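/- Let $p$ be a prime and let $\mathrm{GSp}_4=\{g\in \mathrm{GL}_4 : gJg^{t}=c(g)J\}$, where $J=\begin{pmatrix}0&s\\-s&0\end{pmatrix}$, $s=\begin{pmatrix}0&1\\1&0\end{pmatrix}$. Put $G=\mathrm{GSp}_4(\mathbb{Q}_p)$ and $K=\mathrm{GSp}_4(\mathbb{Z}_p)$. For subgroups $K',K''$ of $G$ conjugate to $K$, let $\mathbb{Z}[K'\backslash G/K'']$ be the group of left $K'$-invariant, right $K''$-invariant functions $G\to\mathbb{Z}$ supported on finitely many double cosets. Composition $\mathbb{Z}[K'\backslash G/K'']\times\mathbb{Z}[K''\backslash G/K''']\to\mathbb{Z}[K'\backslash G/K''']$ is the convolution $$(f\circ h)(x)=\sum_{y\in G/K''}f(y)\,h(y^{-1}x),$$ which makes $\mathbb{Z}[K'\backslash G/K']$ a ring with unit $\mathrm{char}(K')$. Let $g_0,g_2\in G$ and let $K_i=g_iKg_i^{-1}$ for $i=0,2$; each $K_i$ is identified with $K$ through conjugation by $g_i$. In $\mathbb{Z}[K_i\backslash G/K_i]$ let $T_{p,0},T_{p,1},T_{p,2},T_{p^2,2}$ be the elements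 $\mathrm{char}(K_i\,g_i\,t\,g_i^{-1}K_i)$ for $t=\mathrm{diag}(p,p,p,p)$, $\mathrm{diag}(p^2,p,p,1)$, $\mathrm{diag}(p,p,1,1)$, $\mathrm{diag}(p^2,p^2,1,1)$ respectively, and let $$T_{02}=\mathrm{char}\bigl(K_2\,g_2\,\mathrm{diag}(p,p,1,1)\,g_0^{-1}K_0\bigr)\in\mathbb{Z}[K_2\backslash G/K_0],\qquad T_{20}=\mathrm{char}\bigl(K_0\,g_0\,\mathrm{diag}(p^{-1},p^{-1},1,1)\,g_2^{-1}K_2\bigr)\in\mathbb{Z}[K_0\backslash G/K_2].$$ (1) For $i=0,2$ the element $T_{p,0}$ is a unit of $\mathbb{Z}[K_i\backslash G/K_i]$, and the compositions $T_{20}\circ T_{02}\in\mathbb{Z}[K_0\backslash G/K_0]$ and $T_{02}\circ T_{20}\in\mathbb{Z}[K_2\backslash G/K_2]$ are both given (for $i=0$ and $i=2$ respectively) by $$T_{p,0}^{-1}T_{p^2,2}+(p+1)\,T_{p,0}^{-1}T_{p,1}+(p^2+1)(p+1).$$ (2) Consequently, on every module over $\mathbb{Z}[K_0\backslash G/K_0]$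 on which $T_{p,0}$ acts trivially (as the identity), $T_{20}\circ T_{02}$ acts as $T_{p,2}^2$; and on every module over $\mathbb{Z}[K_2\backslash G/K_2]$ on which $T_{p,0}$ acts trivially, $T_{02}\circ T_{20}$ acts as $T_{p,2}^2$. (3) This applies to the correspondences between vertex lattices. Equip $V=\mathbb{Q}_p^4$ with the form $\langle x,y\rangle=x^{t}Jy$. A vertex lattice of type $0$, resp. of type $2$, is a $\mathbb{Z}_p$-lattice $\Lambda$ in $V$ with $\Lambda=\Lambda^\vee$, resp. $\Lambda=p\Lambda^\vee$. If $\Lambda_2\subseteq\Lambda_0$ are vertex lattices of types $2$ and $0$, there are $g_0,g_2\in G$ such that $K_0$ and $K_2$ as above are the stabilizers of $\Lambda_0$ and $\Lambda_2$ in $G$, that $T_{02}$ is the characteristic function of the set of $x\in G$ for which $x\Lambda_0$ is a vertex lattice of type $0$ containing $\Lambda_2$, and that $T_{20}$ is the characteristic function of the set of $x\in G$ for which $x\Lambda_2$ is a vertex lattice of type $2$ contained in $\Lambda_0$. -/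

import Mathlib

open scoped Pointwise

universe u v

/-- `ℤ[K \ G / L]`: the integer-valued functions on `G` that are left `K`-invariant and right
`L`-invariant, and whose support is a finite union of cosets `x L`.  (If every double coset
`K x L` is a finite union of cosets `y L`, as for open compact subgroups, this is the free abelian
group on the characteristic functions of the double cosets.) -/
def heckeModule {G : Type u} [Group G] (K L : Subgroup G) : AddSubgroup (G → ℤ) where
  carrier := {f | (∀ k ∈ K, ∀ l ∈ L, ∀ x, f (k * x * l) = f x) ∧
    ((fun x : G => (x : G ⧸ L)) '' Function.support f).Finite}
  zero_mem' := by simp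
  add_mem' := by
    rintro f g ⟨hf, hf'⟩ ⟨hg, hg'⟩
    refine ⟨fun k hk l hl x => by simp [hf k hk l hl, hg k hk l hl], ?_⟩
    refine (hf'.union hg').subset ?_
    rw [← Set.image_union]
    exact Set.image_mono (Function.support_add f g)
  neg_mem' := by
    rintro f ⟨hf, hf'⟩
    exact ⟨fun k hk l hl x => by simp [hf k hk l hl], by simpa using hf'⟩

namespace heckeModule

variable {G : Type u} [Group G] {H K L M : Subgroup G}

theorem right_invariant (f : heckeModule K L) {l : G} (hl : l ∈ L) (x : G) : f.1 (x * l) = f.1 x := by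
  simpa using f.2.1 1 K.one_mem l hl x

theorem left_invariant (f : heckeModule K L) {k : G} (hk : k ∈ K) (x : G) : f.1 (k * x) = f.1 x := by
  simpa using f.2.1 k hk 1 L.one_mem x

theorem term_eq (f : heckeModule K L) (g : heckeModule L M) (x y : G) :
    f.1 (y : G ⧸ L).out * g.1 ((y : G ⧸ L).out⁻¹ * x) = f.1 y * g.1 (y⁻¹ * x) := by
  obtain ⟨l, hl⟩ := QuotientGroup.mk_out_eq_mul L y
  rw [hl, right_invariant f l.2, mul_inv_rev, mul_assoc, left_invariant g (L.inv_mem l.2)]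

/-- The value at `x` of the convolution `f * g`: the sum of `f(y) g(y⁻¹ x)` over `y ∈ G / L`.
The summand depends only on the coset `y L`, and only finitely many summands are nonzero. -/
noncomputable def convFun (f : heckeModule K L) (g : heckeModule L M) (x : G) : ℤ :=
  ∑ᶠ c : G ⧸ L, f.1 c.out * g.1 (c.out⁻¹ * x)

/-- The finite set of cosets on which `f` is supported. -/
noncomputable def supp (f : heckeModule K L) : Finset (G ⧸ L) := f.2.2.toFinset

theorem mem_supp (f : heckeModule K L) {x : G} (h : f.1 x ≠ 0) : (x : G ⧸ L) ∈ supp f := by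
  simp only [supp, Set.Finite.mem_toFinset]
  exact ⟨x, h, rfl⟩

theorem convFun_eq_sum (f : heckeModule K L) (g : heckeModule L M) (x : G)
    (s : Finset (G ⧸ L)) (hs : supp f ⊆ s) :
    convFun f g x = ∑ c ∈ s, f.1 c.out * g.1 (c.out⁻¹ * x) := by
  refine finsum_eq_sum_of_support_subset _ fun c hc => ?_
  apply hs
  have := mem_supp f (x := c.out) (left_ne_zero_of_mul hc)
  simpa using this

/-- The composition (convolution product) `ℤ[K \ G / L] × ℤ[L \ G / M] → ℤ[K \ G / M]`. -/
noncomputable def conv (f : heckeModule K L) (g : heckeModule L M) : heckeModule K M :=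
  ⟨convFun f g, by
    classical
    constructor
    · intro k hk m hm x
      have h1 : ∀ c : G ⧸ L, f.1 (k • c).out * g.1 ((k • c).out⁻¹ * (k * x * m))
          = f.1 c.out * g.1 (c.out⁻¹ * x) := by
        intro c
        have hc : k • c = ((k * c.out : G) : G ⧸ L) := by
          conv_lhs => rw [← QuotientGroup.out_eq' c]
          rfl
        rw [hc, term_eq f g, left_invariant f hk, ← right_invariant g hm (c.out⁻¹ * x)]
        congr 2
        group
      unfold convFun
      rw [← finsum_comp_equiv (MulAction.toPerm k : Equiv.Perm (G ⧸ L))]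
      exact finsum_congr h1
    · refine (((supp f) ×ˢ (supp g)).image (fun q => q.1.out • q.2)).finite_toSet.subset ?_
      rintro _ ⟨x, hx, rfl⟩
      have hx' : convFun f g x ≠ 0 := hx
      rw [convFun_eq_sum f g x _ subset_rfl] at hx'
      obtain ⟨c, hc, hne⟩ := Finset.exists_ne_zero_of_sum_ne_zero hx'
      have h2 := mem_supp g (right_ne_zero_of_mul hne)
      simp only [Finset.coe_image, Set.mem_image, Finset.mem_coe, Finset.mem_product]
      refine ⟨(c, _), ⟨hc, h2⟩, ?_⟩
      change ((c.out * (c.out⁻¹ * x) : G) : G ⧸ M) = _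
      simp⟩

theorem conv_apply (f : heckeModule K L) (g : heckeModule L M) (x : G) :
    (conv f g).1 x = ∑ᶠ c : G ⧸ L, f.1 c.out * g.1 (c.out⁻¹ * x) := rfl

theorem conv_apply_sum (f : heckeModule K L) (g : heckeModule L M) (x : G)
    (s : Finset (G ⧸ L)) (hs : supp f ⊆ s) :
    (conv f g).1 x = ∑ c ∈ s, f.1 c.out * g.1 (c.out⁻¹ * x) := convFun_eq_sum f g x s hs

theorem conv_add (f : heckeModule K L) (g g' : heckeModule L M) :
    conv f (g + g') = conv f g + conv f g' := by
  ext x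
  have e : (conv f g + conv f g').1 x = (conv f g).1 x + (conv f g').1 x := rfl
  rw [e]
  simp only [conv_apply_sum f _ x _ subset_rfl, ← Finset.sum_add_distrib]
  refine Finset.sum_congr rfl fun c _ => ?_
  exact mul_add _ _ _

theorem add_conv (f f' : heckeModule K L) (g : heckeModule L M) :
    conv (f + f') g = conv f g + conv f' g := by
  classical
  ext x
  have e : (conv f g + conv f' g).1 x = (conv f g).1 x + (conv f' g).1 x := rfl
  rw [e]
  set s := supp f ∪ supp f' ∪ supp (f + f')
  rw [conv_apply_sum f g x s (by intro c; simp +contextual [s]),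
    conv_apply_sum f' g x s (by intro c; simp +contextual [s]),
    conv_apply_sum (f + f') g x s (by intro c; simp +contextual [s]), ← Finset.sum_add_distrib]
  refine Finset.sum_congr rfl fun c _ => ?_
  exact add_mul _ _ _

theorem conv_assoc (f : heckeModule H K) (g : heckeModule K L) (h : heckeModule L M) :
    conv (conv f g) h = conv f (conv g h) := by
  classical
  ext x
  set s := supp f
  set t := ((supp f) ×ˢ (supp g)).image (fun q => q.1.out • q.2) ∪ supp (conv f g) with ht
  rw [conv_apply_sum (conv f g) h x t Finset.subset_union_right,
    conv_apply_sum f (conv g h) x s subset_rfl]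
  simp_rw [conv_apply_sum f g _ s subset_rfl, Finset.sum_mul]
  rw [Finset.sum_comm]
  refine Finset.sum_congr rfl fun c hc => ?_
  simp_rw [mul_assoc]
  rw [← Finset.mul_sum]
  congr 1
  rw [conv_apply, ← finsum_comp_equiv (MulAction.toPerm c.out⁻¹ : Equiv.Perm (G ⧸ L))]
  symm
  have key : ∀ d : G ⧸ L, g.1 (c.out⁻¹ • d).out * h.1 ((c.out⁻¹ • d).out⁻¹ * (c.out⁻¹ * x))
      = g.1 (c.out⁻¹ * d.out) * h.1 (d.out⁻¹ * x) := by
    intro d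
    have hd : c.out⁻¹ • d = ((c.out⁻¹ * d.out : G) : G ⧸ L) := by
      conv_lhs => rw [← QuotientGroup.out_eq' d]
      rfl
    rw [hd, term_eq g h]
    congr 2
    group
  refine (finsum_congr key).trans ?_
  refine finsum_eq_sum_of_support_subset _ fun d hd => ?_
  have h2 := mem_supp g (left_ne_zero_of_mul hd)
  simp only [ht, Finset.coe_union, Set.mem_union, Finset.coe_image, Set.mem_image, Finset.mem_coe]
  left
  refine ⟨(c, _), Finset.mem_product.2 ⟨hc, h2⟩, ?_⟩
  change ((c.out * (c.out⁻¹ * d.out) : G) : G ⧸ L) = _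
  simp

/-- The unit of the Hecke ring: the characteristic function of `K`. -/
noncomputable def unit (K : Subgroup G) : heckeModule K K :=
  ⟨(K : Set G).indicator 1, by
    classical
    constructor
    · intro k hk l hl x
      have : k * x * l ∈ K ↔ x ∈ K := by
        rw [K.mul_mem_cancel_right hl, K.mul_mem_cancel_left hk]
      simp [Set.indicator_apply, this]
    · refine (Set.finite_singleton ((1 : G) : G ⧸ K)).subset ?_
      rintro _ ⟨x, hx, rfl⟩
      have hx' : x ∈ K := by
        by_contra hn
        exact hx (Set.indicator_of_notMem hn _)
      simpa [QuotientGroup.eq] using hx'⟩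

theorem unit_conv (f : heckeModule K L) : conv (unit K) f = f := by
  classical
  ext x
  have hs : supp (unit K) ⊆ {((1 : G) : G ⧸ K)} := by
    intro c hc
    simp only [supp, Set.Finite.mem_toFinset] at hc
    obtain ⟨y, hy, rfl⟩ := hc
    have hy' : y ∈ K := by
      by_contra hn
      exact hy (Set.indicator_of_notMem hn _)
    simpa [QuotientGroup.eq] using hy'
  rw [conv_apply_sum _ _ x _ hs, Finset.sum_singleton, term_eq]
  simp [unit, K.one_mem]

theorem conv_unit (f : heckeModule K L) : conv f (unit L) = f := by
  classical
  ext x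
  rw [conv_apply_sum f _ x ({((x : G) : G ⧸ L)} ∪ supp f) Finset.subset_union_right]
  rw [Finset.sum_eq_single_of_mem ((x : G) : G ⧸ L) (by simp)]
  · rw [term_eq]
    simp [unit, L.one_mem]
  · intro c _ hc
    have : c.out⁻¹ * x ∉ L := by
      intro hn
      apply hc
      rw [← QuotientGroup.eq] at hn
      simpa using hn
    simp [unit, this]

/-- The Hecke ring `ℤ[K \ G / K]`, with convolution as product. -/
noncomputable instance instRing (K : Subgroup G) : Ring (heckeModule K K) where
  __ := (inferInstance : AddCommGroup (heckeModule K K))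
  mul := conv
  one := unit K
  mul_assoc := conv_assoc
  one_mul := unit_conv
  mul_one := conv_unit
  left_distrib := conv_add
  right_distrib := add_conv
  zero_mul f := by
    have h := add_conv (0 : heckeModule K K) 0 f
    rw [add_zero] at h
    exact left_eq_add.1 h
  mul_zero f := by
    have h := conv_add f (0 : heckeModule K K) 0
    rw [add_zero] at h
    exact left_eq_add.1 h

theorem mul_def (f g : heckeModule K K) : f * g = conv f g := rfl

end heckeModule

/-- The antisymmetric matrix `J = (0 s; -s 0)` with `s = (0 1; 1 0)`. -/
def matJ (R : Type v) [CommRing R] : Matrix (Fin 4) (Fin 4) R :=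
  !![0, 0, 0, 1; 0, 0, 1, 0; 0, -1, 0, 0; -1, 0, 0, 0]

/-- `GSp₄(R)`: the `g ∈ GL₄(R)` with `g J gᵗ = c(g) J` for some unit `c(g)`. -/
def GSp4 (R : Type v) [CommRing R] : Subgroup (GL (Fin 4) R) where
  carrier := {g | ∃ c : Rˣ, g.1 * matJ R * g.1.transpose = (c : R) • matJ R}
  one_mem' := ⟨1, by simp⟩
  mul_mem' := by
    rintro g h ⟨c, hc⟩ ⟨d, hd⟩
    refine ⟨c * d, ?_⟩
    calc (g * h).1 * matJ R * (g * h).1.transpose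
        = g.1 * (h.1 * matJ R * h.1.transpose) * g.1.transpose := by
          simp [Matrix.transpose_mul, Matrix.mul_assoc]
      _ = _ := by
          rw [hd, Matrix.mul_smul, Matrix.smul_mul, hc, smul_smul, Units.val_mul, mul_comm]
  inv_mem' := by
    rintro g ⟨c, hc⟩
    refine ⟨c⁻¹, ?_⟩
    have h1 : (g⁻¹).1 * g.1 = 1 := by rw [← Units.val_mul]; simp
    have h2 : g.1.transpose * (g⁻¹).1.transpose = 1 := by
      rw [← Matrix.transpose_mul, h1, Matrix.transpose_one]
    have h3 : matJ R = ((c⁻¹ : Rˣ) : R) • (g.1 * matJ R * g.1.transpose) := by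
      rw [hc, smul_smul]; simp
    calc (g⁻¹).1 * matJ R * (g⁻¹).1.transpose
        = ((c⁻¹ : Rˣ) : R) • (((g⁻¹).1 * g.1) * matJ R *
            (g.1.transpose * (g⁻¹).1.transpose)) := by
          conv_lhs => rw [h3]
          simp only [Matrix.mul_smul, Matrix.smul_mul, Matrix.mul_assoc]
      _ = _ := by rw [h1, h2, Matrix.one_mul, Matrix.mul_one]

section padic

variable (p : ℕ) [Fact p.Prime]

/-- `GSp₄(ℤ_p)` as a subgroup of `GSp₄(ℚ_p)`. -/
noncomputable def GSp4Int : Subgroup (GSp4 ℚ_[p]) :=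
  ((GSp4 ℤ_[p]).map (Matrix.GeneralLinearGroup.map (algebraMap ℤ_[p] ℚ_[p]))).subgroupOf
    (GSp4 ℚ_[p])

/-- The hyperspecial subgroup `g GSp₄(ℤ_p) g⁻¹` of `GSp₄(ℚ_p)`. -/
noncomputable def hyperspecial (g : GSp4 ℚ_[p]) : Subgroup (GSp4 ℚ_[p]) :=
  (GSp4Int p).map (MulAut.conj g).toMonoidHom

/-- The element `diag(p^a, p^b, p^c, p^d)` of `GSp₄(ℚ_p)`, where `a + d = b + c`. -/
noncomputable def torusElt (a b c d : ℤ) (h : a + d = b + c) : GSp4 ℚ_[p] :=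
  ⟨Matrix.GeneralLinearGroup.mkOfDetNeZero
      (Matrix.diagonal ![(p : ℚ_[p]) ^ a, (p : ℚ_[p]) ^ b, (p : ℚ_[p]) ^ c, (p : ℚ_[p]) ^ d])
      (by
        have hp : (p : ℚ_[p]) ≠ 0 := by exact_mod_cast (Fact.out : p.Prime).ne_zero
        simp [Matrix.det_diagonal, Fin.prod_univ_four, hp, zpow_ne_zero]), by
    have hp : (p : ℚ_[p]) ≠ 0 := by exact_mod_cast (Fact.out : p.Prime).ne_zero
    have h1 : (p : ℚ_[p]) ^ a * (p : ℚ_[p]) ^ d = (p : ℚ_[p]) ^ b * (p : ℚ_[p]) ^ c := by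
      rw [← zpow_add₀ hp, ← zpow_add₀ hp, h]
    refine ⟨Units.mk0 ((p : ℚ_[p]) ^ a * (p : ℚ_[p]) ^ d)
      (mul_ne_zero (zpow_ne_zero _ hp) (zpow_ne_zero _ hp)), ?_⟩
    change Matrix.diagonal _ * matJ ℚ_[p] * (Matrix.diagonal _).transpose = _
    rw [Matrix.diagonal_transpose]
    ext i j
    rw [Matrix.mul_diagonal, Matrix.diagonal_mul]
    fin_cases i <;> fin_cases j <;> simp [matJ] <;>
      first | linear_combination h1 | linear_combination -h1 | linear_combination 0 * h1⟩

theorem mem_GSp4Int_of (y : GSp4 ℚ_[p]) (Y Z : Matrix (Fin 4) (Fin 4) ℤ_[p])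
    (hY : y.1.1 = Y.map (algebraMap ℤ_[p] ℚ_[p]))
    (hZ : (y.1⁻¹).1 = Z.map (algebraMap ℤ_[p] ℚ_[p])) : y ∈ GSp4Int p := by
  have inj : Function.Injective
      (fun A : Matrix (Fin 4) (Fin 4) ℤ_[p] => A.map (algebraMap ℤ_[p] ℚ_[p])) :=
    Matrix.map_injective (FaithfulSMul.algebraMap_injective ℤ_[p] ℚ_[p])
  have h1 : Y * Z = 1 := by
    apply inj
    simp only [Matrix.map_mul, ← hY, ← hZ]
    rw [← Units.val_mul, mul_inv_cancel, Units.val_one, Matrix.map_one _ (map_zero _) (map_one _)]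
  have h2 : Z * Y = 1 := by
    apply inj
    simp only [Matrix.map_mul, ← hY, ← hZ]
    rw [← Units.val_mul, inv_mul_cancel, Units.val_one, Matrix.map_one _ (map_zero _) (map_one _)]
  have hJ : (matJ ℤ_[p]).map (algebraMap ℤ_[p] ℚ_[p]) = matJ ℚ_[p] := by
    ext i j
    fin_cases i <;> fin_cases j <;> simp [matJ]
  obtain ⟨c, hc⟩ := y.2
  obtain ⟨c', hc'⟩ := (y⁻¹).2
  have hc2 : (y.1⁻¹).1 * matJ ℚ_[p] * (y.1⁻¹).1.transpose = (c' : ℚ_[p]) • matJ ℚ_[p] := hc'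
  have e1 : (c : ℚ_[p]) = algebraMap ℤ_[p] ℚ_[p] ((Y * matJ ℤ_[p] * Y.transpose) 0 3) := by
    have := congrFun (congrFun hc 0) 3
    rw [hY, ← hJ, ← Matrix.transpose_map, ← Matrix.map_mul, ← Matrix.map_mul] at this
    simpa [matJ] using this.symm
  have e2 : (c' : ℚ_[p]) = algebraMap ℤ_[p] ℚ_[p] ((Z * matJ ℤ_[p] * Z.transpose) 0 3) := by
    have := congrFun (congrFun hc2 0) 3
    rw [hZ, ← hJ, ← Matrix.transpose_map, ← Matrix.map_mul, ← Matrix.map_mul] at this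
    simpa [matJ] using this.symm
  set u := (Y * matJ ℤ_[p] * Y.transpose) 0 3
  set w := (Z * matJ ℤ_[p] * Z.transpose) 0 3
  have hYJ : Y * matJ ℤ_[p] * Y.transpose = u • matJ ℤ_[p] := by
    apply inj
    change Matrix.map _ _ = Matrix.map _ _
    rw [Matrix.map_mul, Matrix.map_mul, Matrix.transpose_map, hJ, ← hY, hc, e1, ← hJ]
    ext i j
    simp
  have hZJ : Z * matJ ℤ_[p] * Z.transpose = w • matJ ℤ_[p] := by
    apply inj
    change Matrix.map _ _ = Matrix.map _ _
    rw [Matrix.map_mul, Matrix.map_mul, Matrix.transpose_map, hJ, ← hZ, hc2, e2, ← hJ]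
    ext i j
    simp
  have huw : u * w = 1 := by
    have h3 : Z * (Y * matJ ℤ_[p] * Y.transpose) * Z.transpose = matJ ℤ_[p] := by
      calc _ = (Z * Y) * matJ ℤ_[p] * (Z * Y).transpose := by
            simp only [Matrix.transpose_mul, Matrix.mul_assoc]
        _ = _ := by simp [h2]
    rw [hYJ, Matrix.mul_smul, Matrix.smul_mul, hZJ, smul_smul] at h3
    have := congrFun (congrFun h3 0) 3
    simpa [matJ] using this
  refine ⟨⟨Y, Z, h1, h2⟩, ⟨Units.mkOfMulEqOne u w huw, hYJ⟩, ?_⟩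
  ext1
  exact hY.symm

theorem exists_pow_smul_eq_map (A : Matrix (Fin 4) (Fin 4) ℚ_[p]) :
    ∃ N : ℕ, ∀ n, N ≤ n → ∃ B : Matrix (Fin 4) (Fin 4) ℤ_[p],
      ((p : ℚ_[p]) ^ n) • A = B.map (algebraMap ℤ_[p] ℚ_[p]) := by
  classical
  obtain ⟨b, hb⟩ := IsLocalization.exist_integer_multiples_of_finset (nonZeroDivisors ℤ_[p])
    (Finset.univ.image (fun q : Fin 4 × Fin 4 => A q.1 q.2))
  have hb0 : (b : ℤ_[p]) ≠ 0 := nonZeroDivisors.ne_zero b.2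
  refine ⟨(b : ℤ_[p]).valuation, fun n hn => ?_⟩
  have key : ∀ i j, ∃ z : ℤ_[p], algebraMap ℤ_[p] ℚ_[p] z = (p : ℚ_[p]) ^ n * A i j := by
    intro i j
    obtain ⟨z, hz⟩ := hb (A i j) (Finset.mem_image.2 ⟨(i, j), Finset.mem_univ _, rfl⟩)
    have hu := PadicInt.unitCoeff_spec hb0
    refine ⟨((PadicInt.unitCoeff hb0)⁻¹ : ℤ_[p]ˣ) * (p : ℤ_[p]) ^ (n - (b : ℤ_[p]).valuation) * z,
      ?_⟩
    rw [map_mul, hz, Algebra.smul_def, ← mul_assoc, ← map_mul]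
    congr 1
    have : ((PadicInt.unitCoeff hb0)⁻¹ : ℤ_[p]ˣ) * (p : ℤ_[p]) ^ (n - (b : ℤ_[p]).valuation) * b
        = (p : ℤ_[p]) ^ n := by
      refine (congrArg (fun t => ((PadicInt.unitCoeff hb0)⁻¹ : ℤ_[p]ˣ) *
        (p : ℤ_[p]) ^ (n - (b : ℤ_[p]).valuation) * t) hu).trans ?_
      calc _ = (((PadicInt.unitCoeff hb0)⁻¹ : ℤ_[p]ˣ) * (PadicInt.unitCoeff hb0 : ℤ_[p])) *
            ((p : ℤ_[p]) ^ (n - (b : ℤ_[p]).valuation) * (p : ℤ_[p]) ^ (b : ℤ_[p]).valuation) := by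
            ring
        _ = _ := by rw [Units.inv_mul, one_mul, ← pow_add, Nat.sub_add_cancel hn]
    rw [this]
    simp
  choose B hB using key
  refine ⟨Matrix.of B, ?_⟩
  ext i j
  simp only [Matrix.smul_apply, smul_eq_mul, Matrix.map_apply, Matrix.of_apply]
  rw [hB]

/-- Each double coset of `GSp₄(ℤ_p)` in `GSp₄(ℚ_p)` is a finite union of cosets. -/
theorem finite_cosets (x : GSp4 ℚ_[p]) :
    ((fun k : GSp4 ℚ_[p] => ((k * x : GSp4 ℚ_[p]) : GSp4 ℚ_[p] ⧸ GSp4Int p)) ''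
      (GSp4Int p : Set (GSp4 ℚ_[p]))).Finite := by
  obtain ⟨N1, h1⟩ := exists_pow_smul_eq_map p x.1.1
  obtain ⟨N2, h2⟩ := exists_pow_smul_eq_map p (x.1⁻¹).1
  set N := max N1 N2
  obtain ⟨B, hB⟩ := h1 N (le_max_left _ _)
  obtain ⟨C, hC⟩ := h2 N (le_max_right _ _)
  have key : ∀ s : ((fun k : GSp4 ℚ_[p] => ((k * x : GSp4 ℚ_[p]) : GSp4 ℚ_[p] ⧸ GSp4Int p)) ''
      (GSp4Int p : Set (GSp4 ℚ_[p]))), ∃ h : GL (Fin 4) ℤ_[p], ∃ k : GSp4 ℚ_[p],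
      k.1 = Matrix.GeneralLinearGroup.map (algebraMap ℤ_[p] ℚ_[p]) h ∧
      ((k * x : GSp4 ℚ_[p]) : GSp4 ℚ_[p] ⧸ GSp4Int p) = s.1 := by
    rintro ⟨_, k, ⟨h, -, hh⟩, rfl⟩
    exact ⟨h, k, hh.symm, rfl⟩
  choose h k hk hs using key
  have : NeZero (p ^ (N + N)) := ⟨pow_ne_zero _ (Fact.out : p.Prime).ne_zero⟩
  refine Set.finite_coe_iff.1 (Finite.of_injective
    (fun s => (h s).1.map (PadicInt.toZModPow (p := p) (N + N))) ?_)
  have close : ∀ s t, (h s).1.map (PadicInt.toZModPow (p := p) (N + N)) =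
      (h t).1.map (PadicInt.toZModPow (p := p) (N + N)) →
      ∃ Y : Matrix (Fin 4) (Fin 4) ℤ_[p],
        ((x.1⁻¹ * ((k s).1⁻¹ * (k t).1) * x.1 : GL (Fin 4) ℚ_[p])).1 =
          Y.map (algebraMap ℤ_[p] ℚ_[p]) := by
    intro s t hst
    have hX : ∀ i j, ∃ z : ℤ_[p], (h t).1 i j = (h s).1 i j + (p : ℤ_[p]) ^ (N + N) * z := by
      intro i j
      have e := congrFun (congrFun hst i) j
      simp only [Matrix.map_apply] at e
      have e' : (h t).1 i j - (h s).1 i j ∈ RingHom.ker (PadicInt.toZModPow (p := p) (N + N)) := by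
        rw [RingHom.mem_ker, map_sub, e, sub_self]
      rw [PadicInt.ker_toZModPow, Ideal.mem_span_singleton] at e'
      obtain ⟨z, hz⟩ := e'
      exact ⟨z, by rw [← hz]; ring⟩
    choose X hX using hX
    have hX' : (h t).1 = (h s).1 + (p : ℤ_[p]) ^ (N + N) • Matrix.of X := by
      ext i j
      simp [hX i j]
    refine ⟨1 + C * ((h s)⁻¹).1 * Matrix.of X * B, ?_⟩
    have ht : (k t).1.1 = (k s).1.1 + (p : ℚ_[p]) ^ (N + N) •
        (Matrix.of X).map (algebraMap ℤ_[p] ℚ_[p]) := by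
      have e1 : (k t).1.1 = (h t).1.map (algebraMap ℤ_[p] ℚ_[p]) := by rw [hk t]; rfl
      have e2 : (k s).1.1 = (h s).1.map (algebraMap ℤ_[p] ℚ_[p]) := by rw [hk s]; rfl
      rw [e1, e2, hX']
      ext i j
      simp
    have hinv : ((k s).1⁻¹).1 = ((h s)⁻¹).1.map (algebraMap ℤ_[p] ℚ_[p]) := by
      rw [hk s, ← map_inv]; rfl
    have u1 : ((k s).1⁻¹).1 * (k s).1.1 = 1 := by rw [← Units.val_mul]; simp
    have u2 : (x.1⁻¹).1 * x.1.1 = 1 := by rw [← Units.val_mul]; simp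
    calc ((x.1⁻¹ * ((k s).1⁻¹ * (k t).1) * x.1 : GL (Fin 4) ℚ_[p])).1
        = (x.1⁻¹).1 * (((k s).1⁻¹).1 * (k t).1.1) * x.1.1 := rfl
      _ = 1 + ((p : ℚ_[p]) ^ N • (x.1⁻¹).1) * ((k s).1⁻¹).1 *
            (Matrix.of X).map (algebraMap ℤ_[p] ℚ_[p]) * ((p : ℚ_[p]) ^ N • x.1.1) := by
          rw [ht, Matrix.mul_add, u1, Matrix.mul_add, Matrix.add_mul, Matrix.mul_one, u2, pow_add]
          simp only [Matrix.mul_smul, Matrix.smul_mul, smul_smul, Matrix.mul_assoc]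
      _ = _ := by
          rw [hB, hC, hinv]
          ext i j
          simp only [Matrix.map_mul, Matrix.map_add _ (map_add (algebraMap ℤ_[p] ℚ_[p])),
            Matrix.map_one _ (map_zero (algebraMap ℤ_[p] ℚ_[p]))
              (map_one (algebraMap ℤ_[p] ℚ_[p]))]
  intro s t hst
  apply Subtype.ext
  rw [← hs s, ← hs t, QuotientGroup.eq]
  obtain ⟨Y, hY⟩ := close s t hst
  obtain ⟨Z, hZ⟩ := close t s hst.symm
  refine mem_GSp4Int_of p _ Y Z (hY ▸ ?_) (hZ ▸ ?_)
  · congr 1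
    simp [mul_assoc]
  · congr 1
    simp [mul_assoc]

/-- The characteristic function of the double coset `K x L` in `ℤ[K \ GSp₄(ℚ_p) / L]`, for the
hyperspecial subgroups `K = g GSp₄(ℤ_p) g⁻¹` and `L = h GSp₄(ℤ_p) h⁻¹`. -/
noncomputable def charDoubleCoset (g h x : GSp4 ℚ_[p]) :
    heckeModule (hyperspecial p g) (hyperspecial p h) :=
  ⟨(DoubleCoset.doubleCoset x (hyperspecial p g : Set (GSp4 ℚ_[p]))
      (hyperspecial p h : Set (GSp4 ℚ_[p]))).indicator 1, by
    classical
    constructor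
    · intro k hk l hl y
      have : k * y * l ∈ DoubleCoset.doubleCoset x (hyperspecial p g : Set (GSp4 ℚ_[p]))
          (hyperspecial p h : Set (GSp4 ℚ_[p])) ↔
          y ∈ DoubleCoset.doubleCoset x (hyperspecial p g : Set (GSp4 ℚ_[p]))
          (hyperspecial p h : Set (GSp4 ℚ_[p])) := by
        simp only [DoubleCoset.mem_doubleCoset, SetLike.mem_coe]
        constructor
        · rintro ⟨a, ha, b, hb, e⟩
          refine ⟨k⁻¹ * a, mul_mem (inv_mem hk) ha, b * l⁻¹, mul_mem hb (inv_mem hl), ?_⟩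
          have : y = k⁻¹ * (k * y * l) * l⁻¹ := by group
          rw [this, e]
          group
        · rintro ⟨a, ha, b, hb, rfl⟩
          exact ⟨k * a, mul_mem hk ha, b * l, mul_mem hb hl, by group⟩
      simp [Set.indicator_apply, this]
    · refine ((finite_cosets p (g⁻¹ * x * h)).image (fun c =>
        ((g * c.out * h⁻¹ : GSp4 ℚ_[p]) : GSp4 ℚ_[p] ⧸ hyperspecial p h))).subset ?_
      rintro _ ⟨y, hy, rfl⟩
      have hy' : y ∈ DoubleCoset.doubleCoset x (hyperspecial p g : Set (GSp4 ℚ_[p]))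
          (hyperspecial p h : Set (GSp4 ℚ_[p])) := by
        by_contra hn
        exact hy (Set.indicator_of_notMem hn _)
      obtain ⟨_, ⟨a, ha, rfl⟩, _, ⟨b, hb, rfl⟩, rfl⟩ := DoubleCoset.mem_doubleCoset.1 hy'
      refine ⟨_, ⟨a, ha, rfl⟩, ?_⟩
      obtain ⟨l, hl⟩ := QuotientGroup.mk_out_eq_mul (GSp4Int p) (a * (g⁻¹ * x * h))
      simp only [hl]
      rw [QuotientGroup.eq]
      refine ⟨l.1⁻¹ * b, mul_mem (inv_mem l.2) hb, ?_⟩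
      simp only [MulEquiv.coe_toMonoidHom, MulAut.conj_apply]
      group⟩

/-! For `i = 0, 2` let `K_i = g_i GSp₄(ℤ_p) g_i⁻¹`, identified with `GSp₄(ℤ_p)` through
conjugation by `g_i`.  Under these identifications a double coset `GSp₄(ℤ_p) x GSp₄(ℤ_p)`
corresponds to `K_i (g_i x g_j⁻¹) K_j`. -/

/-- The operator `T_{p,0}` of `diag(p, p, p, p)` at level `g GSp₄(ℤ_p) g⁻¹`. -/
noncomputable def Tp0 (g : GSp4 ℚ_[p]) : heckeModule (hyperspecial p g) (hyperspecial p g) :=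
  charDoubleCoset p g g (g * torusElt p 1 1 1 1 (by norm_num) * g⁻¹)

/-- The operator `T_{p,1}` of `diag(p², p, p, 1)` at level `g GSp₄(ℤ_p) g⁻¹`. -/
noncomputable def Tp1 (g : GSp4 ℚ_[p]) : heckeModule (hyperspecial p g) (hyperspecial p g) :=
  charDoubleCoset p g g (g * torusElt p 2 1 1 0 (by norm_num) * g⁻¹)

/-- The operator `T_{p,2}` of `diag(p, p, 1, 1)` at level `g GSp₄(ℤ_p) g⁻¹`. -/
noncomputable def Tp2 (g : GSp4 ℚ_[p]) : heckeModule (hyperspecial p g) (hyperspecial p g) :=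
  charDoubleCoset p g g (g * torusElt p 1 1 0 0 (by norm_num) * g⁻¹)

/-- The operator `T_{p²,2}` of `diag(p², p², 1, 1)` at level `g GSp₄(ℤ_p) g⁻¹`. -/
noncomputable def Tpp2 (g : GSp4 ℚ_[p]) : heckeModule (hyperspecial p g) (hyperspecial p g) :=
  charDoubleCoset p g g (g * torusElt p 2 2 0 0 (by norm_num) * g⁻¹)

/-- The operator `T₀₂ ∈ ℤ[K₂ \ GSp₄(ℚ_p) / K₀]` of `diag(p, p, 1, 1)`. -/
noncomputable def T02 (g₀ g₂ : GSp4 ℚ_[p]) :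
    heckeModule (hyperspecial p g₂) (hyperspecial p g₀) :=
  charDoubleCoset p g₂ g₀ (g₂ * torusElt p 1 1 0 0 (by norm_num) * g₀⁻¹)

/-- The operator `T₂₀ ∈ ℤ[K₀ \ GSp₄(ℚ_p) / K₂]` of `diag(p⁻¹, p⁻¹, 1, 1)`. -/
noncomputable def T20 (g₀ g₂ : GSp4 ℚ_[p]) :
    heckeModule (hyperspecial p g₀) (hyperspecial p g₂) :=
  charDoubleCoset p g₀ g₂ (g₀ * torusElt p (-1) (-1) 0 0 (by norm_num) * g₂⁻¹)

/-- The dual lattice `Λ^∨ = {x | ⟨x, y⟩ ∈ ℤ_p for all y ∈ Λ}` in the symplectic space `ℚ_p⁴` with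
`⟨x, y⟩ = xᵗ J y`. -/
noncomputable def dualLattice (Λ : Submodule ℤ_[p] (Fin 4 → ℚ_[p])) :
    Submodule ℤ_[p] (Fin 4 → ℚ_[p]) :=
  LinearMap.BilinForm.dualSubmodule (Matrix.toBilin' (matJ ℚ_[p])) Λ

/-- Vertex lattices of type `0`: lattices with `Λ = Λ^∨`. -/
def IsVertexLatticeZero (Λ : Submodule ℤ_[p] (Fin 4 → ℚ_[p])) : Prop :=
  Submodule.IsLattice ℚ_[p] Λ ∧ dualLattice p Λ = Λ

/-- Vertex lattices of type `2`: lattices with `Λ = p Λ^∨`. -/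
def IsVertexLatticeTwo (Λ : Submodule ℤ_[p] (Fin 4 → ℚ_[p])) : Prop :=
  Submodule.IsLattice ℚ_[p] Λ ∧ (p : ℤ_[p]) • dualLattice p Λ = Λ

/-- The translate `g Λ`. -/
noncomputable def latticeMap (g : GSp4 ℚ_[p]) (Λ : Submodule ℤ_[p] (Fin 4 → ℚ_[p])) :
    Submodule ℤ_[p] (Fin 4 → ℚ_[p]) :=
  Λ.map ((Matrix.toLin' g.1.1).restrictScalars ℤ_[p])

theorem latticeMap_one (Λ : Submodule ℤ_[p] (Fin 4 → ℚ_[p])) : latticeMap p 1 Λ = Λ := by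
  ext x
  simp [latticeMap]

theorem latticeMap_mul (g h : GSp4 ℚ_[p]) (Λ : Submodule ℤ_[p] (Fin 4 → ℚ_[p])) :
    latticeMap p (g * h) Λ = latticeMap p g (latticeMap p h Λ) := by
  ext x
  simp [latticeMap]

/-- The stabilizer of `Λ` in `GSp₄(ℚ_p)`. -/
noncomputable def latticeStabilizer (Λ : Submodule ℤ_[p] (Fin 4 → ℚ_[p])) :
    Subgroup (GSp4 ℚ_[p]) where
  carrier := {g | latticeMap p g Λ = Λ}
  one_mem' := latticeMap_one p Λ
  mul_mem' := by
    intro g h hg hh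
    have hg' : latticeMap p g Λ = Λ := hg
    have hh' : latticeMap p h Λ = Λ := hh
    change latticeMap p (g * h) Λ = Λ
    rw [latticeMap_mul, hh', hg']
  inv_mem' := by
    intro g hg
    have hg' : latticeMap p g Λ = Λ := hg
    change latticeMap p g⁻¹ Λ = Λ
    conv_lhs => rw [← hg']
    rw [← latticeMap_mul, inv_mul_cancel, latticeMap_one]

end padic

/-! Conjugation by `g_i` moves every computation to the level `K = GSp₄(ℤ_p)`
(`heckeModule.conv_transport`). There the two composites are the products, in the two orders, of the
characteristic functions of the double cosets of `diag(p, p, 1, 1)` and `diag(p⁻¹, p⁻¹, 1, 1)`. A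
Weyl element carries the latter matrix to `p⁻¹ diag(p, p, 1, 1)`, so its double coset gives
`T_{p,0}⁻¹ T_{p,2}`. As `T_{p,0}` is central, both composites equal `T_{p,0}⁻¹ T_{p,2}²`. This
settles the claim about modules and reduces the identity to `T_{p,2}² = T_{p²,2} + (p+1) T_{p,1} +
(p²+1)(p+1) T_{p,0}` (`GSp4.charStd_siegel_sq`).

The double coset of `diag(p, p, 1, 1)` consists of the integral matrices whose similitude factor has
valuation 1 (`GSp4.assoc_siegel_iff`). Hence `T_{p,2}²` lives on integral matrices with similitude
valuation 2, and by the Cartan decomposition only the three double cosets of the formula occur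
(`GSp4.assoc_of_norm_simil_eq_sq`). Its value at `x` is the number of type 2 lattices between `x
ℤ_p⁴` and `ℤ_p⁴` (`GSp4.charStd_siegel_sq_apply`). Modulo `p` these become the Lagrangian planes of
`𝔽_p⁴` that contain two, one or none of the coordinate vectors, according to the representative `x`.
There are `1`, `p + 1` and `(p² + 1)(p + 1)` of them, by double counting over a finite field.

For the vertex lattices, a lattice homothetic to its dual has a symplectic basis up to scaling,
hence is a translate of `ℤ_p⁴` (`GSp4.exists_latticeMap_eq`). Inclusion of translates is then
integrality of a matrix, and the type is the valuation of a similitude factor, so the criterion for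
the double coset of `diag(p, p, 1, 1)` reads as an incidence relation. -/

namespace heckeModule

/-! ### Convolution, conjugation and central elements -/

variable {G : Type u} [Group G] {K L M K' L' M' : Subgroup G}

/-- Lets the convolution be evaluated on any system of representatives: conjugation does not respect
the representatives chosen by `Quotient.out`. -/
theorem conv_apply_of_bijective {ι : Type*} (f : heckeModule K L) (g : heckeModule L M) (x : G)
    (e : ι → G) (he : Function.Bijective fun i => (e i : G ⧸ L)) :
    (conv f g).1 x = ∑ᶠ i, f.1 (e i) * g.1 ((e i)⁻¹ * x) := by
  rw [conv_apply, ← finsum_comp_equiv (Equiv.ofBijective _ he)]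
  exact finsum_congr fun i => term_eq f g x (e i)

theorem bijective_translate {g h : G} (hL : ∀ x, x ∈ L' ↔ h⁻¹ * x * h ∈ L) :
    Function.Bijective fun c : G ⧸ L => ((g * c.out * h⁻¹ : G) : G ⧸ L') := by
  constructor
  · intro c d hcd
    have h1 := QuotientGroup.eq.1 hcd
    rw [hL] at h1
    rw [← QuotientGroup.out_eq' c, ← QuotientGroup.out_eq' d]
    refine QuotientGroup.eq.2 ?_
    convert h1 using 1
    group
  · intro c
    refine ⟨((g⁻¹ * c.out * h : G) : G ⧸ L), ?_⟩
    obtain ⟨l, hl⟩ := QuotientGroup.mk_out_eq_mul L (g⁻¹ * c.out * h)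
    conv_rhs => rw [← QuotientGroup.out_eq' c]
    refine QuotientGroup.eq.2 ?_
    rw [hl, hL]
    convert L.inv_mem l.2 using 1
    group

/-- Conjugation carries bi-invariant functions for `K`, `L` to bi-invariant functions for
`g K g⁻¹`, `h L h⁻¹`. -/
noncomputable def transport (g h : G) (hK : ∀ x, x ∈ K' ↔ g⁻¹ * x * g ∈ K)
    (hL : ∀ x, x ∈ L' ↔ h⁻¹ * x * h ∈ L) : heckeModule K L →+ heckeModule K' L' where
  toFun f := ⟨fun x => f.1 (g⁻¹ * x * h), by
    constructor
    · intro k hk l hl x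
      have := f.2.1 _ ((hK k).1 hk) _ ((hL l).1 hl) (g⁻¹ * x * h)
      refine Eq.trans ?_ this
      change f.1 _ = _
      group
    · refine (f.2.2.image fun c : G ⧸ L => ((g * c.out * h⁻¹ : G) : G ⧸ L')).subset ?_
      rintro _ ⟨y, hy, rfl⟩
      refine ⟨_, ⟨_, hy, rfl⟩, ?_⟩
      obtain ⟨l, hl⟩ := QuotientGroup.mk_out_eq_mul L (g⁻¹ * y * h)
      refine QuotientGroup.eq.2 ?_
      rw [hl, hL]
      convert L.inv_mem l.2 using 1
      group⟩
  map_zero' := rfl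
  map_add' _ _ := rfl

theorem transport_apply (g h : G) (hK : ∀ x, x ∈ K' ↔ g⁻¹ * x * g ∈ K)
    (hL : ∀ x, x ∈ L' ↔ h⁻¹ * x * h ∈ L) (f : heckeModule K L) (x : G) :
    (transport g h hK hL f).1 x = f.1 (g⁻¹ * x * h) := rfl

/-- Substitute `y = g c h⁻¹` in the sum: the intermediate `h` cancels between the two factors, so
the result does not depend on it. -/
theorem conv_transport (g h m : G) (hK : ∀ x, x ∈ K' ↔ g⁻¹ * x * g ∈ K)
    (hL : ∀ x, x ∈ L' ↔ h⁻¹ * x * h ∈ L) (hM : ∀ x, x ∈ M' ↔ m⁻¹ * x * m ∈ M)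
    (f : heckeModule K L) (f' : heckeModule L M) :
    conv (transport g h hK hL f) (transport h m hL hM f') =
      transport g m hK hM (conv f f') := by
  ext x
  rw [conv_apply_of_bijective _ _ _ _ (bijective_translate (g := g) hL), transport_apply,
    conv_apply]
  refine finsum_congr fun c => ?_
  rw [transport_apply, transport_apply]
  congr 2 <;> group

/-- Conjugation by `g` as a homomorphism of Hecke rings. -/
noncomputable def transportRingHom (g : G) (hK : ∀ x, x ∈ K' ↔ g⁻¹ * x * g ∈ K) :
    heckeModule K K →+* heckeModule K' K' where
  __ := transport g g hK hK
  map_one' := by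
    classical
    ext x
    change (unit K).1 (g⁻¹ * x * g) = (unit K').1 x
    simp [unit, Set.indicator_apply, hK x]
  map_mul' f f' := (conv_transport g g g hK hK hK f f').symm

/-- If `f` is the characteristic function of `a L`, then left convolution with `f` is
translation by `a`. -/
theorem central_conv {a : G} (f : heckeModule L L)
    (hf : f.1 = Set.indicator {x | a⁻¹ * x ∈ L} 1) (g : heckeModule L M) (x : G) :
    (conv f g).1 x = g.1 (a⁻¹ * x) := by
  classical
  rw [conv_apply, finsum_eq_single _ (a : G ⧸ L)]
  · rw [term_eq, hf]
    simp [L.one_mem]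
  · intro c hc
    have : a⁻¹ * c.out ∉ L := by
      intro hn
      apply hc
      rw [← QuotientGroup.eq] at hn
      simpa using hn.symm
    rw [hf]
    simp [this]

/-- Only the coset of `a⁻¹ x` contributes. Together with `central_conv` this makes the
characteristic function of a central coset commute with the Hecke ring. -/
theorem conv_central {a : G} (ha : a ∈ Subgroup.center G) (f : heckeModule L L)
    (hf : f.1 = Set.indicator {x | a⁻¹ * x ∈ L} 1) (g : heckeModule M L) (x : G) :
    (conv g f).1 x = g.1 (a⁻¹ * x) := by
  classical
  have ha' : ∀ y, y * a⁻¹ = a⁻¹ * y := fun y =>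
    Subgroup.mem_center_iff.1 ((Subgroup.center G).inv_mem ha) y
  rw [conv_apply, finsum_eq_single _ ((a⁻¹ * x : G) : G ⧸ L)]
  · rw [term_eq, hf]
    have : a⁻¹ * ((a⁻¹ * x)⁻¹ * x) = 1 := by
      rw [← mul_assoc, ← ha']; group
    simp only [Set.indicator_apply, Set.mem_ofPred_eq, this, L.one_mem]
    simp
  · intro c hc
    have : a⁻¹ * (c.out⁻¹ * x) ∉ L := by
      intro hn
      apply hc
      rw [← mul_assoc, ← ha', mul_assoc, ← QuotientGroup.eq] at hn
      simpa using hn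
    rw [hf]
    simp [this]

end heckeModule

/-! ### Similitude factor, inverse and the integrality criterion -/

namespace GSp4

section field

variable {F : Type v} [Field F]

theorem matJ_mul_matJ (R : Type v) [CommRing R] : matJ R * matJ R = -1 := by
  ext i j
  fin_cases i <;> fin_cases j <;> simp [matJ, Matrix.mul_apply, Fin.sum_univ_four]

theorem matJ_transpose (R : Type v) [CommRing R] : (matJ R).transpose = -matJ R := by
  ext i j
  fin_cases i <;> fin_cases j <;> simp [matJ]

/-- The similitude factor `c(g)`. -/
def simil (g : GSp4 F) : F := (g.1.1 * matJ F * g.1.1.transpose) 0 3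

theorem mul_matJ_mul_transpose (g : GSp4 F) :
    g.1.1 * matJ F * g.1.1.transpose = simil g • matJ F := by
  obtain ⟨c, hc⟩ := g.2
  have : simil g = c := by
    rw [simil, hc]
    simp [matJ]
  rw [this, hc]

theorem simil_eq {g : GSp4 F} {c : F} (h : g.1.1 * matJ F * g.1.1.transpose = c • matJ F) :
    simil g = c := by
  rw [simil, h]
  simp [matJ]

theorem simil_ne_zero (g : GSp4 F) : simil g ≠ 0 := by
  obtain ⟨c, hc⟩ := g.2
  rw [simil_eq hc]
  exact c.ne_zero

theorem simil_mul (g h : GSp4 F) : simil (g * h) = simil g * simil h := by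
  apply simil_eq
  calc (g * h).1.1 * matJ F * (g * h).1.1.transpose
      = g.1.1 * (h.1.1 * matJ F * h.1.1.transpose) * g.1.1.transpose := by
        simp [Matrix.transpose_mul, Matrix.mul_assoc]
    _ = _ := by
        rw [mul_matJ_mul_transpose, Matrix.mul_smul, Matrix.smul_mul, mul_matJ_mul_transpose,
          smul_smul, mul_comm]

theorem simil_one : simil (1 : GSp4 F) = 1 := simil_eq (by simp)

theorem simil_inv (g : GSp4 F) : simil g⁻¹ = (simil g)⁻¹ := by
  have := simil_mul g g⁻¹
  rw [mul_inv_cancel, simil_one] at this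
  exact eq_inv_of_mul_eq_one_right this.symm

/-- Solve `g J gᵗ = c(g) J` for the inverse, using `J⁻¹ = -J`. -/
theorem inv_eq (g : GSp4 F) :
    (g⁻¹).1.1 = (simil g)⁻¹ • (matJ F * g.1.1.transpose * -matJ F) := by
  have h1 : g.1.1 * ((simil g)⁻¹ • (matJ F * g.1.1.transpose * -matJ F)) = 1 := by
    rw [Matrix.mul_smul, ← Matrix.mul_assoc, ← Matrix.mul_assoc, mul_matJ_mul_transpose,
      Matrix.smul_mul, Matrix.mul_neg, matJ_mul_matJ, neg_neg, smul_smul,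
      inv_mul_cancel₀ (simil_ne_zero g), one_smul]
  have h2 : (g⁻¹).1.1 * g.1.1 = 1 := by
    rw [← Units.val_mul, ← Subgroup.coe_mul, inv_mul_cancel]; rfl
  calc (g⁻¹).1.1 = (g⁻¹).1.1 * (g.1.1 * ((simil g)⁻¹ • (matJ F * g.1.1.transpose * -matJ F))) := by
        rw [h1, Matrix.mul_one]
    _ = _ := by rw [← Matrix.mul_assoc, h2, Matrix.one_mul]

/-- The group is defined by `g J gᵗ`, but the form `xᵗ J y` transforms by `gᵗ J g`. Inserting the
formula for `g⁻¹` into `g⁻¹ g = 1` passes from one to the other. -/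
theorem transpose_mul_matJ_mul (g : GSp4 F) :
    g.1.1.transpose * matJ F * g.1.1 = simil g • matJ F := by
  have h2 : (g⁻¹).1.1 * g.1.1 = 1 := by
    rw [← Units.val_mul, ← Subgroup.coe_mul, inv_mul_cancel]; rfl
  have h3 : matJ F * ((g⁻¹).1.1 * g.1.1) = matJ F := by rw [h2, Matrix.mul_one]
  rw [inv_eq] at h3
  simp only [Matrix.smul_mul, Matrix.mul_smul, Matrix.mul_neg, Matrix.neg_mul,
    ← Matrix.mul_assoc, matJ_mul_matJ, Matrix.one_mul, neg_neg] at h3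
  conv_rhs => rw [← h3]
  rw [smul_smul, mul_inv_cancel₀ (simil_ne_zero g), one_smul]

/-- The element of `GSp₄(F)` with a given matrix. -/
def ofMatrix (A : Matrix (Fin 4) (Fin 4) F) (c : F) (hc : c ≠ 0)
    (h : A * matJ F * A.transpose = c • matJ F) : GSp4 F :=
  ⟨⟨A, c⁻¹ • (matJ F * A.transpose * -matJ F), by
    rw [Matrix.mul_smul, ← Matrix.mul_assoc, ← Matrix.mul_assoc, h,
      Matrix.smul_mul, Matrix.mul_neg, matJ_mul_matJ, neg_neg, smul_smul,
      inv_mul_cancel₀ hc, one_smul], by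
    rw [mul_eq_one_comm, Matrix.mul_smul, ← Matrix.mul_assoc, ← Matrix.mul_assoc, h,
      Matrix.smul_mul, Matrix.mul_neg, matJ_mul_matJ, neg_neg, smul_smul,
      inv_mul_cancel₀ hc, one_smul]⟩, Units.mk0 c hc, h⟩

theorem simil_ofMatrix (A : Matrix (Fin 4) (Fin 4) F) (c : F) (hc : c ≠ 0)
    (h : A * matJ F * A.transpose = c • matJ F) : simil (ofMatrix A c hc h) = c := simil_eq h

theorem ext_matrix {g h : GSp4 F} (e : g.1.1 = h.1.1) : g = h :=
  Subtype.ext (Units.ext e)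

theorem mul_val (g h : GSp4 F) : (g * h).1.1 = g.1.1 * h.1.1 := rfl

end field

section padic

variable {p : ℕ} [Fact p.Prime]

/-- All matrix entries are `p`-adic integers. -/
def IsIntegral (g : GSp4 ℚ_[p]) : Prop := ∀ i j, ‖g.1.1 i j‖ ≤ 1

/-- Conjugation by `J` reverses the indices up to sign, so `g⁻¹` is, up to signs, `g` reflected in
the antidiagonal and divided by `c(g)`. -/
theorem norm_inv_apply (g : GSp4 ℚ_[p]) (i j : Fin 4) :
    ‖(g⁻¹).1.1 i j‖ = ‖simil g‖⁻¹ * ‖g.1.1 j.rev i.rev‖ := by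
  rw [inv_eq, Matrix.smul_apply, smul_eq_mul, norm_mul, norm_inv]
  congr 1
  fin_cases i <;> fin_cases j <;>
    simp [matJ, Matrix.mul_apply, Fin.sum_univ_four, Matrix.vecMul, dotProduct]

theorem isIntegral_inv_iff (g : GSp4 ℚ_[p]) :
    IsIntegral g⁻¹ ↔ ∀ i j, ‖g.1.1 i j‖ ≤ ‖simil g‖ := by
  have h0 : 0 < ‖simil g‖ := norm_pos_iff.2 (simil_ne_zero g)
  constructor
  · intro h i j
    have := h j.rev i.rev
    rwa [norm_inv_apply, Fin.rev_rev, Fin.rev_rev, inv_mul_le_iff₀ h0, mul_one] at this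
  · intro h i j
    rw [norm_inv_apply, inv_mul_le_iff₀ h0, mul_one]
    exact h _ _

theorem norm_sum_four_le {f : Fin 4 → ℚ_[p]} {r : ℝ} (h : ∀ i, ‖f i‖ ≤ r) : ‖∑ i, f i‖ ≤ r := by
  apply IsUltrametricDist.norm_sum_le_of_forall_le_of_nonneg
  · exact (norm_nonneg _).trans (h 0)
  · exact fun i _ => h i

theorem IsIntegral.mul {g h : GSp4 ℚ_[p]} (hg : IsIntegral g) (hh : IsIntegral h) :
    IsIntegral (g * h) := by
  intro i j
  rw [mul_val, Matrix.mul_apply]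
  refine norm_sum_four_le fun k => ?_
  rw [norm_mul]
  exact mul_le_one₀ (hg _ _) (norm_nonneg _) (hh _ _)

theorem IsIntegral.norm_simil_le {g : GSp4 ℚ_[p]} (hg : IsIntegral g) : ‖simil g‖ ≤ 1 := by
  rw [simil, Matrix.mul_apply]
  refine norm_sum_four_le fun k => ?_
  rw [norm_mul, Matrix.mul_apply, Matrix.transpose_apply]
  refine mul_le_one₀ (norm_sum_four_le fun l => ?_) (norm_nonneg _) (hg _ _)
  rw [norm_mul]
  refine mul_le_one₀ (hg _ _) (norm_nonneg _) ?_
  fin_cases l <;> fin_cases k <;> simp [matJ]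

/-- With a unit similitude factor the inverse of an integral matrix is integral. Conversely `c(g)`
and `c(g⁻¹)` are both integral, hence units. -/
theorem mem_GSp4Int_iff {g : GSp4 ℚ_[p]} : g ∈ GSp4Int p ↔ IsIntegral g ∧ ‖simil g‖ = 1 := by
  constructor
  · rintro ⟨h, -, hh⟩
    have hi : IsIntegral g := fun i j => by
      have : g.1.1 i j = algebraMap ℤ_[p] ℚ_[p] (h.1 i j) := by
        have h2 : Matrix.GeneralLinearGroup.map (algebraMap ℤ_[p] ℚ_[p]) h = g.1 := hh
        rw [← h2]
        rfl
      rw [this]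
      exact (h.1 i j).2
    have hi' : IsIntegral g⁻¹ := fun i j => by
      have : (g⁻¹).1.1 i j = algebraMap ℤ_[p] ℚ_[p] ((h⁻¹).1 i j) := by
        have h2 : Matrix.GeneralLinearGroup.map (algebraMap ℤ_[p] ℚ_[p]) h = g.1 := hh
        change ((g.1)⁻¹ : GL (Fin 4) ℚ_[p]).1 i j = _
        rw [← h2, ← map_inv]
        rfl
      rw [this]
      exact ((h⁻¹).1 i j).2
    refine ⟨hi, le_antisymm hi.norm_simil_le ?_⟩
    have := hi'.norm_simil_le
    rw [simil_inv, norm_inv] at this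
    exact (inv_le_one₀ (norm_pos_iff.2 (simil_ne_zero g))).1 this
  · rintro ⟨hi, hc⟩
    have hi' : IsIntegral g⁻¹ := (isIntegral_inv_iff g).2 (by rw [hc]; exact hi)
    exact mem_GSp4Int_of p g (Matrix.of fun i j => ⟨g.1.1 i j, hi i j⟩)
      (Matrix.of fun i j => ⟨(g⁻¹).1.1 i j, hi' i j⟩) rfl rfl

theorem IsIntegral.of_mem {g : GSp4 ℚ_[p]} (h : g ∈ GSp4Int p) : IsIntegral g :=
  (mem_GSp4Int_iff.1 h).1

theorem ofMatrix_mem (A : Matrix (Fin 4) (Fin 4) ℚ_[p]) (c : ℚ_[p]) (hc : c ≠ 0)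
    (h : A * matJ ℚ_[p] * A.transpose = c • matJ ℚ_[p]) (hA : ∀ i j, ‖A i j‖ ≤ 1)
    (hn : ‖c‖ = 1) : ofMatrix A c hc h ∈ GSp4Int p :=
  mem_GSp4Int_iff.2 ⟨hA, by rwa [simil_ofMatrix]⟩

/-! ### Cartan decomposition by symplectic elimination -/

/-- `x` and `y` lie in the same double coset of `GSp₄(ℤ_p)`. -/
def Assoc (x y : GSp4 ℚ_[p]) : Prop := ∃ a ∈ GSp4Int p, ∃ b ∈ GSp4Int p, y = a * x * b

theorem Assoc.refl (x : GSp4 ℚ_[p]) : Assoc x x := ⟨1, one_mem _, 1, one_mem _, by simp⟩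

theorem Assoc.symm {x y : GSp4 ℚ_[p]} : Assoc x y → Assoc y x := by
  rintro ⟨a, ha, b, hb, rfl⟩
  exact ⟨a⁻¹, inv_mem ha, b⁻¹, inv_mem hb, by group⟩

theorem Assoc.trans {x y z : GSp4 ℚ_[p]} : Assoc x y → Assoc y z → Assoc x z := by
  rintro ⟨a, ha, b, hb, rfl⟩ ⟨c, hc, d, hd, rfl⟩
  exact ⟨c * a, mul_mem hc ha, b * d, mul_mem hb hd, by group⟩

theorem Assoc.norm_simil {x y : GSp4 ℚ_[p]} (h : Assoc x y) : ‖simil y‖ = ‖simil x‖ := by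
  obtain ⟨a, ha, b, hb, rfl⟩ := h
  rw [simil_mul, simil_mul, norm_mul, norm_mul, (mem_GSp4Int_iff.1 ha).2,
    (mem_GSp4Int_iff.1 hb).2, one_mul, mul_one]

theorem Assoc.isIntegral {x y : GSp4 ℚ_[p]} (h : Assoc x y) (hx : IsIntegral x) :
    IsIntegral y := by
  obtain ⟨a, ha, b, hb, rfl⟩ := h
  exact ((IsIntegral.of_mem ha).mul hx).mul (IsIntegral.of_mem hb)

/-- The permutations `i ↦ i xor m` of the index set; they preserve the symplectic form up to
sign. -/
def xorPerm (m i : Fin 4) : Fin 4 :=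
  ![![0, 1, 2, 3], ![1, 0, 3, 2], ![2, 3, 0, 1], ![3, 2, 1, 0]] m i

theorem exists_perm (m : Fin 4) : ∃ w ∈ GSp4Int p,
    w.1.1 = Matrix.of fun i j => if xorPerm m i = j then 1 else 0 := by
  -- `J` pairs `i` with `i xor 3`, which commutes with `xor m`. The sign is `-1` exactly when `m` is
  -- 2 or 3, where the two halves of the index set are exchanged.
  have hJ : (Matrix.of fun i j => if xorPerm m i = j then (1 : ℚ_[p]) else 0) * matJ ℚ_[p] *
      (Matrix.of fun i j => if xorPerm m i = j then (1 : ℚ_[p]) else 0).transpose =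
      (![1, 1, -1, -1] m : ℚ_[p]) • matJ ℚ_[p] := by
    ext i j
    fin_cases m <;> fin_cases i <;> fin_cases j <;>
      simp [matJ, xorPerm, Matrix.mul_apply, Fin.sum_univ_four]
  refine ⟨ofMatrix _ _ ?_ hJ, ofMatrix_mem _ _ _ _ ?_ ?_, rfl⟩
  · fin_cases m <;> simp
  · intro i j
    rw [Matrix.of_apply]
    split_ifs <;> simp
  · fin_cases m <;> simp

/-- As `xorPerm m 0 = m`, a suitable pair of permutations brings any chosen entry to position `(0,
0)`. -/
theorem assoc_perm (g : GSp4 ℚ_[p]) (m n : Fin 4) : ∃ h, Assoc g h ∧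
    ∀ i j, h.1.1 i j = g.1.1 (xorPerm m i) (xorPerm n j) := by
  obtain ⟨w, hw, ew⟩ := exists_perm (p := p) m
  obtain ⟨w', hw', ew'⟩ := exists_perm (p := p) n
  refine ⟨w * g * w', ⟨w, hw, w', hw', rfl⟩, fun i j => ?_⟩
  have hsymm : ∀ k, (xorPerm n k = j) ↔ (k = xorPerm n j) := by
    have key : ∀ n j k : Fin 4, xorPerm n k = j ↔ k = xorPerm n j := by decide
    exact fun k => key n j k
  simp [ew, ew', Matrix.mul_apply, hsymm]

/-- The integral opposite Klingen unipotent radical: the first column below the diagonal is free and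
determines the last row. It clears a column under a pivot. -/
theorem exists_lower (x y z : ℚ_[p]) (hx : ‖x‖ ≤ 1) (hy : ‖y‖ ≤ 1) (hz : ‖z‖ ≤ 1) :
    ∃ w ∈ GSp4Int p, w.1.1 = !![1, 0, 0, 0; x, 1, 0, 0; y, 0, 1, 0; z, y, -x, 1] := by
  have hJ : !![1, 0, 0, 0; x, 1, 0, 0; y, 0, 1, 0; z, y, -x, 1] * matJ ℚ_[p] *
      (!![1, 0, 0, 0; x, 1, 0, 0; y, 0, 1, 0; z, y, -x, 1]).transpose =
      (1 : ℚ_[p]) • matJ ℚ_[p] := by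
    ext i j
    fin_cases i <;> fin_cases j <;>
      simp [matJ, Matrix.mul_apply, Fin.sum_univ_four]
    all_goals ring
  refine ⟨ofMatrix _ _ one_ne_zero hJ, ofMatrix_mem _ _ _ _ ?_ (by simp), rfl⟩
  intro i j
  fin_cases i <;> fin_cases j <;> simp [hx, hy, hz]

theorem exists_upper (x y z : ℚ_[p]) (hx : ‖x‖ ≤ 1) (hy : ‖y‖ ≤ 1) (hz : ‖z‖ ≤ 1) :
    ∃ w ∈ GSp4Int p, w.1.1 = !![1, x, y, z; 0, 1, 0, y; 0, 0, 1, -x; 0, 0, 0, 1] := by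
  have hJ : !![1, x, y, z; 0, 1, 0, y; 0, 0, 1, -x; 0, 0, 0, 1] * matJ ℚ_[p] *
      (!![1, x, y, z; 0, 1, 0, y; 0, 0, 1, -x; 0, 0, 0, 1]).transpose =
      (1 : ℚ_[p]) • matJ ℚ_[p] := by
    ext i j
    fin_cases i <;> fin_cases j <;>
      simp [matJ, Matrix.mul_apply, Fin.sum_univ_four]
    all_goals ring
  refine ⟨ofMatrix _ _ one_ne_zero hJ, ofMatrix_mem _ _ _ _ ?_ (by simp), rfl⟩
  intro i j
  fin_cases i <;> fin_cases j <;> simp [hx, hy, hz]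

/-- The `GL₂` in the Klingen Levi subgroup; the last diagonal entry must be the determinant so that
both hyperbolic planes have the same multiplier. -/
theorem exists_middle (a b c d : ℚ_[p]) (ha : ‖a‖ ≤ 1) (hb : ‖b‖ ≤ 1) (hc : ‖c‖ ≤ 1)
    (hd : ‖d‖ ≤ 1) (h : ‖a * d - b * c‖ = 1) :
    ∃ w ∈ GSp4Int p,
      w.1.1 = !![1, 0, 0, 0; 0, a, b, 0; 0, c, d, 0; 0, 0, 0, a * d - b * c] := by
  have hJ : !![1, 0, 0, 0; 0, a, b, 0; 0, c, d, 0; 0, 0, 0, a * d - b * c] * matJ ℚ_[p] *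
      (!![1, 0, 0, 0; 0, a, b, 0; 0, c, d, 0; 0, 0, 0, a * d - b * c]).transpose =
      (a * d - b * c) • matJ ℚ_[p] := by
    ext i j
    fin_cases i <;> fin_cases j <;>
      simp [matJ, Matrix.mul_apply, Fin.sum_univ_four] <;> ring
  have h0 : a * d - b * c ≠ 0 := by
    rw [← norm_pos_iff, h]
    exact one_pos
  refine ⟨ofMatrix _ _ h0 hJ, ofMatrix_mem _ _ _ _ ?_ h, rfl⟩
  intro i j
  fin_cases i <;> fin_cases j <;> simp [ha, hb, hc, hd, h]

theorem norm_neg_div_le {x y : ℚ_[p]} (h : ‖x‖ ≤ ‖y‖) : ‖-x / y‖ ≤ 1 := by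
  rw [norm_div, norm_neg]
  exact div_le_one_of_le₀ h (norm_nonneg _)

theorem assoc_max (g : GSp4 ℚ_[p]) : ∃ h, Assoc g h ∧ ∀ i j, ‖h.1.1 i j‖ ≤ ‖h.1.1 0 0‖ := by
  obtain ⟨⟨m, n⟩, -, hmn⟩ := Finset.exists_max_image (Finset.univ : Finset (Fin 4 × Fin 4))
    (fun q => ‖g.1.1 q.1 q.2‖) ⟨(0, 0), Finset.mem_univ _⟩
  obtain ⟨h, hgh, e⟩ := assoc_perm g m n
  refine ⟨h, hgh, fun i j => ?_⟩
  have h0 : ∀ m, xorPerm m 0 = m := by decide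
  rw [e, e, h0, h0]
  exact hmn (_, _) (Finset.mem_univ _)

theorem ne_zero_of_max {g : GSp4 ℚ_[p]} (hg : ∀ i j, ‖g.1.1 i j‖ ≤ ‖g.1.1 0 0‖) :
    g.1.1 0 0 ≠ 0 := by
  intro h0
  have h1 : g.1.1 = 0 := by
    ext i j
    have := hg i j
    rw [h0, norm_zero] at this
    exact norm_le_zero_iff.1 this
  apply simil_ne_zero g
  rw [simil, h1]
  simp

theorem assoc_cleared (g : GSp4 ℚ_[p]) : ∃ h, Assoc g h ∧ h.1.1 0 0 ≠ 0 ∧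
    (h.1.1 1 0 = 0 ∧ h.1.1 2 0 = 0 ∧ h.1.1 3 0 = 0) ∧
    (h.1.1 0 1 = 0 ∧ h.1.1 0 2 = 0 ∧ h.1.1 0 3 = 0) := by
  obtain ⟨h, hgh, hmax⟩ := assoc_max g
  have h0 := ne_zero_of_max hmax
  -- The pivot has maximal norm, so the quotients are integral. Left multiplication by `w` fixes the
  -- first row of `h`, hence `w'` may be read off from `h` as well.
  obtain ⟨w, hw, ew⟩ := exists_lower _ _ _ (norm_neg_div_le (hmax 1 0))
    (norm_neg_div_le (hmax 2 0)) (norm_neg_div_le (hmax 3 0))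
  obtain ⟨w', hw', ew'⟩ := exists_upper _ _ _ (norm_neg_div_le (hmax 0 1))
    (norm_neg_div_le (hmax 0 2)) (norm_neg_div_le (hmax 0 3))
  have e : ∀ i j, (w * h * w').1.1 i j = ∑ k, (∑ l, w.1.1 i l * h.1.1 l k) * w'.1.1 k j := by
    intro i j
    simp [Matrix.mul_apply]
  refine ⟨w * h * w', hgh.trans ⟨w, hw, w', hw', rfl⟩, ?_, ⟨?_, ?_, ?_⟩, ?_, ?_, ?_⟩ <;>
    simp only [e, ew, ew', Fin.sum_univ_four] <;> simp [h0] <;> field_simp <;> ring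

/-- Once the first row and column are cleared, the two symplectic relations force the rest of the
last row and column to vanish. -/
theorem assoc_block (g : GSp4 ℚ_[p]) : ∃ h, Assoc g h ∧ ∃ a b c d e f : ℚ_[p],
    h.1.1 = !![a, 0, 0, 0; 0, b, c, 0; 0, d, e, 0; 0, 0, 0, f] := by
  obtain ⟨h, hgh, h0, ⟨h1, h2, h3⟩, h4, h5, h6⟩ := assoc_cleared g
  refine ⟨h, hgh, h.1.1 0 0, h.1.1 1 1, h.1.1 1 2, h.1.1 2 1, h.1.1 2 2, h.1.1 3 3, ?_⟩
  have e1 : h.1.1 1 3 = 0 ∧ h.1.1 2 3 = 0 := by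
    have e := mul_matJ_mul_transpose h
    have c1 := congrFun (congrFun e 0) 1
    have c2 := congrFun (congrFun e 0) 2
    simp [matJ, Matrix.mul_apply, Fin.sum_univ_four, h0, h4, h5, h6] at c1 c2
    exact ⟨c1, c2⟩
  have e2 : h.1.1 3 1 = 0 ∧ h.1.1 3 2 = 0 := by
    have e := transpose_mul_matJ_mul h
    have c1 := congrFun (congrFun e 0) 1
    have c2 := congrFun (congrFun e 0) 2
    simp [matJ, Matrix.mul_apply, Fin.sum_univ_four, h0, h1, h2, h3] at c1 c2
    exact ⟨c1, c2⟩
  ext i j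
  fin_cases i <;> fin_cases j <;> simp [h1, h2, h3, h4, h5, h6, e1, e2]

theorem assoc_block_max (g : GSp4 ℚ_[p]) : ∃ h, Assoc g h ∧ ∃ a b c d e f : ℚ_[p],
    h.1.1 = !![a, 0, 0, 0; 0, b, c, 0; 0, d, e, 0; 0, 0, 0, f] ∧
    ‖c‖ ≤ ‖b‖ ∧ ‖d‖ ≤ ‖b‖ := by
  obtain ⟨h, hgh, a, b, c, d, e, f, eh⟩ := assoc_block g
  obtain ⟨s, hs, es⟩ := exists_middle (p := p) 0 1 1 0 (by simp) (by simp) (by simp) (by simp)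
    (by simp)
  have L : (s * h).1.1 = !![a, 0, 0, 0; 0, d, e, 0; 0, b, c, 0; 0, 0, 0, -f] := by
    rw [mul_val, es, eh]
    ext i j
    fin_cases i <;> fin_cases j <;> simp [Matrix.mul_apply, Fin.sum_univ_four]
  have R : (h * s).1.1 = !![a, 0, 0, 0; 0, c, b, 0; 0, e, d, 0; 0, 0, 0, -f] := by
    rw [mul_val, es, eh]
    ext i j
    fin_cases i <;> fin_cases j <;> simp [Matrix.mul_apply, Fin.sum_univ_four]
  have LR : (s * h * s).1.1 = !![a, 0, 0, 0; 0, e, d, 0; 0, c, b, 0; 0, 0, 0, f] := by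
    rw [mul_val, es, L]
    ext i j
    fin_cases i <;> fin_cases j <;> simp [Matrix.mul_apply, Fin.sum_univ_four]
  have aL : Assoc g (s * h) := hgh.trans ⟨s, hs, 1, one_mem _, by simp⟩
  have aR : Assoc g (h * s) := hgh.trans ⟨1, one_mem _, s, hs, by simp⟩
  have aLR : Assoc g (s * h * s) := hgh.trans ⟨s, hs, s, hs, rfl⟩
  by_cases c1 : ‖c‖ ≤ ‖b‖ ∧ ‖d‖ ≤ ‖b‖
  · exact ⟨_, hgh, _, _, _, _, _, _, eh, c1⟩
  by_cases c2 : ‖b‖ ≤ ‖c‖ ∧ ‖e‖ ≤ ‖c‖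
  · exact ⟨_, aR, _, _, _, _, _, _, R, c2⟩
  by_cases c3 : ‖e‖ ≤ ‖d‖ ∧ ‖b‖ ≤ ‖d‖
  · exact ⟨_, aL, _, _, _, _, _, _, L, c3⟩
  -- An entry of largest norm in the middle block dominates its neighbours in row and column; with
  -- the other three positions excluded it is `e`, which two swaps bring to the upper left corner.
  refine ⟨_, aLR, _, _, _, _, _, _, LR, ?_⟩
  rcases le_total ‖c‖ ‖b‖ with h1 | h1 <;> rcases le_total ‖d‖ ‖b‖ with h2 | h2 <;>
    rcases le_total ‖d‖ ‖e‖ with h3 | h3 <;> rcases le_total ‖c‖ ‖e‖ with h4 | h4 <;>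
    simp_all <;> linarith

theorem assoc_diagonal (g : GSp4 ℚ_[p]) : ∃ h, Assoc g h ∧ ∃ v : Fin 4 → ℚ_[p],
    h.1.1 = Matrix.diagonal v := by
  obtain ⟨h, hgh, a, b, c, d, e, f, eh, hc, hd⟩ := assoc_block_max g
  by_cases hb : b = 0
  · subst hb
    simp only [norm_zero, norm_le_zero_iff] at hc hd
    subst hc hd
    refine ⟨h, hgh, ![a, 0, e, f], ?_⟩
    rw [eh]
    ext i j
    fin_cases i <;> fin_cases j <;> simp [Matrix.diagonal]
  · obtain ⟨w, hw, ew⟩ := exists_middle 1 0 (-d / b) 1 (by simp) (by simp) (norm_neg_div_le hd)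
      (by simp) (by simp)
    obtain ⟨w', hw', ew'⟩ := exists_middle 1 (-c / b) 0 1 (by simp) (norm_neg_div_le hc) (by simp)
      (by simp) (by simp)
    refine ⟨w * h * w', hgh.trans ⟨w, hw, w', hw', rfl⟩, ![a, b, -d / b * c + e, f], ?_⟩
    rw [mul_val, mul_val, ew, ew', eh]
    ext i j
    fin_cases i <;> fin_cases j <;>
      simp [Matrix.diagonal, Matrix.mul_apply, Fin.sum_univ_four] <;> field_simp <;> simp

/-! ### Torus representatives of small similitude valuation -/

theorem torusElt_val (a b c d : ℤ) (h : a + d = b + c) : (torusElt p a b c d h).1.1 =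
    Matrix.diagonal ![(p : ℚ_[p]) ^ a, (p : ℚ_[p]) ^ b, (p : ℚ_[p]) ^ c, (p : ℚ_[p]) ^ d] := rfl

theorem simil_diagonal {g : GSp4 ℚ_[p]} {v : Fin 4 → ℚ_[p]} (h : g.1.1 = Matrix.diagonal v) :
    simil g = v 0 * v 3 ∧ simil g = v 1 * v 2 := by
  have e := mul_matJ_mul_transpose g
  rw [h] at e
  have c1 := congrFun (congrFun e 0) 3
  have c2 := congrFun (congrFun e 1) 2
  simp [matJ, Matrix.mul_apply, Fin.sum_univ_four] at c1 c2
  exact ⟨c1.symm, c2.symm⟩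

/-- The Cartan decomposition. -/
theorem assoc_torusElt (g : GSp4 ℚ_[p]) : ∃ (a b c d : ℤ) (h : a + d = b + c),
    Assoc g (torusElt p a b c d h) := by
  obtain ⟨h, hgh, v, ev⟩ := assoc_diagonal g
  obtain ⟨s1, s2⟩ := simil_diagonal ev
  have hs := simil_ne_zero h
  have hv : ∀ i, v i ≠ 0 := by
    have h1 := hs
    rw [s1] at h1
    rw [s2] at hs
    intro i
    fin_cases i
    exacts [left_ne_zero_of_mul h1, left_ne_zero_of_mul hs, right_ne_zero_of_mul hs,
      right_ne_zero_of_mul h1]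
  have hp1 : (1 : ℝ) < p := by exact_mod_cast (Fact.out : p.Prime).one_lt
  have hsum : (v 0).valuation + (v 3).valuation = (v 1).valuation + (v 2).valuation := by
    rw [← Padic.valuation_mul (hv _) (hv _), ← Padic.valuation_mul (hv _) (hv _), ← s1, ← s2]
  -- Each diagonal entry is a unit times a power of `p`; the diagonal matrix of the inverse units
  -- lies in `GSp₄(ℤ_p)` and is absorbed on the right.
  refine ⟨_, _, _, _, hsum, hgh.trans ⟨1, one_mem _, h⁻¹ * torusElt p _ _ _ _ hsum, ?_,
    by group⟩⟩
  have e : (h⁻¹ * torusElt p _ _ _ _ hsum).1.1 =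
      Matrix.diagonal fun i => (v i)⁻¹ * (p : ℚ_[p]) ^ (v i).valuation := by
    have e1 : (h⁻¹).1.1 = Matrix.diagonal fun i => (v i)⁻¹ := by
      have e2 : (h⁻¹).1.1 * h.1.1 = 1 := by
        rw [← Units.val_mul, ← Subgroup.coe_mul, inv_mul_cancel]; rfl
      have e3 : h.1.1 * (Matrix.diagonal fun i => (v i)⁻¹) = 1 := by
        rw [ev, Matrix.diagonal_mul_diagonal, ← Matrix.diagonal_one]
        congr 1
        ext i
        simp [hv i]
      calc (h⁻¹).1.1 = (h⁻¹).1.1 * (h.1.1 * (Matrix.diagonal fun i => (v i)⁻¹)) := by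
            rw [e3, Matrix.mul_one]
        _ = _ := by rw [← Matrix.mul_assoc, e2, Matrix.one_mul]
    rw [mul_val, e1, torusElt_val, Matrix.diagonal_mul_diagonal]
    congr 1
    ext i
    fin_cases i <;> rfl
  have hn : ∀ i, ‖(v i)⁻¹ * (p : ℚ_[p]) ^ (v i).valuation‖ = 1 := by
    intro i
    rw [norm_mul, norm_inv, Padic.norm_eq_zpow_neg_valuation (hv i), norm_zpow, Padic.norm_p,
      inv_zpow, ← zpow_neg, neg_neg, ← zpow_neg, ← zpow_add₀ (by positivity), add_neg_cancel,
      zpow_zero]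
  rw [mem_GSp4Int_iff]
  constructor
  · intro i j
    rw [e, Matrix.diagonal_apply]
    split_ifs
    · exact (hn i).le
    · simp
  · rw [(simil_diagonal e).1, norm_mul, hn, hn, one_mul]

/-- With the four permutations of `assoc_torusElt_perm` this generates the action of the Weyl group,
of order 8, on the exponents. -/
theorem assoc_torusElt_swap (a b c d : ℤ) (h : a + d = b + c) (h' : a + d = c + b) :
    Assoc (torusElt p a b c d h) (torusElt p a c b d h') := by
  obtain ⟨s, hs, es⟩ := exists_middle (p := p) 0 1 1 0 (by simp) (by simp) (by simp) (by simp)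
    (by simp)
  refine ⟨s, hs, s, hs, ext_matrix ?_⟩
  rw [mul_val, mul_val, es, torusElt_val, torusElt_val]
  ext i j
  fin_cases i <;> fin_cases j <;> simp [Matrix.mul_apply, Fin.sum_univ_four, Matrix.vecMul_diagonal]

theorem assoc_torusElt_perm (a b c d a' b' c' d' : ℤ) (h : a + d = b + c) (h' : a' + d' = b' + c')
    (m : Fin 4) (hm : ∀ i, ![a', b', c', d'] i = ![a, b, c, d] (xorPerm m i)) :
    Assoc (torusElt p a b c d h) (torusElt p a' b' c' d' h') := by
  obtain ⟨g, hg, e⟩ := assoc_perm (torusElt p a b c d h) m m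
  convert hg
  apply ext_matrix
  ext i j
  have key : ∀ m i j, xorPerm m i = xorPerm m j ↔ i = j := by decide
  have hd : ∀ (a b c d : ℤ) (i : Fin 4), ![(p : ℚ_[p]) ^ a, (p : ℚ_[p]) ^ b, (p : ℚ_[p]) ^ c,
      (p : ℚ_[p]) ^ d] i = (p : ℚ_[p]) ^ (![a, b, c, d] i) := by
    intro a b c d i
    fin_cases i <;> rfl
  rw [e, torusElt_val, torusElt_val, Matrix.diagonal_apply, Matrix.diagonal_apply]
  simp only [key, hd, hm]

theorem norm_simil_torusElt (a b c d : ℤ) (h : a + d = b + c) :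
    ‖simil (torusElt p a b c d h)‖ = (p : ℝ) ^ (-(a + d)) := by
  have hp : (p : ℚ_[p]) ≠ 0 := by exact_mod_cast (Fact.out : p.Prime).ne_zero
  rw [(simil_diagonal (torusElt_val a b c d h)).1]
  change ‖(p : ℚ_[p]) ^ a * (p : ℚ_[p]) ^ d‖ = _
  rw [← zpow_add₀ hp, Padic.norm_p_zpow]

theorem isIntegral_torusElt_iff (a b c d : ℤ) (h : a + d = b + c) :
    IsIntegral (torusElt p a b c d h) ↔ 0 ≤ a ∧ 0 ≤ b ∧ 0 ≤ c ∧ 0 ≤ d := by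
  have hp1 : (1 : ℝ) < p := by exact_mod_cast (Fact.out : p.Prime).one_lt
  have key : ∀ n : ℤ, ‖(p : ℚ_[p]) ^ n‖ ≤ 1 ↔ 0 ≤ n := by
    intro n
    rw [Padic.norm_p_zpow, zpow_le_one_iff_right₀ hp1, neg_nonpos]
  constructor
  · intro hi
    refine ⟨?_, ?_, ?_, ?_⟩
    · exact (key a).1 (hi 0 0)
    · exact (key b).1 (hi 1 1)
    · exact (key c).1 (hi 2 2)
    · exact (key d).1 (hi 3 3)
  · rintro ⟨ha, hb, hc, hd⟩ i j
    rw [torusElt_val, Matrix.diagonal_apply]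
    split_ifs
    · fin_cases i
      exacts [(key a).2 ha, (key b).2 hb, (key c).2 hc, (key d).2 hd]
    · simp

theorem zpow_p_injective : Function.Injective fun n : ℤ => (p : ℝ) ^ n :=
  zpow_right_injective₀ (by exact_mod_cast (Fact.out : p.Prime).pos)
    (by exact_mod_cast (Fact.out : p.Prime).one_lt.ne')

theorem exists_assoc_torusElt_of_isIntegral {g : GSp4 ℚ_[p]} (hg : IsIntegral g) {n : ℤ}
    (hn : ‖simil g‖ = (p : ℝ) ^ (-n)) : ∃ (a b c d : ℤ) (h : a + d = b + c),
    Assoc (torusElt p a b c d h) g ∧ 0 ≤ a ∧ 0 ≤ b ∧ 0 ≤ c ∧ 0 ≤ d ∧ a + d = n := by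
  obtain ⟨a, b, c, d, h, hgt⟩ := assoc_torusElt g
  have h1 := (isIntegral_torusElt_iff a b c d h).1 (hgt.isIntegral hg)
  have h2 := hgt.norm_simil
  rw [norm_simil_torusElt, hn] at h2
  have h3 := zpow_p_injective h2
  exact ⟨a, b, c, d, h, hgt.symm, h1.1, h1.2.1, h1.2.2.1, h1.2.2.2, by omega⟩

/-- For nonnegative exponents with `a + d = b + c = 1` each of the pairs `(a, d)` and `(b, c)`
consists of 0 and 1, and these four choices form one Weyl orbit. -/
theorem assoc_siegel_iff {g : GSp4 ℚ_[p]} : Assoc (torusElt p 1 1 0 0 (by norm_num)) g ↔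
    IsIntegral g ∧ ‖simil g‖ = (p : ℝ) ^ (-1 : ℤ) := by
  constructor
  · intro h
    refine ⟨h.isIntegral ((isIntegral_torusElt_iff _ _ _ _ _).2 (by norm_num)), ?_⟩
    rw [h.norm_simil, norm_simil_torusElt]
    norm_num
  · rintro ⟨hi, hs⟩
    obtain ⟨a, b, c, d, h, hgt, ha, hb, hc, hd, had⟩ := exists_assoc_torusElt_of_isIntegral hi hs
    refine Assoc.trans ?_ hgt
    have hsw : Assoc (torusElt p 1 1 0 0 (by norm_num)) (torusElt p 1 0 1 0 (by norm_num)) :=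
      assoc_torusElt_swap _ _ _ _ _ _
    rcases (by omega : a = 1 ∨ a = 0) with rfl | rfl <;>
      rcases (by omega : b = 1 ∨ b = 0) with rfl | rfl
    · obtain rfl : c = 0 := by omega
      obtain rfl : d = 0 := by omega
      exact Assoc.refl _
    · obtain rfl : c = 1 := by omega
      obtain rfl : d = 0 := by omega
      exact hsw
    · obtain rfl : c = 0 := by omega
      obtain rfl : d = 1 := by omega
      exact hsw.trans (assoc_torusElt_perm _ _ _ _ _ _ _ _ _ _ 1 (by decide))
    · obtain rfl : c = 1 := by omega
      obtain rfl : d = 1 := by omega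
      exact assoc_torusElt_perm _ _ _ _ _ _ _ _ _ _ 3 (by decide)

/-- Nonnegative exponents with `a + d = b + c = 2` leave nine cases, which the Weyl group sorts into
the three listed orbits. -/
theorem assoc_of_norm_simil_eq_sq {g : GSp4 ℚ_[p]} (hi : IsIntegral g)
    (hs : ‖simil g‖ = (p : ℝ) ^ (-2 : ℤ)) :
    Assoc (torusElt p 2 2 0 0 (by norm_num)) g ∨ Assoc (torusElt p 2 1 1 0 (by norm_num)) g ∨
      Assoc (torusElt p 1 1 1 1 (by norm_num)) g := by
  obtain ⟨a, b, c, d, h, hgt, ha, hb, hc, hd, had⟩ := exists_assoc_torusElt_of_isIntegral hi hs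
  have hsw : Assoc (torusElt p 2 2 0 0 (by norm_num)) (torusElt p 2 0 2 0 (by norm_num)) :=
    assoc_torusElt_swap _ _ _ _ _ _
  have hx : Assoc (torusElt p 2 1 1 0 (by norm_num)) (torusElt p 1 2 0 1 (by norm_num)) :=
    assoc_torusElt_perm _ _ _ _ _ _ _ _ _ _ 1 (by decide)
  rcases (by omega : a = 2 ∨ a = 1 ∨ a = 0) with rfl | rfl | rfl <;>
    rcases (by omega : b = 2 ∨ b = 1 ∨ b = 0) with rfl | rfl | rfl
  · obtain rfl : c = 0 := by omega
    obtain rfl : d = 0 := by omega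
    exact Or.inl hgt
  · obtain rfl : c = 1 := by omega
    obtain rfl : d = 0 := by omega
    exact Or.inr (Or.inl hgt)
  · obtain rfl : c = 2 := by omega
    obtain rfl : d = 0 := by omega
    exact Or.inl (hsw.trans hgt)
  · obtain rfl : c = 0 := by omega
    obtain rfl : d = 1 := by omega
    exact Or.inr (Or.inl (hx.trans hgt))
  · obtain rfl : c = 1 := by omega
    obtain rfl : d = 1 := by omega
    exact Or.inr (Or.inr hgt)
  · obtain rfl : c = 2 := by omega
    obtain rfl : d = 1 := by omega
    exact Or.inr (Or.inl ((hx.trans (assoc_torusElt_swap _ _ _ _ _ _)).trans hgt))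
  · obtain rfl : c = 0 := by omega
    obtain rfl : d = 2 := by omega
    exact Or.inl ((hsw.trans (assoc_torusElt_perm _ _ _ _ _ _ _ _ _ _ 1 (by decide))).trans hgt)
  · obtain rfl : c = 1 := by omega
    obtain rfl : d = 2 := by omega
    exact Or.inr (Or.inl
      ((assoc_torusElt_perm _ _ _ _ _ _ _ _ _ _ 3 (by decide)).trans hgt))
  · obtain rfl : c = 2 := by omega
    obtain rfl : d = 2 := by omega
    exact Or.inl ((assoc_torusElt_perm _ _ _ _ _ _ _ _ _ _ 3 (by decide)).trans hgt)

/-! ### Translates of the standard lattice and their duals -/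

/-- Membership in `ℤ_p` inside `ℚ_p`. -/
theorem mem_one_iff_norm_le {x : ℚ_[p]} : x ∈ (1 : Submodule ℤ_[p] ℚ_[p]) ↔ ‖x‖ ≤ 1 := by
  rw [Submodule.mem_one]
  exact ⟨by rintro ⟨y, rfl⟩; exact y.2, fun h => ⟨⟨x, h⟩, rfl⟩⟩

theorem norm_div_p_le {x : ℚ_[p]} (h : ‖x‖ < 1) : ‖(p : ℚ_[p])⁻¹ * x‖ ≤ 1 := by
  have hp : (0 : ℝ) < p := by exact_mod_cast (Fact.out : p.Prime).pos
  have := (Padic.norm_le_pow_iff_norm_lt_pow_add_one x (-1)).2 (by simpa using h)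
  rw [norm_mul, norm_inv, Padic.norm_p, inv_inv]
  rw [zpow_neg_one] at this
  calc (p : ℝ) * ‖x‖ ≤ p * (p : ℝ)⁻¹ := by gcongr
    _ = 1 := mul_inv_cancel₀ hp.ne'

theorem one_lt_norm_inv_p : 1 < ‖(p : ℚ_[p])⁻¹‖ := by
  rw [norm_inv, Padic.norm_p, inv_inv]
  exact_mod_cast (Fact.out : p.Prime).one_lt

variable (p) in
/-- The inclusion of `ℤ_p⁴` in `ℚ_p⁴`. -/
noncomputable def intEmb : (Fin 4 → ℤ_[p]) →ₗ[ℤ_[p]] (Fin 4 → ℚ_[p]) :=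
  (Algebra.linearMap ℤ_[p] ℚ_[p]).compLeft (Fin 4)

theorem intEmb_apply (x : Fin 4 → ℤ_[p]) (i : Fin 4) : intEmb p x i = (x i : ℚ_[p]) := rfl

variable (p) in
/-- The standard lattice `ℤ_p⁴`. -/
noncomputable def stdLattice : Submodule ℤ_[p] (Fin 4 → ℚ_[p]) := LinearMap.range (intEmb p)

theorem mem_stdLattice {x : Fin 4 → ℚ_[p]} : x ∈ stdLattice p ↔ ∀ i, ‖x i‖ ≤ 1 := by
  constructor
  · rintro ⟨y, rfl⟩ i
    exact (y i).2
  · intro h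
    exact ⟨fun i => ⟨x i, h i⟩, rfl⟩

instance isLattice_stdLattice : Submodule.IsLattice ℚ_[p] (stdLattice p) where
  fg := by
    rw [stdLattice, LinearMap.range_eq_map]
    exact Module.Finite.fg_top.map _
  span_eq_top := by
    rw [eq_top_iff, ← (Pi.basisFun ℚ_[p] (Fin 4)).span_eq]
    refine Submodule.span_mono ?_
    rintro _ ⟨i, rfl⟩
    rw [Pi.basisFun_apply, SetLike.mem_coe, mem_stdLattice]
    intro j
    rw [Pi.single_apply]
    split_ifs <;> simp

theorem mem_latticeMap {g : GSp4 ℚ_[p]} {Λ : Submodule ℤ_[p] (Fin 4 → ℚ_[p])}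
    {x : Fin 4 → ℚ_[p]} : x ∈ latticeMap p g Λ ↔ ∃ y ∈ Λ, g.1.1.mulVec y = x := Iff.rfl

theorem inv_mul_val (g : GSp4 ℚ_[p]) : (g⁻¹).1.1 * g.1.1 = 1 := by
  rw [← Units.val_mul, ← Subgroup.coe_mul, inv_mul_cancel]; rfl

theorem mul_inv_val (g : GSp4 ℚ_[p]) : g.1.1 * (g⁻¹).1.1 = 1 := by
  rw [← Units.val_mul, ← Subgroup.coe_mul, mul_inv_cancel]; rfl

theorem mem_latticeMap_iff_inv {g : GSp4 ℚ_[p]} {Λ : Submodule ℤ_[p] (Fin 4 → ℚ_[p])}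
    {x : Fin 4 → ℚ_[p]} : x ∈ latticeMap p g Λ ↔ (g⁻¹).1.1.mulVec x ∈ Λ := by
  rw [mem_latticeMap]
  constructor
  · rintro ⟨y, hy, rfl⟩
    rwa [Matrix.mulVec_mulVec, inv_mul_val, Matrix.one_mulVec]
  · intro h
    exact ⟨_, h, by rw [Matrix.mulVec_mulVec, mul_inv_val, Matrix.one_mulVec]⟩

theorem mulVec_mem_latticeMap {g : GSp4 ℚ_[p]} {Λ : Submodule ℤ_[p] (Fin 4 → ℚ_[p])}
    {x : Fin 4 → ℚ_[p]} : g.1.1.mulVec x ∈ latticeMap p g Λ ↔ x ∈ Λ := by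
  rw [mem_latticeMap_iff_inv, Matrix.mulVec_mulVec, inv_mul_val, Matrix.one_mulVec]

theorem latticeMap_mono (g : GSp4 ℚ_[p]) {Λ Λ' : Submodule ℤ_[p] (Fin 4 → ℚ_[p])} (h : Λ ≤ Λ') :
    latticeMap p g Λ ≤ latticeMap p g Λ' := Submodule.map_mono h

theorem latticeMap_le_latticeMap {g h : GSp4 ℚ_[p]} {Λ Λ' : Submodule ℤ_[p] (Fin 4 → ℚ_[p])} :
    latticeMap p g Λ ≤ latticeMap p h Λ' ↔ latticeMap p (h⁻¹ * g) Λ ≤ Λ' := by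
  constructor
  · intro e
    have := latticeMap_mono h⁻¹ e
    rwa [← latticeMap_mul, ← latticeMap_mul, inv_mul_cancel, latticeMap_one] at this
  · intro e
    have := latticeMap_mono h e
    rwa [← latticeMap_mul, mul_inv_cancel_left] at this

theorem mulVec_mem_stdLattice {A : Matrix (Fin 4) (Fin 4) ℚ_[p]} (hA : ∀ i j, ‖A i j‖ ≤ 1)
    {y : Fin 4 → ℚ_[p]} (hy : y ∈ stdLattice p) : A.mulVec y ∈ stdLattice p := by
  rw [mem_stdLattice] at hy ⊢
  intro i
  refine norm_sum_four_le fun j => ?_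
  rw [norm_mul]
  exact mul_le_one₀ (hA _ _) (norm_nonneg _) (hy _)

theorem single_mem_stdLattice (j : Fin 4) : Pi.single j 1 ∈ stdLattice p := by
  rw [mem_stdLattice]
  intro i
  rw [Pi.single_apply]
  split_ifs <;> simp

theorem latticeMap_stdLattice_le {g : GSp4 ℚ_[p]} :
    latticeMap p g (stdLattice p) ≤ stdLattice p ↔ IsIntegral g := by
  constructor
  · intro h i j
    have := mem_stdLattice.1 (h (mem_latticeMap.2 ⟨_, single_mem_stdLattice j, rfl⟩)) i
    simpa using this
  · rintro h _ ⟨y, hy, rfl⟩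
    exact mulVec_mem_stdLattice h hy

theorem latticeMap_stdLattice_le_iff {g h : GSp4 ℚ_[p]} :
    latticeMap p g (stdLattice p) ≤ latticeMap p h (stdLattice p) ↔ IsIntegral (h⁻¹ * g) := by
  rw [latticeMap_le_latticeMap, latticeMap_stdLattice_le]

theorem mem_GSp4Int_iff_isIntegral_inv {g : GSp4 ℚ_[p]} :
    g ∈ GSp4Int p ↔ IsIntegral g ∧ IsIntegral g⁻¹ := by
  constructor
  · exact fun h => ⟨IsIntegral.of_mem h, IsIntegral.of_mem (inv_mem h)⟩
  · rintro ⟨h1, h2⟩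
    refine mem_GSp4Int_iff.2 ⟨h1, le_antisymm h1.norm_simil_le ?_⟩
    have := h2.norm_simil_le
    rw [simil_inv, norm_inv] at this
    exact (inv_le_one₀ (norm_pos_iff.2 (simil_ne_zero g))).1 this

/-- Identifies the orbit of `ℤ_p⁴` with the cosets of `GSp₄(ℤ_p)`. -/
theorem latticeMap_stdLattice_eq_iff {g h : GSp4 ℚ_[p]} :
    latticeMap p g (stdLattice p) = latticeMap p h (stdLattice p) ↔ h⁻¹ * g ∈ GSp4Int p := by
  rw [le_antisymm_iff, latticeMap_stdLattice_le_iff, latticeMap_stdLattice_le_iff,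
    mem_GSp4Int_iff_isIntegral_inv, mul_inv_rev, inv_inv]

instance isLattice_latticeMap (g : GSp4 ℚ_[p]) (Λ : Submodule ℤ_[p] (Fin 4 → ℚ_[p]))
    [hΛ : Submodule.IsLattice ℚ_[p] Λ] : Submodule.IsLattice ℚ_[p] (latticeMap p g Λ) where
  fg := hΛ.fg.map _
  span_eq_top := by
    have h1 : (latticeMap p g Λ : Set (Fin 4 → ℚ_[p])) = Matrix.toLin' g.1.1 '' Λ := rfl
    rw [h1, ← Submodule.map_span, hΛ.span_eq_top, Submodule.map_top, LinearMap.range_eq_top]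
    intro x
    refine ⟨(g⁻¹).1.1.mulVec x, ?_⟩
    rw [Matrix.toLin'_apply, Matrix.mulVec_mulVec, mul_inv_val, Matrix.one_mulVec]

theorem mem_dualLattice {Λ : Submodule ℤ_[p] (Fin 4 → ℚ_[p])} {x : Fin 4 → ℚ_[p]} :
    x ∈ dualLattice p Λ ↔ ∀ y ∈ Λ, ‖x ⬝ᵥ (matJ ℚ_[p]).mulVec y‖ ≤ 1 := by
  refine forall₂_congr fun y _ => ?_
  rw [mem_one_iff_norm_le, Matrix.toBilin'_apply']

theorem dotProduct_matJ_mulVec (x y : Fin 4 → ℚ_[p]) : x ⬝ᵥ (matJ ℚ_[p]).mulVec y =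
    x 0 * y 3 + x 1 * y 2 - x 2 * y 1 - x 3 * y 0 := by
  simp [matJ, Matrix.mulVec, dotProduct, Fin.sum_univ_four]
  ring

theorem dualLattice_stdLattice : dualLattice p (stdLattice p) = stdLattice p := by
  ext x
  rw [mem_dualLattice, mem_stdLattice]
  constructor
  · intro h i
    have := h _ (single_mem_stdLattice i.rev)
    rw [dotProduct_matJ_mulVec] at this
    fin_cases i <;> simpa using this
  · intro h y hy
    rw [mem_stdLattice] at hy
    refine norm_sum_four_le fun i => ?_
    rw [norm_mul]
    refine mul_le_one₀ (h i) (norm_nonneg _) (norm_sum_four_le fun j => ?_)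
    rw [norm_mul]
    refine mul_le_one₀ ?_ (norm_nonneg _) (hy j)
    fin_cases i <;> fin_cases j <;> simp [matJ]

theorem dotProduct_mulVec_mulVec (g : GSp4 ℚ_[p]) (x y : Fin 4 → ℚ_[p]) :
    g.1.1.mulVec x ⬝ᵥ (matJ ℚ_[p]).mulVec (g.1.1.mulVec y) =
      simil g * (x ⬝ᵥ (matJ ℚ_[p]).mulVec y) := by
  rw [Matrix.mulVec_mulVec, Matrix.dotProduct_mulVec, Matrix.vecMul_mulVec,
    ← Matrix.dotProduct_mulVec, ← Matrix.mul_assoc, transpose_mul_matJ_mul, Matrix.smul_mulVec,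
    dotProduct_smul, smul_eq_mul]

/-- Since `g` scales the form by `c(g)` and `ℤ_p⁴` is self-dual, the dual of `g ℤ_p⁴` is `c(g)⁻¹ g
ℤ_p⁴`. -/
theorem mem_dualLattice_latticeMap {g : GSp4 ℚ_[p]} {x : Fin 4 → ℚ_[p]} :
    x ∈ dualLattice p (latticeMap p g (stdLattice p)) ↔
      simil g • x ∈ latticeMap p g (stdLattice p) := by
  have hx : x = g.1.1.mulVec ((g⁻¹).1.1.mulVec x) := by
    rw [Matrix.mulVec_mulVec, mul_inv_val, Matrix.one_mulVec]
  generalize (g⁻¹).1.1.mulVec x = z at hx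
  subst hx
  rw [← Matrix.mulVec_smul, mulVec_mem_latticeMap]
  conv_rhs => rw [← dualLattice_stdLattice]
  rw [mem_dualLattice, mem_dualLattice]
  constructor
  · intro h y hy
    have := h _ (mulVec_mem_latticeMap.2 hy)
    rwa [dotProduct_mulVec_mulVec, ← smul_eq_mul, ← smul_dotProduct] at this
  · rintro h _ ⟨y, hy, rfl⟩
    have := h y hy
    rw [smul_dotProduct, smul_eq_mul, ← dotProduct_mulVec_mulVec] at this
    exact this

/-- Treats both types at once, with `u = 1` and `u = p`: the type of a translate is the valuation of
its similitude factor. -/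
theorem dual_homothety_iff {g : GSp4 ℚ_[p]} {u : ℚ_[p]} (hu : u ≠ 0) :
    (∀ x, x ∈ dualLattice p (latticeMap p g (stdLattice p)) ↔
      u • x ∈ latticeMap p g (stdLattice p)) ↔ ‖simil g‖ = ‖u‖ := by
  have hc := simil_ne_zero g
  constructor
  · intro h
    -- Testing on the line spanned by the first column of `g` compares the two scalars.
    have key : ∀ t : ℚ_[p], ‖simil g * t‖ ≤ 1 ↔ ‖u * t‖ ≤ 1 := by
      intro t
      have e := h (g.1.1.mulVec (Pi.single 0 t))
      rw [mem_dualLattice_latticeMap, ← Matrix.mulVec_smul, ← Matrix.mulVec_smul,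
        mulVec_mem_latticeMap, mulVec_mem_latticeMap] at e
      have aux : ∀ w : ℚ_[p], w • (Pi.single 0 t : Fin 4 → ℚ_[p]) ∈ stdLattice p ↔
          ‖w * t‖ ≤ 1 := by
        intro w
        rw [mem_stdLattice]
        constructor
        · intro h
          simpa using h 0
        · intro h i
          by_cases hi : i = 0
          · subst hi
            simpa using h
          · simp [hi]
      rwa [aux, aux] at e
    apply le_antisymm
    · have := (key u⁻¹).2 (by rw [mul_inv_cancel₀ hu]; simp)
      rw [norm_mul, norm_inv, ← div_eq_mul_inv] at this
      exact (div_le_one (norm_pos_iff.2 hu)).1 this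
    · have := (key (simil g)⁻¹).1 (by rw [mul_inv_cancel₀ hc]; simp)
      rw [norm_mul, norm_inv, ← div_eq_mul_inv] at this
      exact (div_le_one (norm_pos_iff.2 hc)).1 this
  · intro h x
    rw [mem_dualLattice_latticeMap, mem_latticeMap_iff_inv, mem_latticeMap_iff_inv,
      Matrix.mulVec_smul, Matrix.mulVec_smul, mem_stdLattice, mem_stdLattice]
    simp [h]

theorem isVertexLatticeZero_iff {Λ : Submodule ℤ_[p] (Fin 4 → ℚ_[p])} :
    IsVertexLatticeZero p Λ ↔ Submodule.IsLattice ℚ_[p] Λ ∧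
      ∀ x, x ∈ dualLattice p Λ ↔ (1 : ℚ_[p]) • x ∈ Λ := by
  refine and_congr_right fun _ => ?_
  simp [Submodule.ext_iff]

theorem isVertexLatticeTwo_iff {Λ : Submodule ℤ_[p] (Fin 4 → ℚ_[p])} :
    IsVertexLatticeTwo p Λ ↔ Submodule.IsLattice ℚ_[p] Λ ∧
      ∀ x, x ∈ dualLattice p Λ ↔ (p : ℚ_[p]) • x ∈ Λ := by
  have hp : (p : ℚ_[p]) ≠ 0 := by exact_mod_cast (Fact.out : p.Prime).ne_zero
  have hs : ∀ x : Fin 4 → ℚ_[p], (p : ℤ_[p]) • x = (p : ℚ_[p]) • x := by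
    intro x
    ext i
    simp [Algebra.smul_def]
  refine and_congr_right fun _ => ?_
  constructor
  · intro h x
    conv_rhs => rw [← h]
    rw [Submodule.mem_smul_pointwise_iff_exists]
    constructor
    · exact fun hx => ⟨x, hx, hs x⟩
    · rintro ⟨y, hy, e⟩
      rw [hs] at e
      rwa [← smul_right_injective _ hp e]
  · intro h
    ext x
    rw [Submodule.mem_smul_pointwise_iff_exists]
    constructor
    · rintro ⟨y, hy, rfl⟩
      rw [hs]
      exact (h y).1 hy
    · intro hx
      refine ⟨(p : ℚ_[p])⁻¹ • x, ?_, ?_⟩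
      · rwa [h, smul_smul, mul_inv_cancel₀ hp, one_smul]
      · rw [hs, smul_smul, mul_inv_cancel₀ hp, one_smul]

theorem isVertexLatticeZero_latticeMap {g : GSp4 ℚ_[p]} :
    IsVertexLatticeZero p (latticeMap p g (stdLattice p)) ↔ ‖simil g‖ = 1 := by
  rw [isVertexLatticeZero_iff, dual_homothety_iff one_ne_zero, norm_one]
  exact and_iff_right inferInstance

theorem isVertexLatticeTwo_latticeMap {g : GSp4 ℚ_[p]} :
    IsVertexLatticeTwo p (latticeMap p g (stdLattice p)) ↔ ‖simil g‖ = (p : ℝ) ^ (-1 : ℤ) := by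
  have hp : (p : ℚ_[p]) ≠ 0 := by exact_mod_cast (Fact.out : p.Prime).ne_zero
  rw [isVertexLatticeTwo_iff, dual_homothety_iff hp, Padic.norm_p, zpow_neg_one]
  exact and_iff_right inferInstance

/-! ### Vertex lattices as translates: symplectic bases over `ℤ_p` -/

theorem inv_p_smul_notMem {y : Fin 4 → ℚ_[p]} (i : Fin 4) (h : y i = 1) :
    (p : ℚ_[p])⁻¹ • y ∉ stdLattice p := by
  rw [mem_stdLattice]
  intro hy
  have := hy i
  rw [Pi.smul_apply, h, smul_eq_mul, mul_one] at this
  exact absurd this (not_le.2 one_lt_norm_inv_p)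

/-- A unimodular alternating `4 × 4` matrix over `ℤ_p` is congruent to `J`. -/
theorem exists_symplectic_basis_of_norm_eq_one (a b s c d e : ℚ_[p])
    (hS : ∀ y, y ∈ stdLattice p ↔
      (!![0, a, b, s; -a, 0, c, d; -b, -c, 0, e; -s, -d, -e, 0]).mulVec y ∈ stdLattice p)
    (hs : ‖s‖ = 1) : ∃ P Q : Matrix (Fin 4) (Fin 4) ℚ_[p], (∀ i j, ‖P i j‖ ≤ 1) ∧
      (∀ i j, ‖Q i j‖ ≤ 1) ∧ P * Q = 1 ∧
      P.transpose * !![0, a, b, s; -a, 0, c, d; -b, -c, 0, e; -s, -d, -e, 0] * P =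
        matJ ℚ_[p] := by
  have hs0 : s ≠ 0 := by rw [← norm_pos_iff, hs]; exact one_pos
  have hent : ∀ i j, ‖(!![0, a, b, s; -a, 0, c, d; -b, -c, 0, e; -s, -d, -e, 0]) i j‖ ≤ 1 := by
    intro i j
    have := mem_stdLattice.1 ((hS _).1 (single_mem_stdLattice j)) i
    simpa using this
  have ha : ‖a‖ ≤ 1 := hent 0 1
  have hb : ‖b‖ ≤ 1 := hent 0 2
  have hc : ‖c‖ ≤ 1 := hent 1 2
  have hd : ‖d‖ ≤ 1 := hent 1 3
  have he : ‖e‖ ≤ 1 := hent 2 3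
  -- The Pfaffian `a e - b d + c s` divided by `s`: the pairing of the middle basis vectors after
  -- projecting off the plane of the outer two.
  obtain ⟨m, hm⟩ : ∃ m, m = c + (a * e - b * d) / s := ⟨_, rfl⟩
  have hv : (!![0, a, b, s; -a, 0, c, d; -b, -c, 0, e; -s, -d, -e, 0]).mulVec
      ![-d / s, 1, 0, -a / s] = ![0, 0, -m, 0] := by
    ext i
    fin_cases i <;> simp [Matrix.mulVec, dotProduct, Fin.sum_univ_four, hm] <;> field_simp <;> ring
  have hm1 : ‖m‖ = 1 := by
    apply le_antisymm
    · have h1 : ![-d / s, 1, 0, -a / s] ∈ stdLattice p := by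
        rw [mem_stdLattice]
        intro i
        fin_cases i <;> simp [hs, hd, ha]
      have := mem_stdLattice.1 ((hS _).1 h1) 2
      rw [hv] at this
      simpa using this
    -- If `m` were divisible by `p`, the Gram matrix would send `p⁻¹` times a primitive vector to an
    -- integral vector.
    · by_contra hlt
      refine inv_p_smul_notMem (y := ![-d / s, 1, 0, -a / s]) 1 rfl ((hS _).2 ?_)
      rw [Matrix.mulVec_smul, hv, mem_stdLattice]
      intro i
      fin_cases i <;> try simp
      have := norm_div_p_le (not_le.1 hlt)
      rwa [norm_mul, norm_inv, Padic.norm_p, inv_inv] at this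
  have hm0 : m ≠ 0 := by rw [← norm_pos_iff, hm1]; exact one_pos
  -- Symplectic Gram–Schmidt: the outer vectors are kept, the last one rescaled by `s`; the middle
  -- ones are made orthogonal to them, and the third is rescaled by `m`.
  refine ⟨!![1, -d / s, -e / s / m, 0; 0, 1, 0, 0; 0, 0, 1 / m, 0; 0, -a / s, -b / s / m, 1 / s],
    !![1, d / s, e / s, 0; 0, 1, 0, 0; 0, 0, m, 0; 0, a, b, s], ?_, ?_, ?_, ?_⟩
  · intro i j
    fin_cases i <;> fin_cases j <;> simp [hs, hm1, ha, hb, hd, he]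
  · intro i j
    fin_cases i <;> fin_cases j <;> simp [hs, hm1, ha, hb, hd, he]
  · ext i j
    fin_cases i <;> fin_cases j <;> simp [Matrix.mul_apply, Fin.sum_univ_four] <;>
      field_simp <;> simp
  · have hc' : c = m - (a * e - b * d) / s := by rw [hm]; ring
    clear hm hv hent hS
    subst hc'
    ext i j
    fin_cases i <;> fin_cases j <;>
      simp [matJ, Matrix.mul_apply, Fin.sum_univ_four] <;> field_simp <;> first | ring1 | simp

/-- The element of `GSp₄(F)` with a given matrix, from the transposed relation. -/
theorem exists_of_transpose_mul {F : Type v} [Field F] (A : Matrix (Fin 4) (Fin 4) F) (c : F)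
    (hc : c ≠ 0) (h : A.transpose * matJ F * A = c • matJ F) : ∃ g : GSp4 F, g.1.1 = A := by
  refine ⟨ofMatrix A c hc ?_, rfl⟩
  have h1 : (c⁻¹ • (-matJ F * A.transpose * matJ F)) * A = 1 := by
    rw [Matrix.smul_mul, Matrix.mul_assoc, Matrix.mul_assoc, ← Matrix.mul_assoc A.transpose, h,
      Matrix.mul_smul, Matrix.neg_mul, matJ_mul_matJ, neg_neg, smul_smul, inv_mul_cancel₀ hc,
      one_smul]
  have h2 := mul_eq_one_comm.1 h1
  have h3 : A * (c⁻¹ • (-matJ F * A.transpose * matJ F)) * matJ F = matJ F := by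
    rw [h2, Matrix.one_mul]
  simp only [Matrix.mul_smul, Matrix.smul_mul, Matrix.neg_mul, Matrix.mul_neg, Matrix.mul_assoc,
    matJ_mul_matJ, Matrix.mul_one, neg_neg] at h3
  rw [Matrix.mul_assoc]
  conv_rhs => rw [← h3]
  rw [smul_smul, mul_inv_cancel₀ hc, one_smul]

/-- A lattice over the principal ideal domain `ℤ_p` is free of rank 4; the columns of `A` form a
basis of it. -/
theorem exists_basis_matrix (Λ : Submodule ℤ_[p] (Fin 4 → ℚ_[p]))
    [hΛ : Submodule.IsLattice ℚ_[p] Λ] : ∃ A : Matrix (Fin 4) (Fin 4) ℚ_[p],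
      (∀ y, A.mulVec y ∈ Λ ↔ y ∈ stdLattice p) ∧ ∀ x ∈ Λ, ∃ y, A.mulVec y = x := by
  have hr : Module.finrank ℤ_[p] Λ = 4 := by
    rw [Submodule.IsLattice.finrank_of_pi (K := ℚ_[p]), Fintype.card_fin]
  let b : Module.Basis (Fin 4) ℤ_[p] Λ := Module.finBasisOfFinrankEq ℤ_[p] Λ hr
  let b' := b.extendOfIsLattice ℚ_[p]
  have hb' : ∀ j, b' j = (b j : Fin 4 → ℚ_[p]) := fun j =>
    Module.Basis.extendOfIsLattice_apply ℚ_[p] b j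
  let A : Matrix (Fin 4) (Fin 4) ℚ_[p] := Matrix.of fun i j => (b j : Fin 4 → ℚ_[p]) i
  have hA : ∀ y, A.mulVec y = b'.equivFun.symm y := by
    intro y
    rw [Module.Basis.equivFun_symm_apply]
    ext i
    simp [A, Matrix.mulVec, dotProduct, hb', mul_comm]
  have hmem : ∀ x ∈ Λ, ∃ y ∈ stdLattice p, A.mulVec y = x := by
    intro x hx
    refine ⟨intEmb p (b.equivFun ⟨x, hx⟩), ⟨_, rfl⟩, ?_⟩
    rw [hA, Module.Basis.equivFun_symm_apply]
    have e := congrArg Subtype.val (b.sum_equivFun ⟨x, hx⟩)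
    rw [Submodule.coe_sum] at e
    refine Eq.trans (Finset.sum_congr rfl fun i _ => ?_) e
    rw [hb', intEmb_apply]
    rfl
  refine ⟨A, fun y => ⟨fun h => ?_, ?_⟩, fun x hx => ?_⟩
  · obtain ⟨z, hz, e⟩ := hmem _ h
    rw [hA, hA] at e
    rwa [← b'.equivFun.symm.injective e]
  · rintro ⟨z, rfl⟩
    rw [hA, Module.Basis.equivFun_symm_apply]
    refine Submodule.sum_mem _ fun i _ => ?_
    rw [hb', intEmb_apply]
    exact Λ.smul_mem (z i) (b i).2
  · obtain ⟨y, -, e⟩ := hmem x hx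
    exact ⟨y, e⟩

/-- A lattice whose dual is homothetic to it is the translate of the standard lattice by an
element of `GSp₄(ℚ_p)`. -/
theorem exists_latticeMap_eq (Λ : Submodule ℤ_[p] (Fin 4 → ℚ_[p]))
    [hΛ : Submodule.IsLattice ℚ_[p] Λ] {u : ℚ_[p]} (hu : u ≠ 0)
    (hd : ∀ x, x ∈ dualLattice p Λ ↔ u • x ∈ Λ) :
    ∃ g : GSp4 ℚ_[p], latticeMap p g (stdLattice p) = Λ := by
  obtain ⟨A₀, hA₀, hA₀'⟩ := exists_basis_matrix Λ
  -- In the coordinates given by `A` the hypothesis on the dual says that the rescaled Gram matrix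
  -- is unimodular.
  have key : ∀ A : Matrix (Fin 4) (Fin 4) ℚ_[p], (∀ y, A.mulVec y ∈ Λ ↔ y ∈ stdLattice p) →
      (∀ x ∈ Λ, ∃ y, A.mulVec y = x) → ∀ y, y ∈ stdLattice p ↔
        (u⁻¹ • (A.transpose * matJ ℚ_[p] * A)).mulVec y ∈ stdLattice p := by
    intro A hA hA' y
    have h1 : ∀ z w, A.mulVec z ⬝ᵥ (matJ ℚ_[p]).mulVec (u⁻¹ • A.mulVec w) =
        z ⬝ᵥ (u⁻¹ • (A.transpose * matJ ℚ_[p] * A)).mulVec w := by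
      intro z w
      rw [Matrix.mulVec_smul, Matrix.smul_mulVec, Matrix.mulVec_mulVec, dotProduct_smul,
        dotProduct_smul, Matrix.dotProduct_mulVec, Matrix.vecMul_mulVec,
        ← Matrix.dotProduct_mulVec, Matrix.mul_assoc]
    rw [← hA, ← one_smul ℚ_[p] (A.mulVec y), ← mul_inv_cancel₀ hu, ← smul_smul, ← hd,
      mem_dualLattice]
    have h2 : ∀ x y : Fin 4 → ℚ_[p], x ⬝ᵥ (matJ ℚ_[p]).mulVec y =
        -(y ⬝ᵥ (matJ ℚ_[p]).mulVec x) := by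
      intro x y
      rw [dotProduct_matJ_mulVec, dotProduct_matJ_mulVec]
      ring
    constructor
    · intro h
      rw [mem_stdLattice]
      intro i
      have := h _ ((hA _).2 (single_mem_stdLattice i))
      rw [h2, norm_neg, h1] at this
      simpa using this
    · intro h x hx
      obtain ⟨z, rfl⟩ := hA' x hx
      rw [h2, norm_neg, h1]
      rw [hA, mem_stdLattice] at hx
      rw [mem_stdLattice] at h
      refine norm_sum_four_le fun i => ?_
      rw [norm_mul]
      exact mul_le_one₀ (hx i) (norm_nonneg _) (h i)
  have hshape : ∀ A : Matrix (Fin 4) (Fin 4) ℚ_[p], ∃ a b s c d e : ℚ_[p],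
      u⁻¹ • (A.transpose * matJ ℚ_[p] * A) =
        !![0, a, b, s; -a, 0, c, d; -b, -c, 0, e; -s, -d, -e, 0] := by
    intro A
    set S := u⁻¹ • (A.transpose * matJ ℚ_[p] * A) with hSdef
    have hT : S.transpose = -S := by
      rw [hSdef, Matrix.transpose_smul, Matrix.transpose_mul, Matrix.transpose_mul, matJ_transpose,
        Matrix.transpose_transpose, Matrix.neg_mul, Matrix.mul_neg, smul_neg, Matrix.mul_assoc]
    have hij : ∀ i j, S i j = -S j i := fun i j => congrFun (congrFun hT j) i
    have hii : ∀ i, S i i = 0 := fun i => self_eq_neg.1 (hij i i)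
    refine ⟨S 0 1, S 0 2, S 0 3, S 1 2, S 1 3, S 2 3, ?_⟩
    ext i j
    fin_cases i <;> fin_cases j <;> simp [hii] <;> rw [hij]
  -- Otherwise the first column would be divisible by `p`, and `p⁻¹ e₀` would have integral image.
  obtain ⟨j, hj⟩ : ∃ j, ‖(u⁻¹ • (A₀.transpose * matJ ℚ_[p] * A₀)) j 0‖ = 1 := by
    by_contra! hne
    refine inv_p_smul_notMem (y := Pi.single 0 1) 0 (by simp) ((key A₀ hA₀ hA₀' _).2 ?_)
    rw [Matrix.mulVec_smul, mem_stdLattice]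
    intro i
    have h1 := mem_stdLattice.1 ((key A₀ hA₀ hA₀' _).1 (single_mem_stdLattice 0)) i
    simp only [Matrix.mulVec_single, MulOpposite.op_one, one_smul, Matrix.col_apply] at h1
    simp only [Pi.smul_apply, Matrix.mulVec_single, MulOpposite.op_one, one_smul,
      Matrix.col_apply, smul_eq_mul]
    exact norm_div_p_le (lt_of_le_of_ne h1 (hne i))
  have hj0 : j ≠ 0 := by
    rintro rfl
    obtain ⟨a, b, s, c, d, e, hsh⟩ := hshape A₀
    rw [hsh] at hj
    simp at hj
  -- Exchanging the basis vectors `j` and `3` makes the outer pairing `s` a unit.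
  obtain ⟨A, hA, hA', hs⟩ : ∃ A : Matrix (Fin 4) (Fin 4) ℚ_[p],
      (∀ y, A.mulVec y ∈ Λ ↔ y ∈ stdLattice p) ∧ (∀ x ∈ Λ, ∃ y, A.mulVec y = x) ∧
      ‖(u⁻¹ • (A.transpose * matJ ℚ_[p] * A)) 3 0‖ = 1 := by
    have e : ∀ y : Fin 4 → ℚ_[p], (A₀.submatrix id (Equiv.swap j 3)).mulVec y =
        A₀.mulVec (y ∘ Equiv.swap j 3) := by
      intro y
      have := Matrix.submatrix_mulVec_equiv A₀ y id (Equiv.swap j 3)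
      rwa [Equiv.symm_swap] at this
    have hstd : ∀ y : Fin 4 → ℚ_[p], y ∘ Equiv.swap j 3 ∈ stdLattice p ↔ y ∈ stdLattice p := by
      intro y
      rw [mem_stdLattice, mem_stdLattice]
      constructor
      · intro h i
        simpa using h (Equiv.swap j 3 i)
      · exact fun h i => h _
    refine ⟨A₀.submatrix id (Equiv.swap j 3), fun y => ?_, fun x hx => ?_, ?_⟩
    · rw [e, hA₀, hstd]
    · obtain ⟨y, rfl⟩ := hA₀' x hx
      refine ⟨y ∘ Equiv.swap j 3, ?_⟩
      rw [e]
      congr 1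
      ext i
      simp
    · rw [← hj]
      have h0 : Equiv.swap j 3 0 = 0 := Equiv.swap_apply_of_ne_of_ne hj0.symm (by decide)
      simp [Matrix.mul_apply, h0]
  obtain ⟨a, b, s, c, d, e, hsh⟩ := hshape A
  have hkey := key A hA hA'
  rw [hsh] at hkey hs
  obtain ⟨P, Q, hP, hQ, hPQ, hPS⟩ := exists_symplectic_basis_of_norm_eq_one a b s c d e hkey
    (by simpa using hs)
  obtain ⟨g, hg⟩ := exists_of_transpose_mul (A * P) u hu (by
    conv_rhs => rw [← hPS, ← hsh]
    rw [Matrix.transpose_mul, Matrix.mul_smul, Matrix.smul_mul, smul_smul,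
      mul_inv_cancel₀ hu, one_smul]
    simp only [Matrix.mul_assoc])
  refine ⟨g, ?_⟩
  ext x
  rw [mem_latticeMap, hg]
  constructor
  · rintro ⟨y, hy, rfl⟩
    rw [← Matrix.mulVec_mulVec, hA]
    exact mulVec_mem_stdLattice hP hy
  · intro hx
    obtain ⟨y, rfl⟩ := hA' x hx
    rw [hA] at hx
    refine ⟨Q.mulVec y, mulVec_mem_stdLattice hQ hx, ?_⟩
    rw [Matrix.mulVec_mulVec, Matrix.mul_assoc, hPQ, Matrix.mul_one]

theorem exists_latticeMap_eq_of_zero {Λ : Submodule ℤ_[p] (Fin 4 → ℚ_[p])}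
    (h : IsVertexLatticeZero p Λ) : ∃ g : GSp4 ℚ_[p], latticeMap p g (stdLattice p) = Λ := by
  obtain ⟨h1, h2⟩ := isVertexLatticeZero_iff.1 h
  exact exists_latticeMap_eq Λ one_ne_zero h2

theorem exists_latticeMap_eq_of_two {Λ : Submodule ℤ_[p] (Fin 4 → ℚ_[p])}
    (h : IsVertexLatticeTwo p Λ) : ∃ g : GSp4 ℚ_[p], latticeMap p g (stdLattice p) = Λ := by
  obtain ⟨h1, h2⟩ := isVertexLatticeTwo_iff.1 h
  exact exists_latticeMap_eq Λ (by exact_mod_cast (Fact.out : p.Prime).ne_zero) h2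

end padic

end GSp4

/-! ### Counting Lagrangian planes over a finite field -/

namespace LinearMap.BilinForm

variable {k V : Type*} [Field k] [AddCommGroup V] [Module k V]

/-- A subspace which is its own orthogonal complement. -/
def IsLagrangian (B : LinearMap.BilinForm k V) (l : Submodule k V) : Prop := B.orthogonal l = l

theorem finrank_span_pair {v w : V} (hv : v ≠ 0) (hw : w ∉ k ∙ v) :
    Module.finrank k (Submodule.span k {v, w}) = 2 := by
  have h : LinearIndependent k ![v, w] := by
    rw [LinearIndependent.pair_iff' hv]
    intro a ha
    exact hw (Submodule.mem_span_singleton.2 ⟨a, ha⟩)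
  have := finrank_span_eq_card h
  rwa [Matrix.range_cons_cons_empty, Fintype.card_fin] at this

open Classical in
theorem card_filter_mem [Fintype k] [Fintype V] (S : Submodule k V) :
    (Finset.univ.filter fun w => w ∈ S).card = Fintype.card k ^ Module.finrank k S := by
  rw [← Module.card_eq_pow_finrank (K := k) (V := S), Fintype.card_subtype]

open Classical in
-- Stated additively to keep truncated subtraction out of the double counts.
theorem card_filter_mem_sdiff [Fintype k] [Fintype V] {S S' : Submodule k V} (h : S' ≤ S) :
    (Finset.univ.filter fun w => w ∈ S ∧ w ∉ S').card + Fintype.card k ^ Module.finrank k S' =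
      Fintype.card k ^ Module.finrank k S := by
  rw [← card_filter_mem, ← card_filter_mem, ← Finset.card_union_of_disjoint]
  · congr 1
    ext w
    by_cases hw : w ∈ S'
    · simp [hw, h hw]
    · simp [hw]
  · rw [Finset.disjoint_left]
    intro w hw hw'
    simp_all

variable [FiniteDimensional k V] {B : LinearMap.BilinForm k V}

theorem IsLagrangian.finrank {l : Submodule k V} (hB : B.Nondegenerate)
    (hV : Module.finrank k V = 4) (hl : B.IsLagrangian l) : Module.finrank k l = 2 := by
  have h := finrank_orthogonal hB l
  rw [hl, hV] at h
  omega

/-- An isotropic plane lies in its orthogonal complement, which also has dimension `4 - 2 = 2`. -/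
theorem isLagrangian_span_pair (hB : B.Nondegenerate) (ha : B.IsAlt)
    (hV : Module.finrank k V = 4) {v w : V} (hv : v ≠ 0) (hw : w ∉ k ∙ v) (hvw : B v w = 0) :
    B.IsLagrangian (Submodule.span k {v, w}) := by
  refine Eq.symm ?_
  apply Submodule.eq_of_le_of_finrank_eq
  · rw [Submodule.span_le]
    have hwv : B w v = 0 := by rw [← ha.neg_eq, hvw, neg_zero]
    have key : ∀ x ∈ Submodule.span k {v, w}, B x v = 0 ∧ B x w = 0 := by
      intro x hx
      obtain ⟨a, b, rfl⟩ := Submodule.mem_span_pair.1 hx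
      simp [ha.self_eq_zero, hvw, hwv]
    rintro x (rfl | rfl)
    · exact mem_orthogonal_iff.2 fun y hy => (key y hy).1
    · exact mem_orthogonal_iff.2 fun y hy => (key y hy).2
  · rw [finrank_orthogonal hB, hV, finrank_span_pair hv hw]

variable [Fintype k] [Fintype V]

instance : Finite (Submodule k V) := Finite.of_injective _ SetLike.coe_injective

/-- Each of the `q³ - q` vectors `w` of `v^⊥` off the line of `v` spans with `v` a Lagrangian plane,
and each Lagrangian plane through `v` arises from `q² - q` of them. -/
theorem ncard_isLagrangian_of_mem (hB : B.Nondegenerate) (ha : B.IsAlt)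
    (hV : Module.finrank k V = 4) {v : V} (hv : v ≠ 0) :
    {l | B.IsLagrangian l ∧ v ∈ l}.ncard = Fintype.card k + 1 := by
  classical
  have : Fintype (Submodule k V) := Fintype.ofFinite _
  have hq : 1 < Fintype.card k := Fintype.one_lt_card
  have hv1 : Module.finrank k (k ∙ v) = 1 := finrank_span_singleton hv
  have hmem : ∀ w, w ∈ B.orthogonal (k ∙ v) ↔ B v w = 0 := by
    intro w
    rw [mem_orthogonal_iff]
    constructor
    · exact fun h => h v (Submodule.mem_span_singleton_self v)
    · intro h n hn
      obtain ⟨a, rfl⟩ := Submodule.mem_span_singleton.1 hn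
      simp [h]
  have hle : k ∙ v ≤ B.orthogonal (k ∙ v) := by
    rw [Submodule.span_singleton_le_iff_mem, hmem]
    exact ha.self_eq_zero v
  have h3 : Module.finrank k (B.orthogonal (k ∙ v)) = 3 := by
    rw [finrank_orthogonal hB, hV, hv1]
  have hT := card_filter_mem_sdiff hle
  have hmaps : Set.MapsTo (fun w => Submodule.span k {v, w})
      (Finset.univ.filter fun w => w ∈ B.orthogonal (k ∙ v) ∧ w ∉ k ∙ v : Finset V)
      (Finset.univ.filter fun l => B.IsLagrangian l ∧ v ∈ l : Finset (Submodule k V)) := by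
    intro w hw
    simp only [Finset.coe_filter, Finset.mem_univ, true_and, Set.mem_ofPred_eq, hmem] at hw ⊢
    exact ⟨isLagrangian_span_pair hB ha hV hv hw.2 hw.1, Submodule.subset_span (by simp)⟩
  have hsum := Finset.card_eq_sum_card_fiberwise hmaps
  have hfib : ∀ l ∈ (Finset.univ.filter fun l => B.IsLagrangian l ∧ v ∈ l :
      Finset (Submodule k V)), (Finset.filter (fun w => Submodule.span k {v, w} = l)
        (Finset.univ.filter fun w => w ∈ B.orthogonal (k ∙ v) ∧ w ∉ k ∙ v)).card =
      Fintype.card k ^ 2 - Fintype.card k := by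
    intro l hl
    simp only [Finset.mem_filter, Finset.mem_univ, true_and] at hl
    obtain ⟨hl, hvl⟩ := hl
    have hvl' : k ∙ v ≤ l := (Submodule.span_singleton_le_iff_mem _ _).2 hvl
    have h2 := card_filter_mem_sdiff hvl'
    rw [hl.finrank hB hV, hv1, pow_one] at h2
    rw [← h2, Nat.add_sub_cancel]
    congr 1
    ext w
    simp only [Finset.mem_filter, Finset.mem_univ, true_and, hmem]
    constructor
    · rintro ⟨⟨-, h⟩, rfl⟩
      exact ⟨Submodule.subset_span (by simp), h⟩
    · rintro ⟨hwl, h⟩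
      refine ⟨⟨?_, h⟩, ?_⟩
      · have hwl' := hwl
        rw [← hl] at hwl'
        exact mem_orthogonal_iff.1 hwl' v hvl
      · apply Submodule.eq_of_le_of_finrank_eq
        · rw [Submodule.span_le]
          rintro x (rfl | rfl)
          exacts [hvl, hwl]
        · rw [finrank_span_pair hv h, hl.finrank hB hV]
  rw [Finset.sum_congr rfl hfib, Finset.sum_const, smul_eq_mul] at hsum
  rw [h3, hv1, pow_one, hsum] at hT
  rw [Set.ncard_eq_toFinset_card', Set.toFinset_ofPred]
  set n := (Finset.univ.filter fun l => B.IsLagrangian l ∧ v ∈ l : Finset (Submodule k V)).card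
  set q := Fintype.card k
  have hq2 : q ≤ q ^ 2 := Nat.le_self_pow (by norm_num) q
  zify [hq2] at hT hq ⊢
  have hne : ((q : ℤ) ^ 2 - q) ≠ 0 := by nlinarith
  apply mul_right_cancel₀ hne
  linear_combination hT

/-- Count pairs of a nonzero vector and a Lagrangian plane through it: `(q⁴ - 1)(q + 1)` by vectors,
`q² - 1` for each plane. -/
theorem ncard_isLagrangian (hB : B.Nondegenerate) (ha : B.IsAlt)
    (hV : Module.finrank k V = 4) :
    {l | B.IsLagrangian l}.ncard = (Fintype.card k ^ 2 + 1) * (Fintype.card k + 1) := by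
  classical
  have : Fintype (Submodule k V) := Fintype.ofFinite _
  have hq : 1 < Fintype.card k := Fintype.one_lt_card
  have hsum := Finset.sum_card_bipartiteAbove_eq_sum_card_bipartiteBelow
    (fun (v : V) (l : Submodule k V) => v ∈ l)
    (s := Finset.univ.filter fun v : V => v ∈ (⊤ : Submodule k V) ∧ v ∉ (⊥ : Submodule k V))
    (t := Finset.univ.filter fun l => B.IsLagrangian l)
  rw [Finset.sum_congr rfl (g := fun _ => Fintype.card k + 1), Finset.sum_const,
    Finset.sum_congr (s₁ := Finset.univ.filter fun l => B.IsLagrangian l) rfl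
      (g := fun _ => Fintype.card k ^ 2 - 1), Finset.sum_const, smul_eq_mul, smul_eq_mul] at hsum
  · have hT := card_filter_mem_sdiff (bot_le : (⊥ : Submodule k V) ≤ ⊤)
    rw [finrank_bot, finrank_top, hV, pow_zero] at hT
    rw [Set.ncard_eq_toFinset_card', Set.toFinset_ofPred]
    set n := (Finset.univ.filter fun l => B.IsLagrangian l : Finset (Submodule k V)).card
    set q := Fintype.card k
    have hq2 : 1 ≤ q ^ 2 := Nat.one_le_pow _ _ (by omega)
    zify [hq2] at hT hq hsum ⊢
    have hne : ((q : ℤ) ^ 2 - 1) ≠ 0 := by nlinarith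
    apply mul_right_cancel₀ hne
    rw [← hsum]
    linear_combination (q + 1 : ℤ) * hT
  · intro l hl
    simp only [Finset.mem_filter, Finset.mem_univ, true_and] at hl
    have h2 := card_filter_mem_sdiff (bot_le : (⊥ : Submodule k V) ≤ l)
    rw [hl.finrank hB hV, finrank_bot, pow_zero] at h2
    rw [← h2, Nat.add_sub_cancel]
    congr 1
    ext w
    simp [Finset.bipartiteBelow, and_comm]
  · intro v hv
    simp only [Finset.mem_filter, Finset.mem_univ, true_and, Submodule.mem_bot,
      Submodule.mem_top] at hv
    rw [← ncard_isLagrangian_of_mem hB ha hV hv, Set.ncard_eq_toFinset_card', Set.toFinset_ofPred]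
    congr 1
    ext l
    simp [Finset.bipartiteAbove]

end LinearMap.BilinForm

/-! ### Lattices between `p ℤ_p⁴` and `ℤ_p⁴` as subspaces of `𝔽_p⁴` -/

namespace GSp4

section padic

variable {p : ℕ} [Fact p.Prime]

/-- Reduction modulo `p` of vectors. -/
noncomputable def redVec (x : Fin 4 → ℤ_[p]) : Fin 4 → ZMod p := fun i => PadicInt.toZMod (x i)

theorem redVec_add (x y : Fin 4 → ℤ_[p]) : redVec (x + y) = redVec x + redVec y := by
  ext i
  simp [redVec]

theorem redVec_smul (c : ℤ_[p]) (x : Fin 4 → ℤ_[p]) :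
    redVec (c • x) = PadicInt.toZMod c • redVec x := by
  ext i
  simp [redVec]

theorem redVec_zero : redVec (0 : Fin 4 → ℤ_[p]) = 0 := by
  ext i
  simp [redVec]

theorem redVec_surjective : Function.Surjective (redVec (p := p)) := by
  intro v
  choose x hx using fun i => ZMod.ringHom_surjective (PadicInt.toZMod (p := p)) (v i)
  exact ⟨x, funext hx⟩

theorem toZMod_eq_zero_iff {x : ℤ_[p]} : PadicInt.toZMod x = 0 ↔ ‖(x : ℚ_[p])‖ < 1 := by
  rw [← RingHom.mem_ker, PadicInt.ker_toZMod, IsLocalRing.mem_maximalIdeal, PadicInt.mem_nonunits]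
  rfl

theorem intEmb_injective : Function.Injective (intEmb p) := by
  intro x y h
  exact funext fun i => Subtype.ext (congrFun h i)

/-- The lattice between `p ℤ_p⁴` and `ℤ_p⁴` with a given reduction modulo `p`. -/
noncomputable def latticeOver (l : Submodule (ZMod p) (Fin 4 → ZMod p)) :
    Submodule ℤ_[p] (Fin 4 → ℚ_[p]) where
  carrier := {x | ∃ y, intEmb p y = x ∧ redVec y ∈ l}
  zero_mem' := ⟨0, map_zero _, by rw [redVec_zero]; exact l.zero_mem⟩
  add_mem' := by
    rintro _ _ ⟨y, rfl, hy⟩ ⟨z, rfl, hz⟩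
    exact ⟨y + z, map_add _ _ _, by rw [redVec_add]; exact l.add_mem hy hz⟩
  smul_mem' := by
    rintro c _ ⟨y, rfl, hy⟩
    exact ⟨c • y, map_smul _ _ _, by rw [redVec_smul]; exact l.smul_mem _ hy⟩

theorem intEmb_mem_latticeOver {l : Submodule (ZMod p) (Fin 4 → ZMod p)} {y : Fin 4 → ℤ_[p]} :
    intEmb p y ∈ latticeOver l ↔ redVec y ∈ l := by
  constructor
  · rintro ⟨z, h, hz⟩
    rwa [← intEmb_injective h]
  · exact fun h => ⟨y, rfl, h⟩

theorem latticeOver_le_stdLattice (l : Submodule (ZMod p) (Fin 4 → ZMod p)) :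
    latticeOver l ≤ stdLattice p := by
  rintro _ ⟨y, rfl, -⟩
  exact ⟨y, rfl⟩

theorem latticeOver_injective : Function.Injective (latticeOver (p := p)) := by
  intro l l' h
  ext v
  obtain ⟨y, rfl⟩ := redVec_surjective v
  rw [← intEmb_mem_latticeOver, h, intEmb_mem_latticeOver]

theorem p_smul_mem_latticeOver (l : Submodule (ZMod p) (Fin 4 → ZMod p)) {x : Fin 4 → ℚ_[p]}
    (hx : x ∈ stdLattice p) : (p : ℚ_[p]) • x ∈ latticeOver l := by
  obtain ⟨y, rfl⟩ := hx
  refine ⟨(p : ℤ_[p]) • y, ?_, ?_⟩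
  · ext i
    simp [intEmb_apply]
  · rw [redVec_smul]
    simp

theorem exists_latticeOver_eq {Λ : Submodule ℤ_[p] (Fin 4 → ℚ_[p])} (h1 : Λ ≤ stdLattice p)
    (h2 : ∀ x ∈ stdLattice p, (p : ℚ_[p]) • x ∈ Λ) : ∃ l, latticeOver l = Λ := by
  refine ⟨{ carrier := {v | ∃ y, redVec y = v ∧ intEmb p y ∈ Λ}
            zero_mem' := ⟨0, redVec_zero, by rw [map_zero]; exact Λ.zero_mem⟩
            add_mem' := ?_
            smul_mem' := ?_ }, ?_⟩
  · rintro _ _ ⟨y, rfl, hy⟩ ⟨z, rfl, hz⟩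
    exact ⟨y + z, redVec_add _ _, by rw [map_add]; exact Λ.add_mem hy hz⟩
  · rintro c _ ⟨y, rfl, hy⟩
    obtain ⟨d, rfl⟩ := ZMod.ringHom_surjective (PadicInt.toZMod (p := p)) c
    exact ⟨d • y, redVec_smul _ _, by rw [map_smul]; exact Λ.smul_mem _ hy⟩
  · ext x
    constructor
    · rintro ⟨y, rfl, z, hz, hzΛ⟩
      have hyz : ∀ i, ∃ w : ℤ_[p], y i - z i = p * w := by
        intro i
        have : PadicInt.toZMod (y i - z i) = 0 := by
          rw [map_sub, sub_eq_zero]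
          exact (congrFun hz i).symm
        rw [toZMod_eq_zero_iff] at this
        exact (PadicInt.norm_lt_one_iff_dvd _).1 this
      choose w hw using hyz
      have e : intEmb p y = intEmb p z + (p : ℚ_[p]) • intEmb p w := by
        ext i
        have := congrArg (fun t : ℤ_[p] => (t : ℚ_[p])) (hw i)
        simp only [PadicInt.coe_sub, PadicInt.coe_mul, PadicInt.coe_natCast] at this
        simp only [Pi.add_apply, Pi.smul_apply, intEmb_apply, smul_eq_mul, ← this]
        ring
      rw [e]
      exact Λ.add_mem hzΛ (h2 _ ⟨w, rfl⟩)
    · intro hx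
      obtain ⟨y, rfl⟩ := h1 hx
      exact ⟨y, rfl, y, rfl, hx⟩

variable (p) in
/-- The symplectic form on `𝔽_p⁴`. -/
noncomputable def modForm : LinearMap.BilinForm (ZMod p) (Fin 4 → ZMod p) :=
  Matrix.toBilin' (matJ (ZMod p))

theorem modForm_apply (v w : Fin 4 → ZMod p) :
    modForm p v w = v 0 * w 3 + v 1 * w 2 - v 2 * w 1 - v 3 * w 0 := by
  rw [modForm, Matrix.toBilin'_apply']
  simp [matJ, Matrix.mulVec, dotProduct, Fin.sum_univ_four]
  ring

theorem modForm_isAlt : (modForm p).IsAlt := by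
  intro v
  rw [modForm_apply]
  ring

theorem modForm_nondegenerate : (modForm p).Nondegenerate := by
  apply LinearMap.BilinForm.nondegenerate_toBilin'_of_det_ne_zero'
  intro h
  have := congrArg Matrix.det (matJ_mul_matJ (ZMod p))
  rw [Matrix.det_mul, h, mul_zero] at this
  simp [Matrix.det_neg, Even.neg_one_pow (by decide : Even 4)] at this

theorem toZMod_form_eq_zero_iff {y z : Fin 4 → ℤ_[p]} : modForm p (redVec y) (redVec z) = 0 ↔
    ‖intEmb p y ⬝ᵥ (matJ ℚ_[p]).mulVec (intEmb p z)‖ < 1 := by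
  have h1 : modForm p (redVec y) (redVec z) =
      PadicInt.toZMod (y 0 * z 3 + y 1 * z 2 - y 2 * z 1 - y 3 * z 0) := by
    simp [modForm_apply, redVec]
  rw [h1, toZMod_eq_zero_iff, dotProduct_matJ_mulVec]
  simp [intEmb_apply]

theorem norm_p_mul_lt_one_iff {x : ℚ_[p]} : ‖(p : ℚ_[p]) * x‖ < 1 ↔ ‖x‖ ≤ 1 := by
  have hp : (p : ℚ_[p]) ≠ 0 := by exact_mod_cast (Fact.out : p.Prime).ne_zero
  constructor
  · intro h
    have := norm_div_p_le h
    rwa [inv_mul_cancel_left₀ hp] at this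
  · intro h
    rw [norm_mul]
    exact mul_lt_one_of_nonneg_of_lt_one_left (norm_nonneg _) Padic.norm_p_lt_one h

/-- As the lattice contains `p ℤ_p⁴`, its dual lies in `p⁻¹ ℤ_p⁴`; after multiplication by `p`,
integrality of the pairing becomes orthogonality modulo `p`. -/
theorem mem_dualLattice_latticeOver {l : Submodule (ZMod p) (Fin 4 → ZMod p)}
    {x : Fin 4 → ℚ_[p]} : x ∈ dualLattice p (latticeOver l) ↔
      (p : ℚ_[p]) • x ∈ latticeOver ((modForm p).orthogonal l) := by
  have hsymm : ∀ v w, modForm p v w = 0 ↔ modForm p w v = 0 := fun v w => by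
    rw [← modForm_isAlt.neg_eq, neg_eq_zero]
  rw [mem_dualLattice]
  constructor
  · intro h
    have hx : (p : ℚ_[p]) • x ∈ stdLattice p := by
      rw [← dualLattice_stdLattice, mem_dualLattice]
      intro y hy
      have := h _ (p_smul_mem_latticeOver l hy)
      rwa [Matrix.mulVec_smul, dotProduct_smul, ← smul_dotProduct] at this
    obtain ⟨y, hy⟩ := hx
    rw [← hy, intEmb_mem_latticeOver, LinearMap.BilinForm.mem_orthogonal_iff]
    intro w hw
    obtain ⟨z, rfl⟩ := redVec_surjective w
    rw [hsymm, toZMod_form_eq_zero_iff, hy, smul_dotProduct, smul_eq_mul, norm_p_mul_lt_one_iff]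
    exact h _ (intEmb_mem_latticeOver.2 hw)
  · rintro ⟨y, hy, hyl⟩ _ ⟨z, rfl, hz⟩
    have := LinearMap.BilinForm.mem_orthogonal_iff.1 hyl _ hz
    rwa [hsymm, toZMod_form_eq_zero_iff, hy, smul_dotProduct, smul_eq_mul,
      norm_p_mul_lt_one_iff] at this

theorem isVertexLatticeTwo_latticeOver_iff {l : Submodule (ZMod p) (Fin 4 → ZMod p)} :
    IsVertexLatticeTwo p (latticeOver l) ↔ (modForm p).IsLagrangian l := by
  have hp : (p : ℚ_[p]) ≠ 0 := by exact_mod_cast (Fact.out : p.Prime).ne_zero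
  rw [isVertexLatticeTwo_iff]
  simp only [mem_dualLattice_latticeOver]
  constructor
  · rintro ⟨-, h⟩
    apply latticeOver_injective
    ext x
    have := h ((p : ℚ_[p])⁻¹ • x)
    rwa [smul_smul, mul_inv_cancel₀ hp, one_smul] at this
  · intro h
    refine ⟨⟨?_, ?_⟩, fun x => by rw [h]⟩
    · have : IsNoetherian ℤ_[p] (stdLattice p) :=
        isNoetherian_of_fg_of_noetherian _ (isLattice_stdLattice (p := p)).fg
      exact Submodule.FG.of_le (isLattice_stdLattice (p := p)).fg (latticeOver_le_stdLattice l)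
    · rw [eq_top_iff, ← (isLattice_stdLattice (p := p)).span_eq_top, Submodule.span_le]
      intro x hx
      have h1 := Submodule.subset_span (R := ℚ_[p]) (p_smul_mem_latticeOver l hx)
      have h2 := Submodule.smul_mem _ (p : ℚ_[p])⁻¹ h1
      rwa [smul_smul, inv_mul_cancel₀ hp, one_smul] at h2

/-- Dualizing the inclusion gives `ℤ_p⁴ ⊆ Λ^∨ = p⁻¹ Λ`, so a type 2 sublattice of `ℤ_p⁴` is
determined by its reduction. -/
theorem p_smul_mem_of_isVertexLatticeTwo {Λ : Submodule ℤ_[p] (Fin 4 → ℚ_[p])}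
    (h : IsVertexLatticeTwo p Λ) (hle : Λ ≤ stdLattice p) {x : Fin 4 → ℚ_[p]}
    (hx : x ∈ stdLattice p) : (p : ℚ_[p]) • x ∈ Λ := by
  rw [← (isVertexLatticeTwo_iff.1 h).2, mem_dualLattice]
  rw [← dualLattice_stdLattice, mem_dualLattice] at hx
  exact fun y hy => hx y (hle hy)

theorem image_latticeOver (Λ : Submodule ℤ_[p] (Fin 4 → ℚ_[p])) :
    latticeOver '' {l | (modForm p).IsLagrangian l ∧ Λ ≤ latticeOver l} =
      {L | IsVertexLatticeTwo p L ∧ L ≤ stdLattice p ∧ Λ ≤ L} := by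
  ext L
  constructor
  · rintro ⟨l, ⟨h1, h2⟩, rfl⟩
    exact ⟨isVertexLatticeTwo_latticeOver_iff.2 h1, latticeOver_le_stdLattice l, h2⟩
  · rintro ⟨h1, h2, h3⟩
    obtain ⟨l, rfl⟩ := exists_latticeOver_eq h2 fun x => p_smul_mem_of_isVertexLatticeTwo h1 h2
    exact ⟨l, ⟨isVertexLatticeTwo_latticeOver_iff.1 h1, h3⟩, rfl⟩

theorem ncard_isVertexLatticeTwo (Λ : Submodule ℤ_[p] (Fin 4 → ℚ_[p])) :
    {L | IsVertexLatticeTwo p L ∧ L ≤ stdLattice p ∧ Λ ≤ L}.ncard =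
      {l | (modForm p).IsLagrangian l ∧ Λ ≤ latticeOver l}.ncard := by
  rw [← image_latticeOver, Set.ncard_image_of_injective _ latticeOver_injective]

/-! ### The three lattice counts -/

theorem latticeMap_torusElt_le (a b c d : ℤ) (h : a + d = b + c)
    {Λ : Submodule ℤ_[p] (Fin 4 → ℚ_[p])} :
    latticeMap p (torusElt p a b c d h) (stdLattice p) ≤ Λ ↔
      ∀ i, (p : ℚ_[p]) ^ (![a, b, c, d] i) • (Pi.single i 1 : Fin 4 → ℚ_[p]) ∈ Λ := by
  have e : ∀ (y : Fin 4 → ℚ_[p]), (torusElt p a b c d h).1.1.mulVec y =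
      ∑ i, y i • (p : ℚ_[p]) ^ (![a, b, c, d] i) • (Pi.single i 1 : Fin 4 → ℚ_[p]) := by
    intro y
    ext j
    rw [torusElt_val, Matrix.mulVec_diagonal, Finset.sum_apply]
    fin_cases j <;> simp [Fin.sum_univ_four, mul_comm]
  constructor
  · intro hle i
    have := hle (mem_latticeMap.2 ⟨_, single_mem_stdLattice i, rfl⟩)
    rw [e, Finset.sum_eq_single i] at this
    · simpa using this
    · intro j _ hj
      simp [hj]
    · simp
  · rintro hΛ _ ⟨_, ⟨y, rfl⟩, rfl⟩
    change (torusElt p a b c d h).1.1.mulVec _ ∈ Λ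
    rw [e]
    exact Submodule.sum_mem _ fun i _ => Λ.smul_mem (y i) (hΛ i)

theorem single_mem_latticeOver {l : Submodule (ZMod p) (Fin 4 → ZMod p)} (i : Fin 4) :
    (Pi.single i 1 : Fin 4 → ℚ_[p]) ∈ latticeOver l ↔ Pi.single i 1 ∈ l := by
  have h1 : (Pi.single i 1 : Fin 4 → ℚ_[p]) = intEmb p (Pi.single i 1) := by
    ext j
    rw [intEmb_apply, Pi.single_apply, Pi.single_apply]
    split_ifs <;> simp
  have h2 : redVec (Pi.single i 1 : Fin 4 → ℤ_[p]) = Pi.single i 1 := by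
    ext j
    rw [redVec, Pi.single_apply, Pi.single_apply]
    split_ifs <;> simp
  rw [h1, intEmb_mem_latticeOver, h2]

theorem pow_smul_single_mem_latticeOver {l : Submodule (ZMod p) (Fin 4 → ZMod p)} {n : ℤ}
    (hn : 0 < n) (i : Fin 4) :
    (p : ℚ_[p]) ^ n • (Pi.single i 1 : Fin 4 → ℚ_[p]) ∈ latticeOver l := by
  have hp : (p : ℚ_[p]) ≠ 0 := by exact_mod_cast (Fact.out : p.Prime).ne_zero
  rw [show n = 1 + (n - 1) by ring, zpow_one_add₀ hp, mul_smul]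
  apply p_smul_mem_latticeOver
  rw [mem_stdLattice]
  intro j
  have : ‖(p : ℚ_[p]) ^ (n - 1)‖ ≤ 1 := by
    rw [Padic.norm_p_zpow]
    exact zpow_le_one_of_nonpos₀ (by exact_mod_cast (Fact.out : p.Prime).one_lt.le) (by omega)
  rw [Pi.smul_apply, Pi.single_apply]
  split_ifs
  · simpa using this
  · simp

/-- The vectors `p e_i` lie in every such lattice, so all Lagrangian planes count. -/
theorem ncard_of_scalar :
    {L | IsVertexLatticeTwo p L ∧ L ≤ stdLattice p ∧
      latticeMap p (torusElt p 1 1 1 1 (by norm_num)) (stdLattice p) ≤ L}.ncard =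
      (p ^ 2 + 1) * (p + 1) := by
  have h := LinearMap.BilinForm.ncard_isLagrangian (modForm_nondegenerate (p := p)) modForm_isAlt
    (by simp)
  rw [ZMod.card] at h
  rw [ncard_isVertexLatticeTwo, ← h]
  congr 1
  ext l
  refine and_iff_left ?_
  rw [latticeMap_torusElt_le]
  intro i
  apply pow_smul_single_mem_latticeOver
  fin_cases i <;> simp

/-- Only the exponent 0 gives a condition, namely that the plane contain the last basis vector. -/
theorem ncard_of_klingen :
    {L | IsVertexLatticeTwo p L ∧ L ≤ stdLattice p ∧
      latticeMap p (torusElt p 2 1 1 0 (by norm_num)) (stdLattice p) ≤ L}.ncard = p + 1 := by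
  have h := LinearMap.BilinForm.ncard_isLagrangian_of_mem (modForm_nondegenerate (p := p))
    modForm_isAlt (by simp) (v := Pi.single 3 1) (by simp)
  rw [ZMod.card] at h
  rw [ncard_isVertexLatticeTwo, ← h]
  congr 1
  ext l
  refine and_congr_right fun _ => ?_
  rw [latticeMap_torusElt_le, ← single_mem_latticeOver]
  constructor
  · intro h
    simpa using h 3
  · intro h i
    fin_cases i
    · exact pow_smul_single_mem_latticeOver (by simp) _
    · exact pow_smul_single_mem_latticeOver (by simp) _
    · exact pow_smul_single_mem_latticeOver (by simp) _
    · simpa using h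

/-- The two exponents 0 force the plane to be the span of the last two basis vectors, which is
Lagrangian. -/
theorem ncard_of_siegel :
    {L | IsVertexLatticeTwo p L ∧ L ≤ stdLattice p ∧
      latticeMap p (torusElt p 2 2 0 0 (by norm_num)) (stdLattice p) ≤ L}.ncard = 1 := by
  have hv : (Pi.single 2 1 : Fin 4 → ZMod p) ≠ 0 := by simp
  have hw : (Pi.single 3 1 : Fin 4 → ZMod p) ∉ (ZMod p) ∙ (Pi.single 2 1 : Fin 4 → ZMod p) := by
    rw [Submodule.mem_span_singleton]
    rintro ⟨a, ha⟩
    simpa using congrFun ha 3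
  have hL := LinearMap.BilinForm.isLagrangian_span_pair (modForm_nondegenerate (p := p))
    modForm_isAlt (by simp) hv hw (by simp [modForm_apply])
  rw [ncard_isVertexLatticeTwo, Set.ncard_eq_one]
  refine ⟨_, Set.eq_singleton_iff_unique_mem.2 ⟨⟨hL, ?_⟩, ?_⟩⟩
  · rw [latticeMap_torusElt_le]
    intro i
    fin_cases i
    · exact pow_smul_single_mem_latticeOver (by simp) _
    · exact pow_smul_single_mem_latticeOver (by simp) _
    · simpa [single_mem_latticeOver] using Submodule.subset_span (by simp)
    · simpa [single_mem_latticeOver] using Submodule.subset_span (by simp)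
  · rintro l ⟨hl, hle⟩
    rw [latticeMap_torusElt_le] at hle
    symm
    apply Submodule.eq_of_le_of_finrank_eq
    · rw [Submodule.span_le]
      rintro x (rfl | rfl)
      · simpa [single_mem_latticeOver] using hle 2
      · simpa [single_mem_latticeOver] using hle 3
    · rw [hl.finrank modForm_nondegenerate (by simp),
        LinearMap.BilinForm.finrank_span_pair hv hw]

/-! ### Characteristic functions of double cosets and scalar elements -/

theorem mem_hyperspecial {g x : GSp4 ℚ_[p]} :
    x ∈ hyperspecial p g ↔ g⁻¹ * x * g ∈ GSp4Int p := by
  constructor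
  · rintro ⟨y, hy, rfl⟩
    have e : g⁻¹ * (MulAut.conj g).toMonoidHom y * g = y := by
      simp only [MulEquiv.coe_toMonoidHom, MulAut.conj_apply]
      group
    rw [e]
    exact hy
  · intro h
    refine ⟨_, h, ?_⟩
    simp only [MulEquiv.coe_toMonoidHom, MulAut.conj_apply]
    group

theorem mem_hyperspecial_one {x : GSp4 ℚ_[p]} : x ∈ hyperspecial p 1 ↔ x ∈ GSp4Int p := by
  simp [mem_hyperspecial]

theorem mem_hyperspecial_iff_one (g : GSp4 ℚ_[p]) (x : GSp4 ℚ_[p]) :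
    x ∈ hyperspecial p g ↔ g⁻¹ * x * g ∈ hyperspecial p 1 := by
  rw [mem_hyperspecial, mem_hyperspecial_one]

theorem mem_doubleCoset_iff {g h x y : GSp4 ℚ_[p]} :
    y ∈ DoubleCoset.doubleCoset (g * x * h⁻¹) (hyperspecial p g : Set (GSp4 ℚ_[p]))
      (hyperspecial p h : Set (GSp4 ℚ_[p])) ↔ Assoc x (g⁻¹ * y * h) := by
  rw [DoubleCoset.mem_doubleCoset]
  constructor
  · rintro ⟨a, ha, b, hb, rfl⟩
    exact ⟨_, mem_hyperspecial.1 ha, _, mem_hyperspecial.1 hb, by group⟩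
  · rintro ⟨a, ha, b, hb, e⟩
    refine ⟨g * a * g⁻¹, mem_hyperspecial.2 ?_, h * b * h⁻¹, mem_hyperspecial.2 ?_, ?_⟩
    · convert ha using 1
      group
    · convert hb using 1
      group
    · have : y = g * (g⁻¹ * y * h) * h⁻¹ := by group
      rw [this, e]
      group

theorem charDoubleCoset_val (g h x : GSp4 ℚ_[p]) :
    (charDoubleCoset p g h (g * x * h⁻¹)).1 = Set.indicator {y | Assoc x (g⁻¹ * y * h)} 1 := by
  classical
  ext y
  simp only [charDoubleCoset, Set.indicator_apply, mem_doubleCoset_iff, Set.mem_ofPred_eq]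

/-- The characteristic function of `GSp₄(ℤ_p) x GSp₄(ℤ_p)`. -/
noncomputable def charStd (x : GSp4 ℚ_[p]) :
    heckeModule (hyperspecial p 1) (hyperspecial p 1) := charDoubleCoset p 1 1 x

theorem charStd_val (x : GSp4 ℚ_[p]) : (charStd x).1 = Set.indicator {y | Assoc x y} 1 := by
  have := charDoubleCoset_val 1 1 x
  simpa [charStd] using this

theorem transport_charStd (g h x : GSp4 ℚ_[p]) :
    heckeModule.transport g h (mem_hyperspecial_iff_one g) (mem_hyperspecial_iff_one h)
      (charStd x) = charDoubleCoset p g h (g * x * h⁻¹) := by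
  ext y
  rw [heckeModule.transport_apply, charStd_val, charDoubleCoset_val]
  rfl

variable (p) in
/-- The scalar element `p^n`. -/
noncomputable def scalarElt (n : ℤ) : GSp4 ℚ_[p] := torusElt p n n n n rfl

theorem scalarElt_val (n : ℤ) : (scalarElt p n).1.1 = (p : ℚ_[p]) ^ n • 1 := by
  rw [scalarElt, torusElt_val, Matrix.smul_one_eq_diagonal]
  congr 1
  ext i
  fin_cases i <;> rfl

theorem scalarElt_mem_center (n : ℤ) : scalarElt p n ∈ Subgroup.center (GSp4 ℚ_[p]) := by
  rw [Subgroup.mem_center_iff]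
  intro g
  apply ext_matrix
  rw [mul_val, mul_val, scalarElt_val]
  simp

theorem torusElt_mul (a b c d a' b' c' d' : ℤ) (h : a + d = b + c) (h' : a' + d' = b' + c')
    (h'' : (a + a') + (d + d') = (b + b') + (c + c')) :
    torusElt p a b c d h * torusElt p a' b' c' d' h' =
      torusElt p (a + a') (b + b') (c + c') (d + d') h'' := by
  have hp : (p : ℚ_[p]) ≠ 0 := by exact_mod_cast (Fact.out : p.Prime).ne_zero
  apply ext_matrix
  rw [mul_val, torusElt_val, torusElt_val, torusElt_val, Matrix.diagonal_mul_diagonal]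
  congr 1
  ext i
  fin_cases i <;> simp [zpow_add₀ hp]

theorem scalarElt_mul_torusElt (n a b c d : ℤ) (h : a + d = b + c)
    (h' : (n + a) + (n + d) = (n + b) + (n + c)) :
    scalarElt p n * torusElt p a b c d h =
      torusElt p (n + a) (n + b) (n + c) (n + d) h' := torusElt_mul _ _ _ _ _ _ _ _ _ _ _

theorem torusElt_zero : torusElt p 0 0 0 0 (by norm_num) = 1 := by
  apply ext_matrix
  rw [torusElt_val]
  simp only [zpow_zero]
  change _ = (1 : Matrix (Fin 4) (Fin 4) ℚ_[p])
  rw [← Matrix.diagonal_one]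
  congr 1
  ext i
  fin_cases i <;> rfl

theorem scalarElt_inv (n : ℤ) : (scalarElt p n)⁻¹ = scalarElt p (-n) := by
  rw [inv_eq_iff_mul_eq_one]
  refine (scalarElt_mul_torusElt n (-n) (-n) (-n) (-n) rfl rfl).trans ?_
  rw [← torusElt_zero]
  congr 1 <;> ring

theorem Assoc.mul_left_center {a x y : GSp4 ℚ_[p]} (ha : a ∈ Subgroup.center (GSp4 ℚ_[p]))
    (h : Assoc x y) : Assoc (a * x) (a * y) := by
  obtain ⟨k, hk, l, hl, rfl⟩ := h
  refine ⟨k, hk, l, hl, ?_⟩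
  rw [← mul_assoc, ← mul_assoc, ← mul_assoc, Subgroup.mem_center_iff.1 ha k]

theorem assoc_mul_left_center_iff {a x y : GSp4 ℚ_[p]}
    (ha : a ∈ Subgroup.center (GSp4 ℚ_[p])) : Assoc (a * x) y ↔ Assoc x (a⁻¹ * y) := by
  constructor
  · intro h
    have := h.mul_left_center (inv_mem ha)
    rwa [inv_mul_cancel_left] at this
  · intro h
    have := h.mul_left_center ha
    rwa [mul_inv_cancel_left] at this

theorem assoc_one_iff {x : GSp4 ℚ_[p]} : Assoc 1 x ↔ x ∈ GSp4Int p := by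
  constructor
  · rintro ⟨a, ha, b, hb, rfl⟩
    rw [mul_one]
    exact mul_mem ha hb
  · exact fun h => ⟨x, h, 1, one_mem _, by simp⟩

/-- For central `a` the double coset `K a K` is the single coset `a K`. -/
theorem charStd_center_val {a : GSp4 ℚ_[p]} (ha : a ∈ Subgroup.center (GSp4 ℚ_[p])) :
    (charStd a).1 = Set.indicator {x | a⁻¹ * x ∈ hyperspecial p 1} 1 := by
  rw [charStd_val]
  congr 1
  ext x
  change Assoc a x ↔ a⁻¹ * x ∈ hyperspecial p 1
  rw [mem_hyperspecial_one, ← assoc_one_iff, ← assoc_mul_left_center_iff ha, mul_one]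

theorem charStd_center_mul {a : GSp4 ℚ_[p]} (ha : a ∈ Subgroup.center (GSp4 ℚ_[p]))
    (x : GSp4 ℚ_[p]) : charStd a * charStd x = charStd (a * x) := by
  classical
  ext y
  rw [heckeModule.mul_def, heckeModule.central_conv _ (charStd_center_val ha), charStd_val,
    charStd_val]
  simp only [Set.indicator_apply, Set.mem_ofPred_eq, assoc_mul_left_center_iff ha]
  rfl

theorem charStd_center_comm {a : GSp4 ℚ_[p]} (ha : a ∈ Subgroup.center (GSp4 ℚ_[p]))
    (f : heckeModule (hyperspecial p 1) (hyperspecial p 1)) :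
    charStd a * f = f * charStd a := by
  ext y
  rw [heckeModule.mul_def, heckeModule.mul_def,
    heckeModule.central_conv _ (charStd_center_val ha),
    heckeModule.conv_central ha _ (charStd_center_val ha)]

theorem charStd_one : charStd (1 : GSp4 ℚ_[p]) = 1 := by
  have h := charStd_center_val (p := p) (one_mem _)
  ext y
  rw [h]
  change _ = (heckeModule.unit (hyperspecial p 1)).1 y
  simp [heckeModule.unit]

/-! ### The square of `T_{p,2}` -/

/-- The value of `T_{p,2}²` at an element with similitude factor of valuation `2` is a number of
vertex lattices of type `2`. -/
theorem charStd_siegel_sq_apply {x : GSp4 ℚ_[p]} (hx : ‖simil x‖ = (p : ℝ) ^ (-2 : ℤ)) :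
    (charStd (torusElt p 1 1 0 0 (by norm_num)) *
      charStd (torusElt p 1 1 0 0 (by norm_num))).1 x =
      ({L | IsVertexLatticeTwo p L ∧ L ≤ stdLattice p ∧
        latticeMap p x (stdLattice p) ≤ L}.ncard : ℤ) := by
  classical
  have hp : (p : ℝ) ≠ 0 := by exact_mod_cast (Fact.out : p.Prime).ne_zero
  set S : Set (GSp4 ℚ_[p] ⧸ hyperspecial p 1) := {c |
    IsVertexLatticeTwo p (latticeMap p c.out (stdLattice p)) ∧
    latticeMap p c.out (stdLattice p) ≤ stdLattice p ∧
    latticeMap p x (stdLattice p) ≤ latticeMap p c.out (stdLattice p)} with hS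
  -- Cosets of `K` correspond to translates of `ℤ_p⁴`; every type 2 lattice is reached because it
  -- has a symplectic basis up to scaling.
  have himage : (fun c : GSp4 ℚ_[p] ⧸ hyperspecial p 1 => latticeMap p c.out (stdLattice p)) '' S =
      {L | IsVertexLatticeTwo p L ∧ L ≤ stdLattice p ∧ latticeMap p x (stdLattice p) ≤ L} := by
    ext L
    constructor
    · rintro ⟨c, hc, rfl⟩
      exact hc
    · intro hL
      obtain ⟨g, rfl⟩ := exists_latticeMap_eq_of_two hL.1
      have e : latticeMap p (g : GSp4 ℚ_[p] ⧸ hyperspecial p 1).out (stdLattice p) =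
          latticeMap p g (stdLattice p) := by
        obtain ⟨l, hl⟩ := QuotientGroup.mk_out_eq_mul (hyperspecial p 1) g
        rw [latticeMap_stdLattice_eq_iff, hl, inv_mul_cancel_left]
        exact mem_hyperspecial_one.1 l.2
      refine ⟨(g : GSp4 ℚ_[p] ⧸ hyperspecial p 1), ?_, e⟩
      rw [hS, Set.mem_ofPred_eq, e]
      exact hL
  have hinj : Function.Injective
      (fun c : GSp4 ℚ_[p] ⧸ hyperspecial p 1 => latticeMap p c.out (stdLattice p)) := by
    intro c d hcd
    have h1 := latticeMap_stdLattice_eq_iff.1 hcd.symm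
    rw [← mem_hyperspecial_one, ← QuotientGroup.eq] at h1
    simpa using h1
  rw [← himage, Set.ncard_image_of_injective _ hinj, heckeModule.mul_def, heckeModule.conv_apply]
  have hterm : ∀ c : GSp4 ℚ_[p] ⧸ hyperspecial p 1,
      (charStd (torusElt p 1 1 0 0 (by norm_num))).1 c.out *
        (charStd (torusElt p 1 1 0 0 (by norm_num))).1 (c.out⁻¹ * x) = S.indicator 1 c := by
    intro c
    simp only [charStd_val, Set.indicator_apply, Set.mem_ofPred_eq, assoc_siegel_iff, hS, isVertexLatticeTwo_latticeMap, latticeMap_stdLattice_le,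
      latticeMap_stdLattice_le_iff]
    -- The similitude condition on the second factor is automatic, since `c(x)` has valuation 2;
    -- what remains are the two integrality conditions, that is, the two inclusions.
    have : ‖simil c.out‖ = (p : ℝ) ^ (-1 : ℤ) → ‖simil (c.out⁻¹ * x)‖ = (p : ℝ) ^ (-1 : ℤ) := by
      intro h
      rw [simil_mul, simil_inv, norm_mul, norm_inv, h, hx, ← zpow_neg, ← zpow_add₀ hp]
      norm_num
    by_cases h1 : ‖simil c.out‖ = (p : ℝ) ^ (-1 : ℤ)
    · simp only [h1, this h1, and_true, true_and]
      by_cases h2 : IsIntegral c.out <;> by_cases h3 : IsIntegral (c.out⁻¹ * x) <;> simp [h2, h3]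
    · simp only [h1, and_false, false_and, if_false, zero_mul]
  rw [finsum_congr hterm]
  have hfin : S.Finite := by
    refine Set.Finite.of_finite_image ?_ hinj.injOn
    rw [himage, ← image_latticeOver]
    exact (Set.toFinite _).image _
  rw [← finsum_mem_def, finsum_mem_eq_finite_toFinset_sum _ hfin, Set.ncard_eq_toFinset_card S hfin]
  simp

theorem charStd_congr {x y : GSp4 ℚ_[p]} (h : Assoc x y) : charStd x = charStd y := by
  ext z
  rw [charStd_val, charStd_val]
  congr 1
  ext w
  exact ⟨fun e => h.symm.trans e, fun e => h.trans e⟩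

theorem apply_eq_of_assoc (f : heckeModule (hyperspecial p 1) (hyperspecial p 1))
    {x y : GSp4 ℚ_[p]} (h : Assoc x y) : f.1 x = f.1 y := by
  obtain ⟨a, ha, b, hb, rfl⟩ := h
  exact (f.2.1 a (mem_hyperspecial_one.2 ha) b (mem_hyperspecial_one.2 hb) x).symm

theorem charStd_mul_apply_ne_zero {x y z : GSp4 ℚ_[p]} (h : (charStd x * charStd y).1 z ≠ 0) :
    ∃ a b, Assoc x a ∧ Assoc y b ∧ z = a * b := by
  rw [heckeModule.mul_def, heckeModule.conv_apply] at h
  obtain ⟨c, hc⟩ : ∃ c : GSp4 ℚ_[p] ⧸ hyperspecial p 1,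
      (charStd x).1 c.out * (charStd y).1 (c.out⁻¹ * z) ≠ 0 := by
    by_contra! hc
    exact h (finsum_eq_zero_of_forall_eq_zero hc)
  rw [charStd_val, charStd_val] at hc
  have h1 : c.out ∈ {w | Assoc x w} := Set.mem_of_indicator_ne_zero (left_ne_zero_of_mul hc)
  have h2 : c.out⁻¹ * z ∈ {w | Assoc y w} :=
    Set.mem_of_indicator_ne_zero (right_ne_zero_of_mul hc)
  exact ⟨c.out, c.out⁻¹ * z, h1, h2, by group⟩

theorem natCast_mul_apply (n : ℕ) (f : heckeModule (hyperspecial p 1) (hyperspecial p 1))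
    (x : GSp4 ℚ_[p]) :
    ((n : heckeModule (hyperspecial p 1) (hyperspecial p 1)) * f).1 x = n * f.1 x := by
  rw [← nsmul_eq_mul]
  change (n • f.1) x = _
  simp

/-- The decomposition of `T_{p,2}²` in the Hecke ring of `GSp₄`. -/
theorem charStd_siegel_sq :
    charStd (torusElt p 1 1 0 0 (by norm_num)) * charStd (torusElt p 1 1 0 0 (by norm_num)) =
      charStd (torusElt p 2 2 0 0 (by norm_num)) +
        ((p + 1 : ℕ) : heckeModule (hyperspecial p 1) (hyperspecial p 1)) *
          charStd (torusElt p 2 1 1 0 (by norm_num)) +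
        (((p ^ 2 + 1) * (p + 1) : ℕ) : heckeModule (hyperspecial p 1) (hyperspecial p 1)) *
          charStd (torusElt p 1 1 1 1 (by norm_num)) := by
  classical
  have hp : 1 < p := (Fact.out : p.Prime).one_lt
  set F := charStd (torusElt p 1 1 0 0 (by norm_num)) *
    charStd (torusElt p 1 1 0 0 (by norm_num)) with hF
  have h1 : F.1 (torusElt p 2 2 0 0 (by norm_num)) = 1 := by
    rw [hF, charStd_siegel_sq_apply (by rw [norm_simil_torusElt]; norm_num), ncard_of_siegel]
    rfl
  have h2 : F.1 (torusElt p 2 1 1 0 (by norm_num)) = (p + 1 : ℕ) := by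
    rw [hF, charStd_siegel_sq_apply (by rw [norm_simil_torusElt]; norm_num), ncard_of_klingen]
  have h3 : F.1 (torusElt p 1 1 1 1 (by norm_num)) = ((p ^ 2 + 1) * (p + 1) : ℕ) := by
    rw [hF, charStd_siegel_sq_apply (by rw [norm_simil_torusElt]; norm_num), ncard_of_scalar]
  -- The three values are distinct, so the double cosets are disjoint; uniqueness in the Cartan
  -- decomposition is not needed.
  have hlt : p + 1 < (p ^ 2 + 1) * (p + 1) := by nlinarith
  ext y
  change F.1 y = (charStd (torusElt p 2 2 0 0 (by norm_num))).1 y + (_ * _ : heckeModule _ _).1 y +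
    (_ * _ : heckeModule _ _).1 y
  rw [natCast_mul_apply, natCast_mul_apply, charStd_val, charStd_val, charStd_val]
  simp only [Set.indicator_apply, Set.mem_ofPred_eq, Pi.one_apply]
  by_cases c1 : Assoc (torusElt p 2 2 0 0 (by norm_num)) y
  · have e := apply_eq_of_assoc F c1
    have c2 : ¬ Assoc (torusElt p 2 1 1 0 (by norm_num)) y := by
      intro c
      have e' := apply_eq_of_assoc F c
      omega
    have c3 : ¬ Assoc (torusElt p 1 1 1 1 (by norm_num)) y := by
      intro c
      have e' := apply_eq_of_assoc F c
      omega
    simp [c1, c2, c3, ← e, h1]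
  by_cases c2 : Assoc (torusElt p 2 1 1 0 (by norm_num)) y
  · have e := apply_eq_of_assoc F c2
    have c3 : ¬ Assoc (torusElt p 1 1 1 1 (by norm_num)) y := by
      intro c
      have e' := apply_eq_of_assoc F c
      omega
    simp [c1, c2, c3, ← e, h2]
  by_cases c3 : Assoc (torusElt p 1 1 1 1 (by norm_num)) y
  · have e := apply_eq_of_assoc F c3
    simp [c1, c2, c3, ← e, h3]
  -- Off the three double cosets the product vanishes: a point of its support is a product of two
  -- integral matrices of similitude valuation 1.
  · simp only [c1, c2, c3, if_false, mul_zero, add_zero]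
    by_contra hne
    obtain ⟨a, b, ha, hb, rfl⟩ := charStd_mul_apply_ne_zero hne
    rw [assoc_siegel_iff] at ha hb
    rcases assoc_of_norm_simil_eq_sq (ha.1.mul hb.1) (by
      rw [simil_mul, norm_mul, ha.2, hb.2, ← zpow_add₀ (by exact_mod_cast (by omega : p ≠ 0))]
      norm_num) with c | c | c
    exacts [c1 c, c2 c, c3 c]

/-! ### The composites at arbitrary hyperspecial levels -/

theorem charStd_scalar_mul_inv : charStd (torusElt p 1 1 1 1 (by norm_num)) *
    charStd (scalarElt p (-1)) = 1 := by
  have h := charStd_center_mul (scalarElt_mem_center (p := p) 1) (scalarElt p 1)⁻¹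
  rwa [mul_inv_cancel, charStd_one, scalarElt_inv] at h

theorem charStd_scalar_inv_mul : charStd (scalarElt p (-1)) *
    charStd (torusElt p 1 1 1 1 (by norm_num)) = 1 := by
  rw [charStd_center_comm (scalarElt_mem_center _), charStd_scalar_mul_inv]

/-- The product is `diag(1, 1, p⁻¹, p⁻¹)`; reversing the indices gives the other matrix. -/
theorem assoc_scalar_mul_siegel : Assoc (scalarElt p (-1) * torusElt p 1 1 0 0 (by norm_num))
    (torusElt p (-1) (-1) 0 0 (by norm_num)) := by
  rw [scalarElt_mul_torusElt (h' := by norm_num)]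
  exact assoc_torusElt_perm _ _ _ _ _ _ _ _ _ _ 3 (by decide)

theorem charStd_siegel_inv : charStd (torusElt p (-1) (-1) 0 0 (by norm_num)) =
    charStd (scalarElt p (-1)) * charStd (torusElt p 1 1 0 0 (by norm_num)) := by
  rw [charStd_center_mul (scalarElt_mem_center _), charStd_congr assoc_scalar_mul_siegel]

theorem charStd_siegel_inv_mul : charStd (torusElt p (-1) (-1) 0 0 (by norm_num)) *
    charStd (torusElt p 1 1 0 0 (by norm_num)) =
    charStd (scalarElt p (-1)) * charStd (torusElt p 1 1 0 0 (by norm_num)) ^ 2 := by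
  rw [charStd_siegel_inv, sq, mul_assoc]

theorem charStd_siegel_mul_inv : charStd (torusElt p 1 1 0 0 (by norm_num)) *
    charStd (torusElt p (-1) (-1) 0 0 (by norm_num)) =
    charStd (scalarElt p (-1)) * charStd (torusElt p 1 1 0 0 (by norm_num)) ^ 2 := by
  rw [charStd_siegel_inv, ← mul_assoc, ← charStd_center_comm (scalarElt_mem_center _), sq,
    mul_assoc]

theorem scalar_inv_mul_siegel_sq :
    charStd (scalarElt p (-1)) * charStd (torusElt p 1 1 0 0 (by norm_num)) ^ 2 =
      charStd (scalarElt p (-1)) * charStd (torusElt p 2 2 0 0 (by norm_num)) +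
        ((p : heckeModule (hyperspecial p 1) (hyperspecial p 1)) + 1) *
          (charStd (scalarElt p (-1)) * charStd (torusElt p 2 1 1 0 (by norm_num))) +
        ((p : heckeModule (hyperspecial p 1) (hyperspecial p 1)) ^ 2 + 1) *
          ((p : heckeModule (hyperspecial p 1) (hyperspecial p 1)) + 1) := by
  rw [sq, charStd_siegel_sq, mul_add, mul_add, ← mul_assoc (charStd (scalarElt p (-1))) (Nat.cast _),
    ← mul_assoc (charStd (scalarElt p (-1))) (Nat.cast _), ← Nat.cast_comm, ← Nat.cast_comm,
    mul_assoc, mul_assoc, charStd_scalar_inv_mul]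
  push_cast
  rw [mul_one]

/-- Conjugation by `g` identifies the Hecke rings of `GSp₄(ℤ_p)` and `g GSp₄(ℤ_p) g⁻¹`. -/
noncomputable def levelHom (g : GSp4 ℚ_[p]) : heckeModule (hyperspecial p 1) (hyperspecial p 1) →+*
    heckeModule (hyperspecial p g) (hyperspecial p g) :=
  heckeModule.transportRingHom g (mem_hyperspecial_iff_one g)

theorem levelHom_charStd (g x : GSp4 ℚ_[p]) :
    levelHom g (charStd x) = charDoubleCoset p g g (g * x * g⁻¹) := transport_charStd g g x

/-- The intermediate level `h` drops out, so composites between different levels are products in the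
Hecke ring of `GSp₄(ℤ_p)`, carried to level `g`. -/
theorem conv_charDoubleCoset (g h x y : GSp4 ℚ_[p]) :
    heckeModule.conv (charDoubleCoset p g h (g * x * h⁻¹))
      (charDoubleCoset p h g (h * y * g⁻¹)) = levelHom g (charStd x * charStd y) := by
  rw [← transport_charStd, ← transport_charStd, heckeModule.conv_transport]
  rfl

theorem conv_T20_T02 (g₀ g₂ : GSp4 ℚ_[p]) : heckeModule.conv (T20 p g₀ g₂) (T02 p g₀ g₂) =
    levelHom g₀ (charStd (scalarElt p (-1)) *
      charStd (torusElt p 1 1 0 0 (by norm_num)) ^ 2) := by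
  rw [T20, T02, conv_charDoubleCoset, charStd_siegel_inv_mul]

theorem conv_T02_T20 (g₀ g₂ : GSp4 ℚ_[p]) : heckeModule.conv (T02 p g₀ g₂) (T20 p g₀ g₂) =
    levelHom g₂ (charStd (scalarElt p (-1)) *
      charStd (torusElt p 1 1 0 0 (by norm_num)) ^ 2) := by
  rw [T20, T02, conv_charDoubleCoset, charStd_siegel_mul_inv]

theorem isUnit_Tp0_and_inverse (g : GSp4 ℚ_[p]) :
    IsUnit (Tp0 p g) ∧ Ring.inverse (Tp0 p g) = levelHom g (charStd (scalarElt p (-1))) := by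
  have e : Tp0 p g = levelHom g (charStd (torusElt p 1 1 1 1 (by norm_num))) :=
    (levelHom_charStd g _).symm
  let w : (heckeModule (hyperspecial p g) (hyperspecial p g))ˣ :=
    ⟨levelHom g (charStd (torusElt p 1 1 1 1 (by norm_num))),
      levelHom g (charStd (scalarElt p (-1))), by
        rw [← map_mul, charStd_scalar_mul_inv, map_one], by
        rw [← map_mul, charStd_scalar_inv_mul, map_one]⟩
  have hw : Tp0 p g = (w : heckeModule (hyperspecial p g) (hyperspecial p g)) := e
  rw [hw]
  exact ⟨w.isUnit, Ring.inverse_unit w⟩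

theorem levelHom_eq (g : GSp4 ℚ_[p]) :
    levelHom g (charStd (scalarElt p (-1)) * charStd (torusElt p 1 1 0 0 (by norm_num)) ^ 2) =
      Ring.inverse (Tp0 p g) * Tpp2 p g +
        ((p : heckeModule (hyperspecial p g) (hyperspecial p g)) + 1) *
          (Ring.inverse (Tp0 p g) * Tp1 p g) +
        ((p : heckeModule (hyperspecial p g) (hyperspecial p g)) ^ 2 + 1) *
          ((p : heckeModule (hyperspecial p g) (hyperspecial p g)) + 1) := by
  rw [scalar_inv_mul_siegel_sq, (isUnit_Tp0_and_inverse g).2, Tpp2, Tp1, ← levelHom_charStd,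
    ← levelHom_charStd]
  simp only [map_add, map_mul, map_pow, map_natCast, map_one]

/-- If `T_{p,0}` acts as the identity, so does its inverse, and only `T_{p,2}²` is left of
`T_{p,0}⁻¹ T_{p,2}²`. -/
theorem levelHom_smul (g : GSp4 ℚ_[p]) {M : Type v} [AddCommGroup M]
    [Module (heckeModule (hyperspecial p g) (hyperspecial p g)) M]
    (h : ∀ m : M, Tp0 p g • m = m) (m : M) :
    levelHom g (charStd (scalarElt p (-1)) * charStd (torusElt p 1 1 0 0 (by norm_num)) ^ 2) • m =
      Tp2 p g ^ 2 • m := by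
  have hi : ∀ m : M, Ring.inverse (Tp0 p g) • m = m := by
    intro m
    conv_lhs => rw [← h m]
    rw [smul_smul, Ring.inverse_mul_cancel _ (isUnit_Tp0_and_inverse g).1, one_smul]
  rw [map_mul, mul_smul, ← (isUnit_Tp0_and_inverse g).2, hi, map_pow, levelHom_charStd]
  rfl

/-! ### Incidence correspondences of vertex lattices -/

theorem latticeStabilizer_latticeMap (g : GSp4 ℚ_[p]) :
    latticeStabilizer p (latticeMap p g (stdLattice p)) = hyperspecial p g := by
  ext x
  change latticeMap p x (latticeMap p g (stdLattice p)) = latticeMap p g (stdLattice p) ↔ _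
  rw [← latticeMap_mul, latticeMap_stdLattice_eq_iff, mem_hyperspecial, mul_assoc]

theorem hyperspecial_center_mul {a : GSp4 ℚ_[p]} (ha : a ∈ Subgroup.center (GSp4 ℚ_[p]))
    (g : GSp4 ℚ_[p]) : hyperspecial p (a * g) = hyperspecial p g := by
  ext x
  rw [mem_hyperspecial, mem_hyperspecial, mul_inv_rev, mul_assoc, mul_assoc, ← mul_assoc x,
    Subgroup.mem_center_iff.1 ha x]
  congr! 1
  group

theorem norm_simil_scalarElt (n : ℤ) : ‖simil (scalarElt p n)‖ = (p : ℝ) ^ (-(n + n)) :=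
  norm_simil_torusElt _ _ _ _ _

theorem norm_scalarElt_mul_apply (n : ℤ) (g : GSp4 ℚ_[p]) (i j : Fin 4) :
    ‖(scalarElt p n * g).1.1 i j‖ = (p : ℝ) ^ (-n) * ‖g.1.1 i j‖ := by
  rw [mul_val, scalarElt_val, Matrix.smul_mul, Matrix.one_mul, Matrix.smul_apply, smul_eq_mul,
    norm_mul, Padic.norm_p_zpow]

/-- Both sides say that all entries of `g` have norm at most `p`, because the entries of `g⁻¹` are,
up to sign, those of `g` divided by `c(g)`. -/
theorem isIntegral_scalarElt_mul_iff {g : GSp4 ℚ_[p]} (h : ‖simil g‖ = p) :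
    IsIntegral (scalarElt p 1 * g) ↔ IsIntegral g⁻¹ := by
  have hp : (0 : ℝ) < p := by exact_mod_cast (Fact.out : p.Prime).pos
  rw [isIntegral_inv_iff, h]
  refine forall₂_congr fun i j => ?_
  rw [norm_scalarElt_mul_apply, zpow_neg_one, inv_mul_le_iff₀ hp, mul_one]

/-- Membership of `x` means that `p h⁻¹ x g₀` is integral with similitude valuation 1. The valuation
makes `c(x)` a unit, and integrality then amounts to that of `(x g₀)⁻¹ h`, which is the inclusion of
lattices. -/
theorem T02_val {g₀ h : GSp4 ℚ_[p]} (h₀ : ‖simil g₀‖ = 1) (h₂ : ‖simil h‖ = (p : ℝ) ^ (-1 : ℤ)) :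
    (T02 p g₀ (scalarElt p (-1) * h)).1 = Set.indicator
      {x | IsVertexLatticeZero p (latticeMap p x (latticeMap p g₀ (stdLattice p))) ∧
        latticeMap p h (stdLattice p) ≤ latticeMap p x (latticeMap p g₀ (stdLattice p))} 1 := by
  have hp : (p : ℝ) ≠ 0 := by exact_mod_cast (Fact.out : p.Prime).ne_zero
  rw [T02, charDoubleCoset_val]
  congr 1
  ext x
  rw [Set.mem_ofPred_eq, Set.mem_ofPred_eq, assoc_siegel_iff, ← latticeMap_mul,
    isVertexLatticeZero_latticeMap, latticeMap_stdLattice_le_iff, mul_inv_rev, scalarElt_inv,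
    neg_neg, and_comm]
  have e : h⁻¹ * scalarElt p 1 * x * g₀ = scalarElt p 1 * (h⁻¹ * x * g₀) := by
    rw [Subgroup.mem_center_iff.1 (scalarElt_mem_center 1) h⁻¹]
    group
  have e' : (x * g₀)⁻¹ * h = (h⁻¹ * x * g₀)⁻¹ := by group
  have hs : ‖simil (h⁻¹ * x * g₀)‖ = p * ‖simil x‖ := by
    rw [simil_mul, simil_mul, simil_inv, norm_mul, norm_mul, norm_inv, h₀, h₂]
    simp
  rw [e, e', simil_mul, simil_mul x, norm_mul, norm_mul, hs, h₀, norm_simil_scalarElt, mul_one]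
  have hiff : (p : ℝ) ^ (-(1 + 1) : ℤ) * (p * ‖simil x‖) = (p : ℝ) ^ (-1 : ℤ) ↔
      ‖simil x‖ = 1 := by
    rw [← mul_assoc, ← zpow_add_one₀ hp]
    norm_num
    exact mul_eq_left₀ (inv_ne_zero hp)
  rw [hiff]
  refine and_congr_right fun hx => ?_
  rw [isIntegral_scalarElt_mul_iff (by rw [hs, hx, mul_one])]

/-- The scalar `p⁻¹` in the level cancels against the one relating `diag(p⁻¹, p⁻¹, 1, 1)` to
`diag(p, p, 1, 1)`, leaving the integrality criterion for `g₀⁻¹ x h`. -/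
theorem T20_val {g₀ h : GSp4 ℚ_[p]} (h₀ : ‖simil g₀‖ = 1) :
    (T20 p g₀ (scalarElt p (-1) * h)).1 = Set.indicator
      {x | IsVertexLatticeTwo p (latticeMap p x (latticeMap p h (stdLattice p))) ∧
        latticeMap p x (latticeMap p h (stdLattice p)) ≤ latticeMap p g₀ (stdLattice p)} 1 := by
  rw [T20, charDoubleCoset_val]
  congr 1
  ext x
  have e : g₀⁻¹ * x * (scalarElt p (-1) * h) = scalarElt p (-1) * (g₀⁻¹ * (x * h)) := by
    rw [← mul_assoc, Subgroup.mem_center_iff.1 (scalarElt_mem_center (-1))]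
    group
  have hassoc : Assoc (torusElt p (-1) (-1) 0 0 (by norm_num)) (g₀⁻¹ * x * (scalarElt p (-1) * h)) ↔
      Assoc (torusElt p 1 1 0 0 (by norm_num)) (g₀⁻¹ * (x * h)) := by
    rw [e]
    refine Iff.trans ⟨fun c => assoc_scalar_mul_siegel.trans c,
      fun c => assoc_scalar_mul_siegel.symm.trans c⟩ ?_
    rw [assoc_mul_left_center_iff (scalarElt_mem_center _), inv_mul_cancel_left]
  rw [Set.mem_ofPred_eq, Set.mem_ofPred_eq, hassoc, assoc_siegel_iff, ← latticeMap_mul,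
    isVertexLatticeTwo_latticeMap, latticeMap_stdLattice_le_iff, and_comm, simil_mul g₀⁻¹,
    simil_inv, norm_mul, norm_inv, h₀, inv_one, one_mul]

end padic

end GSp4

/-! ### The theorem -/

theorem lemma6p8 (p : ℕ) [Fact p.Prime] :
    -- the identities, and their consequence when `T_{p,0}` acts trivially, for all hyperspecial
    -- `K₀ = g₀ GSp₄(ℤ_p) g₀⁻¹` and `K₂ = g₂ GSp₄(ℤ_p) g₂⁻¹`
    (∀ g₀ g₂ : GSp4 ℚ_[p],
      (IsUnit (Tp0 p g₀) ∧
        heckeModule.conv (T20 p g₀ g₂) (T02 p g₀ g₂) =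
          Ring.inverse (Tp0 p g₀) * Tpp2 p g₀ +
            ((p : heckeModule (hyperspecial p g₀) (hyperspecial p g₀)) + 1) *
              (Ring.inverse (Tp0 p g₀) * Tp1 p g₀) +
            ((p : heckeModule (hyperspecial p g₀) (hyperspecial p g₀)) ^ 2 + 1) *
              ((p : heckeModule (hyperspecial p g₀) (hyperspecial p g₀)) + 1)) ∧
      (IsUnit (Tp0 p g₂) ∧
        heckeModule.conv (T02 p g₀ g₂) (T20 p g₀ g₂) =
          Ring.inverse (Tp0 p g₂) * Tpp2 p g₂ +
            ((p : heckeModule (hyperspecial p g₂) (hyperspecial p g₂)) + 1) *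
              (Ring.inverse (Tp0 p g₂) * Tp1 p g₂) +
            ((p : heckeModule (hyperspecial p g₂) (hyperspecial p g₂)) ^ 2 + 1) *
              ((p : heckeModule (hyperspecial p g₂) (hyperspecial p g₂)) + 1)) ∧
      (∀ (M : Type v) [AddCommGroup M]
        [Module (heckeModule (hyperspecial p g₀) (hyperspecial p g₀)) M],
        (∀ m : M, Tp0 p g₀ • m = m) →
          ∀ m : M, heckeModule.conv (T20 p g₀ g₂) (T02 p g₀ g₂) • m = Tp2 p g₀ ^ 2 • m) ∧
      (∀ (M : Type v) [AddCommGroup M]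
        [Module (heckeModule (hyperspecial p g₂) (hyperspecial p g₂)) M],
        (∀ m : M, Tp0 p g₂ • m = m) →
          ∀ m : M, heckeModule.conv (T02 p g₀ g₂) (T20 p g₀ g₂) • m = Tp2 p g₂ ^ 2 • m)) ∧
    -- the stabilizers of vertex lattices `Λ₂ ⊆ Λ₀` of types `2` and `0` are such a pair `K₂`, `K₀`,
    -- for which `T₀₂` and `T₂₀` are the incidence correspondences between the vertex lattices
    (∀ Λ₀ Λ₂ : Submodule ℤ_[p] (Fin 4 → ℚ_[p]),
      IsVertexLatticeZero p Λ₀ → IsVertexLatticeTwo p Λ₂ → Λ₂ ≤ Λ₀ →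
      ∃ g₀ g₂ : GSp4 ℚ_[p],
        latticeStabilizer p Λ₀ = hyperspecial p g₀ ∧
        latticeStabilizer p Λ₂ = hyperspecial p g₂ ∧
        (T02 p g₀ g₂).1 = Set.indicator
          {x | IsVertexLatticeZero p (latticeMap p x Λ₀) ∧ Λ₂ ≤ latticeMap p x Λ₀} 1 ∧
        (T20 p g₀ g₂).1 = Set.indicator
          {x | IsVertexLatticeTwo p (latticeMap p x Λ₂) ∧ latticeMap p x Λ₂ ≤ Λ₀} 1) := by
  refine ⟨fun g₀ g₂ => ⟨⟨(GSp4.isUnit_Tp0_and_inverse g₀).1, ?_⟩,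
    ⟨(GSp4.isUnit_Tp0_and_inverse g₂).1, ?_⟩, fun M _ _ hM m => ?_, fun M _ _ hM m => ?_⟩,
    fun Λ₀ Λ₂ h₀ h₂ _ => ?_⟩
  · rw [GSp4.conv_T20_T02, GSp4.levelHom_eq]
  · rw [GSp4.conv_T02_T20, GSp4.levelHom_eq]
  · rw [GSp4.conv_T20_T02, GSp4.levelHom_smul g₀ hM]
  · rw [GSp4.conv_T02_T20, GSp4.levelHom_smul g₂ hM]
  · obtain ⟨g₀, rfl⟩ := GSp4.exists_latticeMap_eq_of_zero h₀
    obtain ⟨h, rfl⟩ := GSp4.exists_latticeMap_eq_of_two h₂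
    rw [GSp4.isVertexLatticeZero_latticeMap] at h₀
    rw [GSp4.isVertexLatticeTwo_latticeMap] at h₂
    -- The twist by `p⁻¹` leaves the stabilizer of `Λ₂` unchanged and makes the elements defining
    -- `T₀₂` and `T₂₀` have unit similitude factor, so that translation by them preserves the types.
    refine ⟨g₀, GSp4.scalarElt p (-1) * h, GSp4.latticeStabilizer_latticeMap g₀, ?_,
      GSp4.T02_val h₀ h₂, GSp4.T20_val h₀⟩
    rw [GSp4.hyperspecial_center_mul (GSp4.scalarElt_mem_center _),
      GSp4.latticeStabilizer_latticeMap]
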